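/- Let $\Bbbk$ be a field of characteristic zero. A \emph{complete dg Lie algebra} is an unbounded dg Lie algebra $L=\{L^i\}_{i\in\mathbb Z}$ over $\Bbbk$ (differential of degree $+1$; we write $L_n=L^{-n}$ and $H_n(L)=H^{-n}(L)$) with a decreasing filtration by subcomplexes $L=F^1L\supseteq F^2L\supseteq\cdots$ such that $[F^pL,F^qL]\subseteq F^{p+q}L$ and $L\to\varprojlim_a L/F^aL$ is an isomorphism; morphisms are the morphisms of dg Lie algebras that preserve the filtrations. Let $\Omega_\bullet$ be the simplicial commutative dg algebra of polynomial differential forms, $\Omega_n=\Bbbk[t_0,\dots,t_n,dt_0,\dots,dt_n]/(\sum t_i-1,\ \sum dt_i)$, let $\Omega_\bullet(L)=\Omega_\bullet\widehat\otimes L=\varprojlim_a\Omega_\bullet\otimes L/F^aL$ with $d(\omega\otimes x)=d\omega\otimes x+(-1)^{|\omega|}\omega\otimes dx$ and $[\omega\otimes x,\eta\otimes y]=(-1)^{|x||\eta|}\omega\eta\otimes[x,y]$, and let $L_\bullet=Z^0\Omega_\bullet(L)$ be the simplicial Lie algebra of its cocycles of degree zero. For a simplicial Lie algebra $X_\bullet$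 let $NX_\bullet$ be its normalized chains, $N_nX=\bigcap_{i=1}^n\ker(\partial_i\colon X_n\to X_{n-1})$ with differential $\partial=\sum_i(-1)^i\partial_i$, and with the bracket of $x\in N_pX$ and $y\in N_qX$ given by $$[x,y]=\sum_{(\mu,\nu)}\operatorname{sgn}(\mu,\nu)\,[s_{\nu_q}\cdots s_{\nu_1}x,\ s_{\mu_p}\cdots s_{\mu_1}y],$$ the sum being over all $(p,q)$-shuffles $(\mu_1<\dots<\mu_p,\ \nu_1<\dots<\nu_q)$ of $\{0,\dots,p+q-1\}$. \textbf{Theorem.} For every complete dg Lie algebra $L$, $NL_\bullet$ is a dg Lie algebra, and the maps $$I\colon\Omega_n^n\widehat\otimes L_n\to L_n,\qquad I(\omega\otimes x)=(-1)^{\binom n2}\int_{\Delta^n}\omega\cdot x,$$ applied to the component in $\Omega^n_n\widehat\otimes L_n$ of an element of $N_nL_\bullet\subseteq Z^0\Omega_n(L)$, define a morphism of dg Lie algebras $I\colon NL_\bullet\to L$, natural in $L$ with respect to morphisms of complete dg Lie algebras, which induces isomorphisms $H_n(NL_\bullet)\to H_n(L)$ for all $n\ge 0$. Consequently $I$ is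 a quasi-isomorphism if and only if $H_n(L)=0$ for all $n<0$ (for example if $L$ is concentrated in non-negative homological degrees). -/

import Mathlib

open scoped TensorProduct

universe u v w

namespace LieDoldKan

/-! ## Polynomial differential forms on the standard simplices -/

/-- The generators `t_0, …, t_n, dt_0, …, dt_n`. -/
inductive FormGen (n : ℕ) : Type
  | t (i : Fin (n + 1)) : FormGen n
  | dt (i : Fin (n + 1)) : FormGen n

/-- The relations: graded commutativity of the generators (`t_i` in degree 0, `dt_i` in degree 1;
over a field of characteristic zero this forces `dt_i ^ 2 = 0`), `∑ t_i = 1` and `∑ dt_i = 0`. -/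
inductive FormRel (k : Type u) [Field k] (n : ℕ) :
    FreeAlgebra k (FormGen n) → FreeAlgebra k (FormGen n) → Prop
  | t_t (i j : Fin (n + 1)) : FormRel k n
      (FreeAlgebra.ι k (FormGen.t i) * FreeAlgebra.ι k (FormGen.t j))
      (FreeAlgebra.ι k (FormGen.t j) * FreeAlgebra.ι k (FormGen.t i))
  | t_dt (i j : Fin (n + 1)) : FormRel k n
      (FreeAlgebra.ι k (FormGen.t i) * FreeAlgebra.ι k (FormGen.dt j))
      (FreeAlgebra.ι k (FormGen.dt j) * FreeAlgebra.ι k (FormGen.t i))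
  | dt_dt (i j : Fin (n + 1)) : FormRel k n
      (FreeAlgebra.ι k (FormGen.dt i) * FreeAlgebra.ι k (FormGen.dt j))
      (-(FreeAlgebra.ι k (FormGen.dt j) * FreeAlgebra.ι k (FormGen.dt i)))
  | sum_t : FormRel k n (∑ i, FreeAlgebra.ι k (FormGen.t i)) 1
  | sum_dt : FormRel k n (∑ i, FreeAlgebra.ι k (FormGen.dt i)) 0

/-- `Ω_n = k[t_0, …, t_n, dt_0, …, dt_n] / (∑ t_i - 1, ∑ dt_i)`, the free graded commutative
algebra on the generators modulo the dg ideal generated by `∑ t_i - 1`. -/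
def Forms (k : Type u) [Field k] (n : ℕ) : Type u := RingQuot (FormRel k n)

namespace Forms

instance (k : Type u) [Field k] (n : ℕ) : Ring (Forms k n) :=
  inferInstanceAs (Ring (RingQuot (FormRel k n)))

instance (k : Type u) [Field k] (n : ℕ) : Algebra k (Forms k n) :=
  inferInstanceAs (Algebra k (RingQuot (FormRel k n)))

variable {k : Type u} [Field k] {n m l : ℕ}

/-- The quotient map from the free algebra. -/
def mk (k : Type u) [Field k] (n : ℕ) : FreeAlgebra k (FormGen n) →ₐ[k] Forms k n :=
  RingQuot.mkAlgHom k (FormRel k n)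

/-- The barycentric coordinate `t_i`. -/
def t (k : Type u) [Field k] {n : ℕ} (i : Fin (n + 1)) : Forms k n :=
  mk k n (FreeAlgebra.ι k (FormGen.t i))

/-- The one-form `dt_i`. -/
def dt (k : Type u) [Field k] {n : ℕ} (i : Fin (n + 1)) : Forms k n :=
  mk k n (FreeAlgebra.ι k (FormGen.dt i))

theorem mk_rel {x y : FreeAlgebra k (FormGen n)} (h : FormRel k n x y) : mk k n x = mk k n y :=
  RingQuot.mkAlgHom_rel k h

theorem t_mul_t (i j : Fin (n + 1)) : t k i * t k j = t k j * t k i := by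
  simpa [t] using mk_rel (FormRel.t_t (k := k) i j)

theorem t_mul_dt (i j : Fin (n + 1)) : t k i * dt k j = dt k j * t k i := by
  simpa [t, dt] using mk_rel (FormRel.t_dt (k := k) i j)

theorem dt_mul_dt (i j : Fin (n + 1)) : dt k i * dt k j = -(dt k j * dt k i) := by
  simpa [dt] using mk_rel (FormRel.dt_dt (k := k) i j)

theorem sum_t : ∑ i : Fin (n + 1), t k i = 1 := by
  simpa [t] using mk_rel (FormRel.sum_t (k := k) (n := n))

theorem sum_dt : ∑ i : Fin (n + 1), dt k i = 0 := by
  simpa [dt] using mk_rel (FormRel.sum_dt (k := k) (n := n))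

/-- The universal property of `Ω_n`. -/
def lift {A : Type w} [Ring A] [Algebra k A] (a b : Fin (n + 1) → A)
    (haa : ∀ i j, a i * a j = a j * a i) (hab : ∀ i j, a i * b j = b j * a i)
    (hbb : ∀ i j, b i * b j = -(b j * b i)) (ha : ∑ i, a i = 1) (hb : ∑ i, b i = 0) :
    Forms k n →ₐ[k] A :=
  RingQuot.liftAlgHom k ⟨FreeAlgebra.lift k (fun g => match g with
      | FormGen.t i => a i
      | FormGen.dt i => b i), by
    intro x y h
    cases h with
    | t_t i j => simpa using haa i j
    | t_dt i j => simpa using hab i j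
    | dt_dt i j => simpa using hbb i j
    | sum_t => simpa using ha
    | sum_dt => simpa using hb⟩

section
variable {A : Type w} [Ring A] [Algebra k A] {a b : Fin (n + 1) → A}
    {haa : ∀ i j, a i * a j = a j * a i} {hab : ∀ i j, a i * b j = b j * a i}
    {hbb : ∀ i j, b i * b j = -(b j * b i)} {ha : ∑ i, a i = 1} {hb : ∑ i, b i = 0}

@[simp] theorem lift_t (i : Fin (n + 1)) : lift (k := k) a b haa hab hbb ha hb (t k i) = a i := by
  unfold lift t mk
  erw [RingQuot.liftAlgHom_mkAlgHom_apply]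
  simp

@[simp] theorem lift_dt (i : Fin (n + 1)) :
    lift (k := k) a b haa hab hbb ha hb (dt k i) = b i := by
  unfold lift dt mk
  erw [RingQuot.liftAlgHom_mkAlgHom_apply]
  simp
end

/-- Algebra maps out of `Ω_n` are determined by the generators. -/
theorem algHom_ext {A : Type w} [Semiring A] [Algebra k A] {f g : Forms k n →ₐ[k] A}
    (ht : ∀ i, f (t k i) = g (t k i)) (hd : ∀ i, f (dt k i) = g (dt k i)) : f = g := by
  refine RingQuot.ringQuot_ext' k f g ?_
  apply FreeAlgebra.hom_ext
  funext x
  cases x with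
  | t i => exact ht i
  | dt i => exact hd i

theorem induction {p : Forms k n → Prop} (hc : ∀ c : k, p (algebraMap k _ c))
    (ht : ∀ i, p (t k i)) (hd : ∀ i, p (dt k i)) (hadd : ∀ x y, p x → p y → p (x + y))
    (hmul : ∀ x y, p x → p y → p (x * y)) (x : Forms k n) : p x := by
  obtain ⟨y, rfl⟩ := RingQuot.mkAlgHom_surjective k (FormRel k n) x
  change p (mk k n y)
  induction y using FreeAlgebra.induction with
  | grade0 r => simpa using hc r
  | grade1 x =>
    cases x with
    | t i => exact ht i
    | dt i => exact hd i
  | mul a b ha hb => rw [map_mul]; exact hmul _ _ ha hb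
  | add a b ha hb => rw [map_add]; exact hadd _ _ ha hb

/-- The parity automorphism, `ω ↦ (-1) ^ |ω| ω`. -/
def parity (k : Type u) [Field k] (n : ℕ) : Forms k n →ₐ[k] Forms k n :=
  lift (t k) (fun i => -dt k i) t_mul_t (fun i j => by simp [t_mul_dt i j])
    (fun i j => by simpa using dt_mul_dt i j) sum_t (by simp [sum_dt])

@[simp] theorem parity_t (i : Fin (n + 1)) : parity k n (t k i) = t k i := by simp [parity]
@[simp] theorem parity_dt (i : Fin (n + 1)) : parity k n (dt k i) = -dt k i := by simp [parity]

/-- Auxiliary algebra map `ω ↦ !![parity ω, D ω; 0, ω]`, where `D` is the antiderivation with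
`D t_i = a i` and `D dt_i = b i`. -/
def antiderHom (a b : Fin (n + 1) → Forms k n)
    (hat : ∀ i j, a i * t k j = t k j * a i) (had : ∀ i j, a i * dt k j = -(dt k j * a i))
    (hbt : ∀ i j, b i * t k j = t k j * b i) (hbd : ∀ i j, b i * dt k j = dt k j * b i)
    (ha : ∑ i, a i = 0) (hb : ∑ i, b i = 0) :
    Forms k n →ₐ[k] Matrix (Fin 2) (Fin 2) (Forms k n) :=
  lift (fun i => !![t k i, a i; 0, t k i]) (fun i => !![-dt k i, b i; 0, dt k i])
    (fun i j => by
      have h1 := hat i j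
      have h2 := hat j i
      simp only [Matrix.mul_fin_two, mul_zero, zero_mul, add_zero, zero_add, t_mul_t i j, h1, h2]
      rw [add_comm])
    (fun i j => by
      have h1 := had i j
      have h2 := hbt j i
      simp only [Matrix.mul_fin_two, mul_zero, zero_mul, add_zero, zero_add, t_mul_dt i j, h1, h2,
        mul_neg, neg_mul, neg_zero]
      rw [add_comm])
    (fun i j => by
      have h1 := hbd i j
      have h2 := hbd j i
      ext x y
      fin_cases x <;> fin_cases y <;>
      simp [Matrix.mul_apply, Fin.sum_univ_two, h1, h2]
      · exact dt_mul_dt i j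
      · exact dt_mul_dt i j)
    (by
      ext x y
      fin_cases x <;> fin_cases y <;> simp [Matrix.sum_apply, ha, sum_t])
    (by
      ext x y
      fin_cases x <;> fin_cases y <;> simp [Matrix.sum_apply, hb, sum_dt])

section
variable (a b : Fin (n + 1) → Forms k n)
    (hat : ∀ i j, a i * t k j = t k j * a i) (had : ∀ i j, a i * dt k j = -(dt k j * a i))
    (hbt : ∀ i j, b i * t k j = t k j * b i) (hbd : ∀ i j, b i * dt k j = dt k j * b i)
    (ha : ∑ i, a i = 0) (hb : ∑ i, b i = 0)

/-- The antiderivation of `Ω_n` with prescribed values `a i` on `t_i` and `b i` on `dt_i`. -/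
def antider : Forms k n →ₗ[k] Forms k n where
  toFun x := antiderHom a b hat had hbt hbd ha hb x 0 1
  map_add' x y := by simp
  map_smul' c x := by simp

theorem antiderHom_entries (x : Forms k n) :
    antiderHom a b hat had hbt hbd ha hb x 0 0 = parity k n x ∧
    antiderHom a b hat had hbt hbd ha hb x 1 0 = 0 ∧
    antiderHom a b hat had hbt hbd ha hb x 1 1 = x := by
  induction x using Forms.induction with
  | hc c => simp [Matrix.algebraMap_matrix_apply]
  | ht i => simp [antiderHom]
  | hd i => simp [antiderHom]
  | hadd x y hx hy => simp [hx, hy]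
  | hmul x y hx hy => simp [hx, hy, Matrix.mul_apply, Fin.sum_univ_two]

@[simp] theorem antider_t (i : Fin (n + 1)) :
    antider a b hat had hbt hbd ha hb (t k i) = a i := by simp [antider, antiderHom]

@[simp] theorem antider_dt (i : Fin (n + 1)) :
    antider a b hat had hbt hbd ha hb (dt k i) = b i := by simp [antider, antiderHom]

theorem antider_mul (x y : Forms k n) :
    antider a b hat had hbt hbd ha hb (x * y) =
      antider a b hat had hbt hbd ha hb x * y +
        parity k n x * antider a b hat had hbt hbd ha hb y := by
  simp only [antider, LinearMap.coe_mk, AddHom.coe_mk, map_mul, Matrix.mul_apply,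
    Fin.sum_univ_two, (antiderHom_entries a b hat had hbt hbd ha hb x).1,
    (antiderHom_entries a b hat had hbt hbd ha hb y).2.2]
  rw [add_comm]
end

/-- The exterior derivative: the antiderivation with `d t_i = dt_i` and `d dt_i = 0`. -/
def d (k : Type u) [Field k] (n : ℕ) : Forms k n →ₗ[k] Forms k n :=
  antider (dt k) 0 (fun i j => (t_mul_dt j i).symm) dt_mul_dt (by simp) (by simp) sum_dt (by simp)

/-- Contraction with the constant vector field `∑ v_i ∂/∂t_i` (where `∑ v_i = 0`):
the antiderivation with `t_i ↦ 0` and `dt_i ↦ v_i`. -/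
def contract (v : Fin (n + 1) → k) (hv : ∑ i, v i = 0) : Forms k n →ₗ[k] Forms k n :=
  antider 0 (fun i => algebraMap k _ (v i)) (by simp) (by simp)
    (fun i j => Algebra.commutes _ _) (fun i j => Algebra.commutes _ _) (by simp)
    (by rw [← map_sum, hv, map_zero])

/-- Contraction with `∂/∂t_{i+1}` in the affine coordinates `t_1, …, t_n` of the `n`-simplex. -/
def contractCoord (k : Type u) [Field k] (n : ℕ) (i : Fin n) : Forms k n →ₗ[k] Forms k n :=
  contract (Pi.single i.succ 1 - Pi.single 0 1) (by simp)

/-- The projection `Ω_n → Ω_n^0 = k[t_1, …, t_n]`, which sends `t_0` to `1 - t_1 - … - t_n`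
and every `dt_i` to zero. The variable `X i` stands for `t_{i+1}`. -/
noncomputable def toPoly (k : Type u) [Field k] (n : ℕ) :
    Forms k n →ₐ[k] MvPolynomial (Fin n) k :=
  lift (Fin.cons (1 - ∑ i, MvPolynomial.X i) MvPolynomial.X) 0 (fun i j => mul_comm _ _)
    (by simp) (by simp) (by simp [Fin.sum_univ_succ]) (by simp)

/-- Integration of a polynomial over the simplex `{t_1, …, t_n ≥ 0, t_1 + … + t_n ≤ 1}`:
`∫ t^a dt_1 ⋯ dt_n = a_1! ⋯ a_n! / (n + a_1 + … + a_n)!`. -/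
noncomputable def polyIntegral (k : Type u) [Field k] (n : ℕ) : MvPolynomial (Fin n) k →ₗ[k] k :=
  (MvPolynomial.basisMonomials (Fin n) k).constr k fun a =>
    (∏ i, ((a i).factorial : k)) / ((n + ∑ i, a i).factorial : k)

/-- Integration over the simplex, `∫_{Δ^n} f dt_1 ⋯ dt_n = ∫ f`, for `f` in `k[t_1, …, t_n]`:
contract successively with `∂/∂t_1, …, ∂/∂t_n`, and integrate the resulting polynomial. -/
noncomputable def integral (k : Type u) [Field k] (n : ℕ) : Forms k n →ₗ[k] k :=
  polyIntegral k n ∘ₗ (toPoly k n).toLinearMap ∘ₗ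
    (((List.ofFn (contractCoord k n)).reverse.prod : Module.End k (Forms k n)) :
      Forms k n →ₗ[k] Forms k n)

/-- The simplicial operator of a monotone map `φ : [m] → [n]`,
`t_i ↦ ∑_{φ j = i} t_j` and `dt_i ↦ ∑_{φ j = i} dt_j`. -/
def op (φ : Fin (m + 1) →o Fin (n + 1)) : Forms k n →ₐ[k] Forms k m :=
  lift (fun i => ∑ j with φ j = i, t k j) (fun i => ∑ j with φ j = i, dt k j)
    (fun i j => Commute.sum_left _ _ _ fun x _ => Commute.sum_right _ _ _ fun y _ => t_mul_t x y)
    (fun i j => Commute.sum_left _ _ _ fun x _ => Commute.sum_right _ _ _ fun y _ => t_mul_dt x y)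
    (fun i j => by
      simp only [Finset.sum_mul_sum]
      rw [Finset.sum_comm, ← Finset.sum_neg_distrib]
      refine Finset.sum_congr rfl fun x _ => ?_
      rw [← Finset.sum_neg_distrib]
      exact Finset.sum_congr rfl fun y _ => dt_mul_dt y x)
    (by rw [Finset.sum_fiberwise]; exact sum_t) (by rw [Finset.sum_fiberwise]; exact sum_dt)

@[simp] theorem op_t (φ : Fin (m + 1) →o Fin (n + 1)) (i : Fin (n + 1)) :
    op φ (t k i) = ∑ j with φ j = i, t k j := by
  unfold op; exact lift_t i
@[simp] theorem op_dt (φ : Fin (m + 1) →o Fin (n + 1)) (i : Fin (n + 1)) :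
    op φ (dt k i) = ∑ j with φ j = i, dt k j := by
  unfold op; exact lift_dt i

theorem op_id : op (k := k) (OrderHom.id : Fin (n + 1) →o Fin (n + 1)) = AlgHom.id k _ := by
  apply algHom_ext <;> intro i <;> simp [Finset.filter_eq']

theorem op_comp (φ : Fin (m + 1) →o Fin (n + 1)) (ψ : Fin (l + 1) →o Fin (m + 1)) :
    op (k := k) (φ.comp ψ) = (op ψ).comp (op φ) := by
  apply algHom_ext <;> intro i <;>
  · simp only [op_t, op_dt, OrderHom.comp_coe, Function.comp_apply, AlgHom.comp_apply, map_sum]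
    rw [← Finset.sum_fiberwise_of_maps_to (g := ψ) (t := Finset.univ.filter fun j => φ j = i)
      (by simp)]
    refine Finset.sum_congr rfl fun j hj => Finset.sum_congr ?_ fun _ _ => rfl
    ext x
    simp only [Finset.mem_filter, Finset.mem_univ, true_and] at hj ⊢
    constructor
    · exact fun h => h.2
    · rintro rfl; exact ⟨hj, rfl⟩

@[simp] theorem d_t (i : Fin (n + 1)) : d k n (t k i) = dt k i := by simp [d]
@[simp] theorem d_dt (i : Fin (n + 1)) : d k n (dt k i) = 0 := by simp [d]

theorem d_mul' (x y : Forms k n) :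
    d k n (x * y) = d k n x * y + parity k n x * d k n y := antider_mul ..

@[simp] theorem d_algebraMap (c : k) : d k n (algebraMap k _ c) = 0 := by
  have h := d_mul' (1 : Forms k n) 1
  simp only [mul_one, one_mul, map_one] at h
  rw [Algebra.algebraMap_eq_smul_one, map_smul, left_eq_add.mp h, smul_zero]

theorem op_parity (φ : Fin (m + 1) →o Fin (n + 1)) (x : Forms k n) :
    op φ (parity k n x) = parity k m (op φ x) := by
  have : (op (k := k) φ).comp (parity k n) = (parity k m).comp (op φ) := by
    apply algHom_ext <;> intro i <;> simp
  exact DFunLike.congr_fun this x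

theorem op_d (φ : Fin (m + 1) →o Fin (n + 1)) (x : Forms k n) :
    op φ (d k n x) = d k m (op φ x) := by
  induction x using Forms.induction with
  | hc c => simp
  | ht i => simp
  | hd i => simp
  | hadd x y hx hy => simp [hx, hy]
  | hmul x y hx hy => simp [d_mul', hx, hy, op_parity]

theorem parity_d (x : Forms k n) : parity k n (d k n x) = -d k n (parity k n x) := by
  induction x using Forms.induction with
  | hc c => simp
  | ht i => simp
  | hd i => simp
  | hadd x y hx hy => simp [hx, hy]; abel
  | hmul x y hx hy => simp [d_mul', hx, hy]; abel

theorem parity_parity (x : Forms k n) : parity k n (parity k n x) = x := by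
  have : (parity k n).comp (parity k n) = AlgHom.id k _ := by
    apply algHom_ext <;> intro i <;> simp
  exact DFunLike.congr_fun this x

theorem d_d (x : Forms k n) : d k n (d k n x) = 0 := by
  induction x using Forms.induction with
  | hc c => simp
  | ht i => simp
  | hd i => simp
  | hadd x y hx hy => simp [hx, hy]
  | hmul x y hx hy => simp [d_mul', hx, hy, parity_d]

/-- The subspace spanned by the polynomials in the `t_i`. -/
def polys (k : Type u) [Field k] (n : ℕ) : Submodule k (Forms k n) :=
  Subalgebra.toSubmodule (Algebra.adjoin k (Set.range (t k)))

/-- The subspace spanned by the `dt_i`. -/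
def dts (k : Type u) [Field k] (n : ℕ) : Submodule k (Forms k n) :=
  Submodule.span k (Set.range (dt k))

/-- `Ω_n^p`, the span of all `f * dt_{i_1} * ⋯ * dt_{i_p}` with `f` a polynomial in the `t_i`. -/
def gr (k : Type u) [Field k] (n p : ℕ) : Submodule k (Forms k n) :=
  polys k n * dts k n ^ p


theorem polys_comm {f : Forms k n} (hf : f ∈ polys k n) (x : Forms k n) : f * x = x * f := by
  induction x using Forms.induction with
  | hc c => exact (Algebra.commutes _ _).symm
  | ht i =>
    induction hf using Algebra.adjoin_induction with
    | mem y hy => obtain ⟨j, rfl⟩ := hy; exact t_mul_t _ _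
    | algebraMap c => exact Algebra.commutes _ _
    | add a b _ _ ha hb => rw [add_mul, mul_add, ha, hb]
    | mul a b _ _ ha hb => rw [mul_assoc, hb, ← mul_assoc, ha, mul_assoc]
  | hd i =>
    induction hf using Algebra.adjoin_induction with
    | mem y hy => obtain ⟨j, rfl⟩ := hy; exact t_mul_dt _ _
    | algebraMap c => exact Algebra.commutes _ _
    | add a b _ _ ha hb => rw [add_mul, mul_add, ha, hb]
    | mul a b _ _ ha hb => rw [mul_assoc, hb, ← mul_assoc, ha, mul_assoc]
  | hadd x y hx hy => rw [mul_add, add_mul, hx, hy]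
  | hmul x y hx hy => rw [← mul_assoc, hx, mul_assoc, hy, mul_assoc]

theorem polys_mul {f g : Forms k n} (hf : f ∈ polys k n) (hg : g ∈ polys k n) :
    f * g ∈ polys k n := mul_mem (S := Subalgebra k (Forms k n)) hf hg

theorem gr_induction {p : ℕ} {P : ∀ x, x ∈ gr k n p → Prop}
    (hmul : ∀ f (hf : f ∈ polys k n) w (hw : w ∈ dts k n ^ p),
      P (f * w) (Submodule.mul_mem_mul hf hw))
    (hadd : ∀ x hx y hy, P x hx → P y hy → P (x + y) (add_mem hx hy))
    {x : Forms k n} (hx : x ∈ gr k n p) : P x hx :=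
  Submodule.mul_induction_on' hmul hadd hx

theorem mul_mem_gr {p q r : ℕ} (h : p + q = r) {x y : Forms k n} (hx : x ∈ gr k n p)
    (hy : y ∈ gr k n q) : x * y ∈ gr k n r := by
  subst h
  induction hx using gr_induction with
  | hadd a _ b _ ha hb => rw [add_mul]; exact add_mem ha hb
  | hmul f hf w hw =>
    induction hy using gr_induction with
    | hadd a _ b _ ha hb => rw [mul_add]; exact add_mem ha hb
    | hmul g hg v hv =>
      have : f * w * (g * v) = f * g * (w * v) := by
        rw [mul_assoc, ← mul_assoc w, ← polys_comm hg w]; simp only [mul_assoc]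
      rw [this, gr, pow_add]
      exact Submodule.mul_mem_mul (polys_mul hf hg) (Submodule.mul_mem_mul hw hv)

theorem parity_polys {f : Forms k n} (hf : f ∈ polys k n) : parity k n f = f := by
  induction hf using Algebra.adjoin_induction with
  | mem y hy => obtain ⟨j, rfl⟩ := hy; simp
  | algebraMap c => simp
  | add a b _ _ ha hb => rw [map_add, ha, hb]
  | mul a b _ _ ha hb => rw [map_mul, ha, hb]

theorem parity_dts {w : Forms k n} (hw : w ∈ dts k n) : parity k n w = -w := by
  induction hw using Submodule.span_induction with
  | mem y hy => obtain ⟨j, rfl⟩ := hy; simp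
  | zero => simp
  | add a b _ _ ha hb => rw [map_add, ha, hb, neg_add]
  | smul c a _ ha => rw [map_smul, ha, smul_neg]

theorem parity_dts_pow {p : ℕ} {w : Forms k n} (hw : w ∈ dts k n ^ p) :
    parity k n w = (-1 : k) ^ p • w := by
  induction p generalizing w with
  | zero =>
    rw [pow_zero] at hw
    obtain ⟨c, rfl⟩ := Submodule.mem_one.mp hw
    simp
  | succ p ih =>
    rw [pow_succ] at hw
    induction hw using Submodule.mul_induction_on' with
    | mem_mul_mem a ha b hb => rw [map_mul, ih ha, parity_dts hb]; simp [pow_succ]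
    | add a _ b _ ha hb => rw [map_add, ha, hb, smul_add]

theorem parity_gr {p : ℕ} {x : Forms k n} (hx : x ∈ gr k n p) :
    parity k n x = (-1 : k) ^ p • x := by
  induction hx using gr_induction with
  | hadd a _ b _ ha hb => rw [map_add, ha, hb, smul_add]
  | hmul f hf w hw => rw [map_mul, parity_polys hf, parity_dts_pow hw, mul_smul_comm]

theorem dts_anticomm {v w : Forms k n} (hv : v ∈ dts k n) (hw : w ∈ dts k n) :
    v * w = -(w * v) := by
  induction hv using Submodule.span_induction with
  | mem y hy =>
    obtain ⟨j, rfl⟩ := hy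
    induction hw using Submodule.span_induction with
    | mem z hz => obtain ⟨i, rfl⟩ := hz; exact dt_mul_dt _ _
    | zero => simp
    | add a b _ _ ha hb => rw [mul_add, add_mul, ha, hb, neg_add]
    | smul c a _ ha => rw [mul_smul_comm, ha, smul_mul_assoc, smul_neg]
  | zero => simp
  | add a b _ _ ha hb => rw [mul_add, add_mul, ha, hb, neg_add]
  | smul c a _ ha => rw [mul_smul_comm, smul_mul_assoc, ha, smul_neg]

theorem dts_comm_pow {q : ℕ} {v w : Forms k n} (hv : v ∈ dts k n) (hw : w ∈ dts k n ^ q) :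
    v * w = (-1 : k) ^ q • (w * v) := by
  induction q generalizing w with
  | zero =>
    rw [pow_zero] at hw
    obtain ⟨c, rfl⟩ := Submodule.mem_one.mp hw
    simpa using (Algebra.commutes c v).symm
  | succ p ih =>
    rw [pow_succ] at hw
    induction hw using Submodule.mul_induction_on' with
    | mem_mul_mem a ha b hb =>
      rw [← mul_assoc, ih ha, smul_mul_assoc, mul_assoc, dts_anticomm hv hb]
      simp [pow_succ, mul_assoc]
    | add a _ b _ ha hb => rw [mul_add, add_mul, ha, hb, smul_add]

theorem dts_pow_comm {p q : ℕ} {v w : Forms k n} (hv : v ∈ dts k n ^ p) (hw : w ∈ dts k n ^ q) :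
    v * w = (-1 : k) ^ (p * q) • (w * v) := by
  induction p generalizing v with
  | zero =>
    rw [pow_zero] at hv
    obtain ⟨c, rfl⟩ := Submodule.mem_one.mp hv
    simpa using Algebra.commutes c w
  | succ p ih =>
    rw [pow_succ] at hv
    induction hv using Submodule.mul_induction_on' with
    | mem_mul_mem a ha b hb =>
      rw [mul_assoc, dts_comm_pow hb hw, mul_smul_comm, ← mul_assoc, ih ha, smul_mul_assoc,
        smul_smul, mul_assoc, ← pow_add]
      congr 2; ring
    | add a _ b _ ha hb => rw [mul_add, add_mul, ha, hb, smul_add]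

/-- Graded commutativity. -/
theorem gr_comm {p q : ℕ} {x y : Forms k n} (hx : x ∈ gr k n p) (hy : y ∈ gr k n q) :
    x * y = (-1 : k) ^ (p * q) • (y * x) := by
  induction hx using gr_induction with
  | hadd a _ b _ ha hb => rw [mul_add, add_mul, ha, hb, smul_add]
  | hmul f hf w hw =>
    induction hy using gr_induction with
    | hadd a _ b _ ha hb => rw [mul_add, add_mul, ha, hb, smul_add]
    | hmul g hg v hv =>
      have h1 : f * w * (g * v) = f * g * (w * v) := by
        rw [mul_assoc, ← mul_assoc w, ← polys_comm hg w]; simp only [mul_assoc]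
      have h2 : g * v * (f * w) = g * f * (v * w) := by
        rw [mul_assoc, ← mul_assoc v, ← polys_comm hf v]; simp only [mul_assoc]
      rw [h1, h2, dts_pow_comm hw hv, mul_smul_comm, polys_comm hf g]

theorem d_mul {p : ℕ} {x : Forms k n} (hx : x ∈ gr k n p) (y : Forms k n) :
    d k n (x * y) = d k n x * y + (-1 : k) ^ p • (x * d k n y) := by
  rw [d_mul', parity_gr hx, smul_mul_assoc]

theorem d_polys {f : Forms k n} (hf : f ∈ polys k n) : d k n f ∈ polys k n * dts k n := by
  induction hf using Algebra.adjoin_induction with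
  | mem y hy =>
    obtain ⟨j, rfl⟩ := hy
    rw [d_t, ← one_mul (dt k j)]
    exact Submodule.mul_mem_mul (one_mem (Algebra.adjoin k (Set.range (t k))))
      (Submodule.subset_span ⟨j, rfl⟩)
  | algebraMap c => simp
  | add a b _ _ ha hb => rw [map_add]; exact add_mem ha hb
  | mul a b ha' hb' ha hb =>
    have e : polys k n * (polys k n * dts k n) = polys k n * dts k n := by
      rw [← mul_assoc]
      congr 1
      exact Subalgebra.isIdempotentElem_toSubmodule _
    rw [d_mul', parity_polys ha', ← polys_comm hb']
    exact add_mem (e ▸ Submodule.mul_mem_mul hb' ha) (e ▸ Submodule.mul_mem_mul ha' hb)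

theorem d_dts_pow {p : ℕ} {w : Forms k n} (hw : w ∈ dts k n ^ p) : d k n w = 0 := by
  induction p generalizing w with
  | zero =>
    rw [pow_zero] at hw
    obtain ⟨c, rfl⟩ := Submodule.mem_one.mp hw
    simp
  | succ p ih =>
    rw [pow_succ] at hw
    induction hw using Submodule.mul_induction_on' with
    | mem_mul_mem a ha b hb =>
      have : d k n b = 0 := by
        induction hb using Submodule.span_induction with
        | mem y hy => obtain ⟨j, rfl⟩ := hy; simp
        | zero => simp
        | add a b _ _ ha hb => rw [map_add, ha, hb, add_zero]
        | smul c a _ ha => rw [map_smul, ha, smul_zero]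
      rw [d_mul', ih ha, this, zero_mul, mul_zero, add_zero]
    | add a _ b _ ha hb => rw [map_add, ha, hb, add_zero]

theorem d_mem_gr {p q : ℕ} (h : p + 1 = q) {x : Forms k n} (hx : x ∈ gr k n p) :
    d k n x ∈ gr k n q := by
  subst h
  induction hx using gr_induction with
  | hadd a _ b _ ha hb => rw [map_add]; exact add_mem ha hb
  | hmul f hf w hw =>
    rw [d_mul', d_dts_pow hw, mul_zero, add_zero, gr, pow_succ', ← mul_assoc]
    exact Submodule.mul_mem_mul (d_polys hf) hw

theorem op_mem_gr {p : ℕ} (φ : Fin (m + 1) →o Fin (n + 1)) {x : Forms k n}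
    (hx : x ∈ gr k n p) : op φ x ∈ gr k m p := by
  have h1 : (polys k n).map (op φ).toLinearMap ≤ polys k m := by
    rintro _ ⟨f, hf, rfl⟩
    change op φ f ∈ Algebra.adjoin k _
    induction hf using Algebra.adjoin_induction with
    | mem y hy =>
      obtain ⟨j, rfl⟩ := hy
      rw [op_t]
      exact sum_mem fun i _ => Algebra.subset_adjoin ⟨i, rfl⟩
    | algebraMap c => simp
    | add a b _ _ ha hb => rw [map_add]; exact add_mem ha hb
    | mul a b _ _ ha hb => rw [map_mul]; exact mul_mem ha hb
  have h2 : (dts k n).map (op φ).toLinearMap ≤ dts k m := by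
    rw [dts, Submodule.map_span_le]
    rintro _ ⟨j, rfl⟩
    change op φ (dt k j) ∈ _
    rw [op_dt]
    exact sum_mem fun i _ => Submodule.subset_span ⟨i, rfl⟩
  have h3 : (gr k n p).map (op φ).toLinearMap ≤ gr k m p := by
    rw [gr, Submodule.map_mul, Submodule.map_pow]
    exact mul_le_mul' h1 (pow_le_pow_left' h2 p)
  exact h3 ⟨x, hx, rfl⟩

/-- The product `Ω_n^p ⊗ Ω_n^q → Ω_n^r`, `r = p + q`. -/
def grMul (k : Type u) [Field k] (n p q r : ℕ) (h : p + q = r) :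
    gr k n p →ₗ[k] gr k n q →ₗ[k] gr k n r :=
  LinearMap.mk₂ k (fun x y => ⟨x.1 * y.1, mul_mem_gr h x.2 y.2⟩)
    (fun _ _ _ => Subtype.ext (add_mul _ _ _)) (fun _ _ _ => Subtype.ext (smul_mul_assoc _ _ _))
    (fun _ _ _ => Subtype.ext (mul_add _ _ _)) (fun _ _ _ => Subtype.ext (mul_smul_comm _ _ _))

/-- The differential `Ω_n^p → Ω_n^q`, `q = p + 1`. -/
def grD (k : Type u) [Field k] (n p q : ℕ) (h : p + 1 = q) : gr k n p →ₗ[k] gr k n q :=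
  (d k n).restrict fun _ hx => d_mem_gr h hx

/-- The simplicial operators `Ω_n^p → Ω_m^p`. -/
def grOp (k : Type u) [Field k] {m n : ℕ} (φ : Fin (m + 1) →o Fin (n + 1)) (p : ℕ) :
    gr k n p →ₗ[k] gr k m p :=
  (op φ).toLinearMap.restrict fun _ hx => op_mem_gr φ hx

/-- The integral `∫_{Δ^n} : Ω_n^n → k`. -/
noncomputable def grIntegral (k : Type u) [Field k] (n : ℕ) : gr k n n →ₗ[k] k :=
  integral k n ∘ₗ (gr k n n).subtype

@[simp] theorem grMul_coe {p q r : ℕ} (h : p + q = r) (x : gr k n p) (y : gr k n q) :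
    (grMul k n p q r h x y : Forms k n) = x.1 * y.1 := rfl

@[simp] theorem grD_coe {p q : ℕ} (h : p + 1 = q) (x : gr k n p) :
    (grD k n p q h x : Forms k n) = d k n x.1 := rfl

@[simp] theorem grOp_coe {p : ℕ} (φ : Fin (m + 1) →o Fin (n + 1)) (x : gr k n p) :
    (grOp k φ p x : Forms k m) = op φ x.1 := rfl

end Forms

/-! ## Complete filtered spaces and completed tensor products -/

/-- A decreasing filtration `M = F^1 ⊇ F^2 ⊇ ⋯` by subspaces (with the convention `F^0 = M`). -/
structure Filt (k : Type u) [Field k] (M : Type v) [AddCommGroup M] [Module k M] where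
  F : ℕ → Submodule k M
  anti : Antitone F
  one : F 1 = ⊤

section Completion

variable {k : Type u} [Field k]

/-- The limit `lim_a M / F^a`, as the space of compatible families. -/
def FiltLim {M : Type v} [AddCommGroup M] [Module k M] (F : Filt k M) :
    Submodule k (∀ a, M ⧸ F.F a) where
  carrier := {z | ∀ (a b : ℕ) (h : a ≤ b), Submodule.factor (F.anti h) (z b) = z a}
  add_mem' hx hy a b h := by simp only [Pi.add_apply, map_add, hx a b h, hy a b h]
  zero_mem' a b h := by simp
  smul_mem' c x hx a b h := by simp only [Pi.smul_apply, map_smul, hx a b h]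

/-- The canonical map `M → lim_a M / F^a`. -/
def toFiltLim {M : Type v} [AddCommGroup M] [Module k M] (F : Filt k M) : M →ₗ[k] FiltLim F where
  toFun x := ⟨fun a => (F.F a).mkQ x, fun _ _ _ => rfl⟩
  map_add' _ _ := rfl
  map_smul' _ _ := rfl

/-- The completed tensor product `V ⊗̂ M = lim_a V ⊗ (M / F^a)`, as the space of compatible
families. -/
def CTensor (V : Type w) [AddCommGroup V] [Module k V] {M : Type v} [AddCommGroup M] [Module k M]
    (F : Filt k M) : Submodule k (∀ a, V ⊗[k] (M ⧸ F.F a)) where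
  carrier := {z | ∀ (a b : ℕ) (h : a ≤ b),
    LinearMap.lTensor V (Submodule.factor (F.anti h)) (z b) = z a}
  add_mem' hx hy a b h := by simp only [Pi.add_apply, map_add, hx a b h, hy a b h]
  zero_mem' a b h := by simp
  smul_mem' c x hx a b h := by simp only [Pi.smul_apply, map_smul, hx a b h]

namespace CTensor

variable {V V' V'' : Type w} [AddCommGroup V] [Module k V] [AddCommGroup V'] [Module k V']
  [AddCommGroup V''] [Module k V'']
  {M M' M'' : Type v} [AddCommGroup M] [Module k M] [AddCommGroup M'] [Module k M']
  [AddCommGroup M''] [Module k M'']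
  {F : Filt k M} {F' : Filt k M'} {F'' : Filt k M''}

/-- Functoriality of the completed tensor product: `v ⊗ x ↦ f v ⊗ g x`. -/
def map (f : V →ₗ[k] V') (g : M →ₗ[k] M') (hg : ∀ a, F.F a ≤ (F'.F a).comap g) :
    CTensor V F →ₗ[k] CTensor V' F' :=
  (LinearMap.pi fun a => TensorProduct.map f ((F.F a).mapQ (F'.F a) g (hg a)) ∘ₗ
    LinearMap.proj a).restrict fun z hz a b h => by
      simp only [LinearMap.pi_apply, LinearMap.comp_apply, LinearMap.proj_apply]
      rw [← hz a b h]
      generalize z b = y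
      induction y using TensorProduct.induction_on with
      | zero => simp
      | tmul v x =>
        obtain ⟨x, rfl⟩ := Submodule.Quotient.mk_surjective _ x
        rfl
      | add y z hy hz => simp only [map_add, hy, hz]

theorem map_map {V₃ : Type w} [AddCommGroup V₃] [Module k V₃] {M₃ : Type v} [AddCommGroup M₃]
    [Module k M₃] {F₃ : Filt k M₃} (f : V →ₗ[k] V') (g : M →ₗ[k] M')
    (hg : ∀ a, F.F a ≤ (F'.F a).comap g) (f' : V' →ₗ[k] V₃) (g' : M' →ₗ[k] M₃)
    (hg' : ∀ a, F'.F a ≤ (F₃.F a).comap g') (z : CTensor V F) :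
    map f' g' hg' (map f g hg z) =
      map (F' := F₃) (f' ∘ₗ f) (g' ∘ₗ g) (fun a _ hx => hg' a (hg a hx)) z := by
  apply Subtype.ext
  funext a
  change TensorProduct.map _ (Submodule.mapQ _ _ g' (hg' a))
    (TensorProduct.map _ (Submodule.mapQ _ _ g (hg a)) (z.1 a)) =
    TensorProduct.map _ (Submodule.mapQ _ _ (g' ∘ₗ g) _) (z.1 a)
  generalize z.1 a = y
  induction y using TensorProduct.induction_on with
  | zero => simp
  | tmul v x =>
    obtain ⟨x, rfl⟩ := Submodule.Quotient.mk_surjective _ x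
    rfl
  | add y z hy hz => simp only [map_add, hy, hz]

theorem map_id (z : CTensor V F) :
    map (F' := F) LinearMap.id LinearMap.id (fun _ => le_rfl) z = z := by
  apply Subtype.ext
  funext a
  change TensorProduct.map _ (Submodule.mapQ _ _ LinearMap.id le_rfl) (z.1 a) = z.1 a
  generalize z.1 a = y
  induction y using TensorProduct.induction_on with
  | zero => simp
  | tmul v x =>
    obtain ⟨x, rfl⟩ := Submodule.Quotient.mk_surjective _ x
    rfl
  | add y z hy hz => simp only [map_add, hy, hz]

/-- The bilinear map `(M / F^a) × (M' / F'^a) → M'' / F''^a` induced by `g`. -/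
def quotBilin (g : M →ₗ[k] M' →ₗ[k] M'') (a : ℕ)
    (hl : ∀ x ∈ F.F a, ∀ y, g x y ∈ F''.F a) (hr : ∀ x, ∀ y ∈ F'.F a, g x y ∈ F''.F a) :
    (M ⧸ F.F a) →ₗ[k] (M' ⧸ F'.F a) →ₗ[k] (M'' ⧸ F''.F a) :=
  (g.compr₂ (F''.F a).mkQ).liftQ₂ (F.F a) (F'.F a)
    (fun x hx => by
      rw [LinearMap.mem_ker]; ext y
      exact (Submodule.Quotient.mk_eq_zero _).mpr (hl x hx y))
    (fun y hy => by
      rw [LinearMap.mem_ker]; ext x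
      exact (Submodule.Quotient.mk_eq_zero _).mpr (hr x y hy))

/-- The bilinear map `(v ⊗ x, v' ⊗ x') ↦ f v v' ⊗ g x x'` of completed tensor products. -/
def map₂ (f : V →ₗ[k] V' →ₗ[k] V'') (g : M →ₗ[k] M' →ₗ[k] M'')
    (hl : ∀ a, ∀ x ∈ F.F a, ∀ y, g x y ∈ F''.F a)
    (hr : ∀ a, ∀ x, ∀ y ∈ F'.F a, g x y ∈ F''.F a) :
    CTensor V F →ₗ[k] CTensor V' F' →ₗ[k] CTensor V'' F'' :=
  LinearMap.mk₂ k (fun z z' => ⟨fun a => TensorProduct.map₂ f (quotBilin g a (hl a) (hr a))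
      (z.1 a) (z'.1 a), fun a b h => by
        beta_reduce
        rw [← z.2 a b h, ← z'.2 a b h]
        generalize z.1 b = y
        generalize z'.1 b = y'
        induction y using TensorProduct.induction_on with
        | zero => simp
        | add y z hy hz => simp only [map_add, LinearMap.add_apply, hy, hz]
        | tmul v x =>
          induction y' using TensorProduct.induction_on with
          | zero => simp
          | add y z hy hz => simp only [map_add, hy, hz]
          | tmul v' x' =>
            obtain ⟨x, rfl⟩ := Submodule.Quotient.mk_surjective _ x
            obtain ⟨x', rfl⟩ := Submodule.Quotient.mk_surjective _ x'
            rfl⟩)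
    (fun _ _ _ => Subtype.ext (funext fun a => by simp))
    (fun _ _ _ => Subtype.ext (funext fun a => by simp))
    (fun _ _ _ => Subtype.ext (funext fun a => by simp))
    (fun _ _ _ => Subtype.ext (funext fun a => by simp))

/-- Evaluation of a linear functional on the first factor, `V ⊗̂ M → lim_a M / F^a`,
`v ⊗ x ↦ f v • x`. -/
def eval (f : V →ₗ[k] k) : CTensor V F →ₗ[k] FiltLim F :=
  (LinearMap.pi fun a => (TensorProduct.lid k (M ⧸ F.F a)).toLinearMap ∘ₗ
    LinearMap.rTensor (M ⧸ F.F a) f ∘ₗ LinearMap.proj a).restrict fun z hz a b h => by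
      simp only [LinearMap.pi_apply, LinearMap.comp_apply, LinearMap.proj_apply]
      rw [← hz a b h]
      generalize z b = y
      induction y using TensorProduct.induction_on with
      | zero => simp
      | tmul v x => simp
      | add y z hy hz => simp only [map_add, hy, hz]

/-- The tensor `v ⊗ x`. -/
def tmul (F : Filt k M) (v : V) (x : M) : CTensor V F :=
  ⟨fun a => v ⊗ₜ (F.F a).mkQ x, fun _ _ _ => rfl⟩

/-- To prove an identity between completed tensors, it is enough to consider it at each level. -/
theorem ext {z z' : CTensor V F} (h : ∀ a, z.1 a = z'.1 a) : z = z' :=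
  Subtype.ext (funext h)

theorem map_tmul (f : V →ₗ[k] V') (g : M →ₗ[k] M') (hg : ∀ a, F.F a ≤ (F'.F a).comap g)
    (v : V) (x : M) : map (F' := F') f g hg (tmul F v x) = tmul F' (f v) (g x) := rfl

theorem map₂_tmul (f : V →ₗ[k] V' →ₗ[k] V'') (g : M →ₗ[k] M' →ₗ[k] M'')
    (hl : ∀ a, ∀ x ∈ F.F a, ∀ y, g x y ∈ F''.F a)
    (hr : ∀ a, ∀ x, ∀ y ∈ F'.F a, g x y ∈ F''.F a) (v : V) (x : M) (v' : V') (x' : M') :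
    map₂ (F'' := F'') f g hl hr (tmul F v x) (tmul F' v' x') = tmul F'' (f v v') (g x x') := rfl

theorem eval_tmul (f : V →ₗ[k] k) (v : V) (x : M) :
    eval f (tmul F v x) = toFiltLim F (f v • x) :=
  Subtype.ext (funext fun _ => rfl)

end CTensor
end Completion

/-- The sum over all decompositions `p + q = r`. -/
def sumAntidiag {M : Type w} [AddCommMonoid M] (r : ℕ) (f : ∀ p q : ℕ, p + q = r → M) : M :=
  ∑ x : {x // x ∈ Finset.HasAntidiagonal.antidiagonal r},
    f x.1.1 x.1.2 (Finset.HasAntidiagonal.mem_antidiagonal.mp x.2)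

/-! ## dg Lie algebras -/

/-- The underlying data of a dg Lie algebra over `k`, in cohomological grading: a `ℤ`-graded vector
space, a linear map `d` of degree `1` and a bilinear bracket of degree `0`. -/
structure DGLieData (k : Type u) [Field k] where
  X : ℤ → Type v
  [addCommGroup : ∀ i, AddCommGroup (X i)]
  [module : ∀ i, Module k (X i)]
  d : ∀ i j : ℤ, i + 1 = j → X i →ₗ[k] X j
  bracket : ∀ i j l : ℤ, i + j = l → X i →ₗ[k] X j →ₗ[k] X l

attribute [instance] DGLieData.addCommGroup DGLieData.module

namespace DGLieData

variable {k : Type u} [Field k]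

/-- The axioms of a dg Lie algebra (over a field of characteristic zero). -/
structure IsDGLie (A : DGLieData.{u, v} k) : Prop where
  d_d : ∀ (i j l : ℤ) (hij : i + 1 = j) (hjl : j + 1 = l) (x : A.X i),
    A.d j l hjl (A.d i j hij x) = 0
  skew : ∀ (i j l : ℤ) (h : i + j = l) (x : A.X i) (y : A.X j),
    A.bracket i j l h x y =
      -((i * j).negOnePow • A.bracket j i l ((add_comm j i).trans h) y x)
  jacobi : ∀ (i j m ij jm im l : ℤ) (hij : i + j = ij) (hjm : j + m = jm) (him : i + m = im)
    (h₁ : i + jm = l) (h₂ : ij + m = l) (h₃ : j + im = l) (x : A.X i) (y : A.X j) (z : A.X m),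
    A.bracket i jm l h₁ x (A.bracket j m jm hjm y z) =
      A.bracket ij m l h₂ (A.bracket i j ij hij x y) z +
        (i * j).negOnePow • A.bracket j im l h₃ y (A.bracket i m im him x z)
  leibniz : ∀ (i j l i' j' l' : ℤ) (h : i + j = l) (hi : i + 1 = i') (hj : j + 1 = j')
    (hl : l + 1 = l') (h₁ : i' + j = l') (h₂ : i + j' = l') (x : A.X i) (y : A.X j),
    A.d l l' hl (A.bracket i j l h x y) =
      A.bracket i' j l' h₁ (A.d i i' hi x) y +
        i.negOnePow • A.bracket i j' l' h₂ x (A.d j j' hj y)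

/-- A family of linear maps is a morphism of dg Lie algebras if it is compatible with the
differentials and the brackets. -/
structure IsHom (A : DGLieData.{u, v} k) (B : DGLieData.{u, w} k)
    (f : ∀ i, A.X i →ₗ[k] B.X i) : Prop where
  map_d : ∀ (i j : ℤ) (h : i + 1 = j) (x : A.X i), f j (A.d i j h x) = B.d i j h (f i x)
  map_bracket : ∀ (i j l : ℤ) (h : i + j = l) (x : A.X i) (y : A.X j),
    f l (A.bracket i j l h x y) = B.bracket i j l h (f i x) (f j y)

/-- The cocycles in degree `i`. -/
def cocycles (A : DGLieData.{u, v} k) (i : ℤ) : Submodule k (A.X i) :=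
  LinearMap.ker (A.d i (i + 1) rfl)

/-- The coboundaries in degree `i`. -/
def coboundaries (A : DGLieData.{u, v} k) (i : ℤ) : Submodule k (A.X i) :=
  LinearMap.range (A.d (i - 1) i (sub_add_cancel i 1))

/-- The cohomology `H^i(A)`, that is, `H_{-i}(A)` in homological grading. -/
abbrev H (A : DGLieData.{u, v} k) (i : ℤ) : Type v :=
  A.cocycles i ⧸ (A.coboundaries i).comap (A.cocycles i).subtype

/-- The map in cohomology induced by a morphism. -/
def IsHom.mapH {A : DGLieData.{u, v} k} {B : DGLieData.{u, w} k} {f : ∀ i, A.X i →ₗ[k] B.X i}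
    (hf : IsHom A B f) (i : ℤ) : A.H i →ₗ[k] B.H i :=
  Submodule.mapQ _ _
    ((f i).restrict (p := A.cocycles i) (q := B.cocycles i) fun x hx => by
      have hx' : A.d i (i + 1) rfl x = 0 := hx
      change B.d i (i + 1) rfl (f i x) = 0
      rw [← hf.map_d, hx', map_zero])
    (by
      rintro ⟨x, hx⟩ ⟨y, hy⟩
      exact ⟨f (i - 1) y, by rw [← hf.map_d, hy]; rfl⟩)

/-- A morphism is a quasi-isomorphism if it induces isomorphisms in cohomology. -/
def IsHom.QuasiIso {A : DGLieData.{u, v} k} {B : DGLieData.{u, w} k}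
    {f : ∀ i, A.X i →ₗ[k] B.X i} (hf : IsHom A B f) : Prop :=
  ∀ i, Function.Bijective (hf.mapH i)

end DGLieData

/-- A complete dg Lie algebra: a dg Lie algebra with a filtration `L = F^1 L ⊇ F^2 L ⊇ ⋯` by
subcomplexes such that `[F^p L, F^q L] ⊆ F^{p+q} L` and `L → lim_n L / F^n L` is an isomorphism. -/
structure CompleteDGLie (k : Type u) [Field k] extends DGLieData.{u, v} k where
  isDGLie : toDGLieData.IsDGLie
  filt : ∀ i, Filt k (X i)
  d_mem : ∀ (i j : ℤ) (h : i + 1 = j) (a : ℕ), ∀ x ∈ (filt i).F a, d i j h x ∈ (filt j).F a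
  bracket_mem : ∀ (i j l : ℤ) (h : i + j = l) (a b : ℕ), ∀ x ∈ (filt i).F a,
    ∀ y ∈ (filt j).F b, bracket i j l h x y ∈ (filt l).F (a + b)
  complete : ∀ i, Function.Bijective (toFiltLim (filt i))

namespace CompleteDGLie

variable {k : Type u} [Field k]

/-- A morphism of complete dg Lie algebras. -/
structure Hom (L L' : CompleteDGLie.{u, v} k) where
  f : ∀ i, L.X i →ₗ[k] L'.X i
  isHom : DGLieData.IsHom L.toDGLieData L'.toDGLieData f
  map_filt : ∀ (i : ℤ) (a : ℕ), ∀ x ∈ (L.filt i).F a, f i x ∈ (L'.filt i).F a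

variable (L : CompleteDGLie.{u, v} k)

theorem bracket_mem_left {i j l : ℤ} (h : i + j = l) (a : ℕ) (x : L.X i)
    (hx : x ∈ (L.filt i).F a) (y : L.X j) : L.bracket i j l h x y ∈ (L.filt l).F a :=
  (L.filt l).anti (Nat.le_succ a)
    (L.bracket_mem i j l h a 1 x hx y ((L.filt j).one ▸ Submodule.mem_top))

theorem bracket_mem_right {i j l : ℤ} (h : i + j = l) (a : ℕ) (x : L.X i) (y : L.X j)
    (hy : y ∈ (L.filt j).F a) : L.bracket i j l h x y ∈ (L.filt l).F a :=
  (L.filt l).anti ((Nat.le_succ a).trans (Nat.add_comm 1 a).ge)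
    (L.bracket_mem i j l h 1 a x ((L.filt i).one ▸ Submodule.mem_top) y hy)

/-! ## The simplicial dg Lie algebra `Ω_•(L)` -/

/-- `Ω_n^p ⊗̂ L^i`. -/
abbrev Comp (n p : ℕ) (i : ℤ) : Type (max u v) := CTensor (Forms.gr k n p) (L.filt i)

/-- The degree `m` part of `Ω_n(L) = Ω_n ⊗̂ L`: the product over all `p + i = m` of the spaces
`Ω_n^p ⊗̂ L^i`. This is the direct sum, since `Ω_n^p = 0` unless `0 ≤ p ≤ n`. -/
abbrev Omega (n : ℕ) (m : ℤ) : Type (max u v) :=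
  ∀ x : {x : ℕ × ℤ // (x.1 : ℤ) + x.2 = m}, L.Comp n x.1.1 x.1.2

/-- `d ⊗ 1 : Ω_n^p ⊗̂ L^i → Ω_n^{p+1} ⊗̂ L^i`. -/
def dForm (n p q : ℕ) (h : p + 1 = q) (i : ℤ) : L.Comp n p i →ₗ[k] L.Comp n q i :=
  CTensor.map (Forms.grD k n p q h) LinearMap.id fun _ => le_rfl

/-- `1 ⊗ d : Ω_n^p ⊗̂ L^i → Ω_n^p ⊗̂ L^{i+1}`. -/
def dLie (n p : ℕ) (i j : ℤ) (h : i + 1 = j) : L.Comp n p i →ₗ[k] L.Comp n p j :=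
  CTensor.map LinearMap.id (L.d i j h) fun a x hx => L.d_mem i j h a x hx

/-- The component of `(d ⊗ 1) ξ` in `Ω_n^p ⊗̂ L^i`. -/
def omegaDForm {n : ℕ} {m : ℤ} (ξ : L.Omega n m) :
    ∀ (p : ℕ) (i : ℤ), (p : ℤ) + i = m + 1 → L.Comp n p i
  | 0, _, _ => 0
  | p + 1, i, h => L.dForm n p (p + 1) rfl i (ξ ⟨(p, i), by push_cast at h; omega⟩)

/-- The component of `(1 ⊗ d) ξ` in `Ω_n^p ⊗̂ L^i` (without the Koszul sign). -/
def omegaDLie {n : ℕ} {m : ℤ} (ξ : L.Omega n m) (p : ℕ) (i : ℤ) (h : (p : ℤ) + i = m + 1) :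
    L.Comp n p i :=
  L.dLie n p (i - 1) i (sub_add_cancel i 1) (ξ ⟨(p, i - 1), by dsimp only; omega⟩)

/-- The differential of `Ω_n(L)`, `d (ω ⊗ x) = dω ⊗ x + (-1)^|ω| ω ⊗ dx`. -/
def omegaD (n : ℕ) (m : ℤ) : L.Omega n m →ₗ[k] L.Omega n (m + 1) where
  toFun ξ x := L.omegaDForm ξ x.1.1 x.1.2 x.2 +
    (-1 : k) ^ x.1.1 • L.omegaDLie ξ x.1.1 x.1.2 x.2
  map_add' ξ η := by
    funext ⟨⟨p, i⟩, h⟩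
    cases p <;> simp [omegaDForm, omegaDLie]; abel
  map_smul' c ξ := by
    funext ⟨⟨p, i⟩, h⟩
    cases p <;> simp [omegaDForm, omegaDLie, smul_comm c]

/-- The map `(ω ⊗ x, η ⊗ y) ↦ ωη ⊗ [x, y]`. -/
def compMul (n p q r : ℕ) (h : p + q = r) (i j l : ℤ) (h' : i + j = l) :
    L.Comp n p i →ₗ[k] L.Comp n q j →ₗ[k] L.Comp n r l :=
  CTensor.map₂ (Forms.grMul k n p q r h) (L.bracket i j l h')
    (fun a x hx y => L.bracket_mem_left h' a x hx y)
    (fun a x y hy => L.bracket_mem_right h' a x y hy)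

/-- The component in `Ω_n^p ⊗̂ L^{-p}` of an element of degree zero. -/
def comp0 {n : ℕ} (ξ : L.Omega n 0) (p : ℕ) : L.Comp n p (-p) := ξ ⟨(p, -p), add_neg_cancel _⟩

/-- The Lie bracket of `Ω_n(L)` in degree zero: `[ω ⊗ x, η ⊗ y] = (-1)^{|x||η|} ωη ⊗ [x, y]`,
where `|x| = -|ω|`, so that the sign is `(-1)^{pq}` for `ω` of degree `p` and `η` of degree `q`. -/
def omegaBracket (n : ℕ) : L.Omega n 0 →ₗ[k] L.Omega n 0 →ₗ[k] L.Omega n 0 :=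
  LinearMap.mk₂ k (fun ξ η y => sumAntidiag y.1.1 fun p q h => (-1 : k) ^ (p * q) •
      L.compMul n p q y.1.1 h (-p) (-q) y.1.2 (by have := y.2; omega) (L.comp0 ξ p) (L.comp0 η q))
    (fun _ _ _ => by funext y; simp [comp0, sumAntidiag, Finset.sum_add_distrib])
    (fun c _ _ => by funext y; simp [comp0, sumAntidiag, Finset.smul_sum, smul_comm c])
    (fun _ _ _ => by funext y; simp [comp0, sumAntidiag, Finset.sum_add_distrib])
    (fun c _ _ => by funext y; simp [comp0, sumAntidiag, Finset.smul_sum, smul_comm c])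

/-- The simplicial operators of `Ω_•(L)`. -/
def omegaOp {m n : ℕ} (φ : Fin (m + 1) →o Fin (n + 1)) (c : ℤ) :
    L.Omega n c →ₗ[k] L.Omega m c where
  toFun ξ x := CTensor.map (Forms.grOp k φ x.1.1) LinearMap.id (fun _ => le_rfl) (ξ x)
  map_add' _ _ := by funext x; simp
  map_smul' _ _ := by funext x; simp

/-- `L_n = Z^0 Ω_n(L)`. -/
def Z0 (n : ℕ) : Submodule k (L.Omega n 0) := LinearMap.ker (L.omegaD n 0)

end CompleteDGLie

theorem sumAntidiag_eq {M : Type w} [AddCommMonoid M] (r : ℕ) (f : ∀ p q : ℕ, p + q = r → M) :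
    sumAntidiag r f = ∑ x ∈ Finset.HasAntidiagonal.antidiagonal r,
      if h : x.1 + x.2 = r then f x.1 x.2 h else 0 := by
  rw [← Finset.sum_coe_sort, sumAntidiag]
  refine Finset.sum_congr rfl fun x _ => ?_
  rw [dif_pos]

theorem sumAntidiag_congr {M : Type w} [AddCommMonoid M] {r : ℕ}
    {f g : ∀ p q : ℕ, p + q = r → M} (h : ∀ p q e, f p q e = g p q e) :
    sumAntidiag r f = sumAntidiag r g :=
  Finset.sum_congr rfl fun _ _ => h _ _ _

theorem sumAntidiag_add {M : Type w} [AddCommMonoid M] {r : ℕ}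
    (f g : ∀ p q : ℕ, p + q = r → M) :
    sumAntidiag r f + sumAntidiag r g = sumAntidiag r fun p q e => f p q e + g p q e :=
  Finset.sum_add_distrib.symm

theorem map_sumAntidiag {M M' : Type*} [AddCommMonoid M] [AddCommMonoid M'] {G : Type*}
    [FunLike G M M'] [AddMonoidHomClass G M M'] (g : G) (r : ℕ) (f : ∀ p q : ℕ, p + q = r → M) :
    g (sumAntidiag r f) = sumAntidiag r fun p q e => g (f p q e) := map_sum _ _ _

theorem sumAntidiag_succ_left {M : Type w} [AddCommMonoid M] (r : ℕ)
    (f : ∀ p q : ℕ, p + q = r + 1 → M) :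
    sumAntidiag (r + 1) f = f 0 (r + 1) (zero_add _) +
      sumAntidiag r fun p q h => f (p + 1) q (by omega) := by
  rw [sumAntidiag_eq, sumAntidiag_eq, Finset.Nat.sum_antidiagonal_succ, dif_pos (zero_add _)]
  congr 1
  refine Finset.sum_congr rfl fun x hx => ?_
  have := Finset.HasAntidiagonal.mem_antidiagonal.mp hx
  rw [dif_pos (by omega), dif_pos (by omega)]

theorem sumAntidiag_succ_right {M : Type w} [AddCommMonoid M] (r : ℕ)
    (f : ∀ p q : ℕ, p + q = r + 1 → M) :
    sumAntidiag (r + 1) f = f (r + 1) 0 (add_zero _) +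
      sumAntidiag r fun p q h => f p (q + 1) (by omega) := by
  rw [sumAntidiag_eq, sumAntidiag_eq, Finset.Nat.sum_antidiagonal_succ', dif_pos (add_zero _)]
  congr 1
  refine Finset.sum_congr rfl fun x hx => ?_
  have := Finset.HasAntidiagonal.mem_antidiagonal.mp hx
  rw [dif_pos (by omega), dif_pos (by omega)]

theorem sumAntidiag_swap {M : Type w} [AddCommMonoid M] (r : ℕ) (f : ∀ p q : ℕ, p + q = r → M) :
    sumAntidiag r f = sumAntidiag r fun p q h => f q p ((add_comm q p).trans h) := by
  rw [sumAntidiag_eq, sumAntidiag_eq, ← Finset.Nat.sum_antidiagonal_swap]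
  refine Finset.sum_congr rfl fun x hx => ?_
  have := Finset.HasAntidiagonal.mem_antidiagonal.mp hx
  rw [dif_pos (by simp; omega), dif_pos (by omega)]
  rfl

theorem sumAntidiag_assoc {M : Type w} [AddCommMonoid M] (r : ℕ)
    (f : ∀ p q s : ℕ, p + q + s = r → M) :
    (sumAntidiag r fun p b h => sumAntidiag b fun q s h' => f p q s (by omega)) =
      sumAntidiag r fun a s h => sumAntidiag a fun p q h' => f p q s (by omega) := by
  have e₁ : (sumAntidiag r fun p b h => sumAntidiag b fun q s h' => f p q s (by omega)) =
      ∑ x ∈ Finset.HasAntidiagonal.antidiagonal r, ∑ y ∈ Finset.HasAntidiagonal.antidiagonal x.2,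
        if h : x.1 + y.1 + y.2 = r then f x.1 y.1 y.2 h else 0 := by
    rw [sumAntidiag_eq]
    refine Finset.sum_congr rfl fun x hx => ?_
    have := Finset.HasAntidiagonal.mem_antidiagonal.mp hx
    rw [dif_pos this, sumAntidiag_eq]
    refine Finset.sum_congr rfl fun y hy => ?_
    have := Finset.HasAntidiagonal.mem_antidiagonal.mp hy
    rw [dif_pos (by omega), dif_pos (by omega)]
  have e₂ : (sumAntidiag r fun a s h => sumAntidiag a fun p q h' => f p q s (by omega)) =
      ∑ x ∈ Finset.HasAntidiagonal.antidiagonal r, ∑ y ∈ Finset.HasAntidiagonal.antidiagonal x.1,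
        if h : y.1 + y.2 + x.2 = r then f y.1 y.2 x.2 h else 0 := by
    rw [sumAntidiag_eq]
    refine Finset.sum_congr rfl fun x hx => ?_
    have := Finset.HasAntidiagonal.mem_antidiagonal.mp hx
    rw [dif_pos this, sumAntidiag_eq]
    refine Finset.sum_congr rfl fun y hy => ?_
    have := Finset.HasAntidiagonal.mem_antidiagonal.mp hy
    rw [dif_pos (by omega), dif_pos (by omega)]
  rw [e₁, e₂, Finset.sum_sigma', Finset.sum_sigma']
  refine Finset.sum_nbij' (fun x => ⟨(x.1.1 + x.2.1, x.2.2), (x.1.1, x.2.1)⟩)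
    (fun x => ⟨(x.2.1, x.2.2 + x.1.2), (x.2.2, x.1.2)⟩) ?_ ?_ ?_ ?_ ?_
  · rintro ⟨⟨a, b⟩, ⟨c, d⟩⟩ h
    simp at h ⊢; omega
  · rintro ⟨⟨a, b⟩, ⟨c, d⟩⟩ h
    simp at h ⊢; omega
  · rintro ⟨⟨a, b⟩, ⟨c, d⟩⟩ h
    simp at h ⊢; omega
  · rintro ⟨⟨a, b⟩, ⟨c, d⟩⟩ h
    simp at h ⊢; omega
  · rintro ⟨⟨a, b⟩, ⟨c, d⟩⟩ h
    rfl

theorem sumAntidiag_three {M : Type w} [AddCommMonoid M] (r : ℕ)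
    (f₁ f₂ f₃ : ∀ p q s : ℕ, p + q + s = r → M)
    (hf : ∀ p q s e, f₁ p q s e = f₂ p q s e + f₃ p q s e) :
    (sumAntidiag r fun p b h => sumAntidiag b fun q s h' => f₁ p q s (by omega)) =
      (sumAntidiag r fun a s h => sumAntidiag a fun p q h' => f₂ p q s (by omega)) +
        sumAntidiag r fun q c h => sumAntidiag c fun p s h' => f₃ p q s (by omega) := by
  rw [sumAntidiag_assoc r f₁, sumAntidiag_assoc r fun q p s e => f₃ p q s (by omega),
    sumAntidiag_add]
  refine sumAntidiag_congr fun a s h => ?_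
  rw [sumAntidiag_swap a fun q p h' => f₃ p q s (by omega), sumAntidiag_add]
  exact sumAntidiag_congr fun p q h' => hf _ _ _ _

namespace CompleteDGLie
variable {k : Type u} [Field k] (L : CompleteDGLie.{u, v} k)

theorem compMul_level {n p q r : ℕ} {h : p + q = r} {i j l : ℤ} {h' : i + j = l}
    (x : L.Comp n p i) (y : L.Comp n q j) (a : ℕ) :
    (L.compMul n p q r h i j l h' x y).1 a =
      TensorProduct.map₂ (Forms.grMul k n p q r h)
        (CTensor.quotBilin (L.bracket i j l h') a (fun x hx y => L.bracket_mem_left h' a x hx y)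
          (fun x y hy => L.bracket_mem_right h' a x y hy)) (x.1 a) (y.1 a) := rfl

theorem negOnePow_smul {W : Type w} [AddCommGroup W] [Module k W] (a : ℤ) (b : ℕ)
    (h : a = b ∨ a = -b) (x : W) : a.negOnePow • x = (-1 : k) ^ b • x := by
  have e : a.negOnePow = (-1 : ℤˣ) ^ b := by
    rcases h with rfl | rfl
    · rfl
    · rw [Int.negOnePow_neg]; rfl
  rw [e]
  rcases Nat.even_or_odd b with h | h
  · simp [h.neg_one_pow]
  · simp [h.neg_one_pow, Units.smul_def]

theorem compMul_skew (n : ℕ) {p q r : ℕ} (h : p + q = r) (h₂ : q + p = r) {l : ℤ}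
    (h' : -(p : ℤ) + -q = l) (h₂' : -(q : ℤ) + -p = l) (x : L.Comp n p (-p))
    (y : L.Comp n q (-q)) :
    L.compMul n p q r h _ _ l h' x y = (-1 : k) • L.compMul n q p r h₂ _ _ l h₂' y x := by
  apply CTensor.ext
  intro a
  change _ = (-1 : k) • (L.compMul n q p r h₂ _ _ l h₂' y x).1 a
  rw [compMul_level, compMul_level]
  generalize x.1 a = x
  generalize y.1 a = y
  induction x using TensorProduct.induction_on with
  | zero => simp
  | add x x' hx hx' => simp only [map_add, LinearMap.add_apply, hx, hx', smul_add]
  | tmul ω x =>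
    induction y using TensorProduct.induction_on with
    | zero => simp
    | add x x' hx hx' => simp only [map_add, LinearMap.add_apply, hx, hx', smul_add]
    | tmul η y =>
      obtain ⟨x, rfl⟩ := Submodule.Quotient.mk_surjective _ x
      obtain ⟨y, rfl⟩ := Submodule.Quotient.mk_surjective _ y
      change (Forms.grMul k n p q r h ω η) ⊗ₜ[k] ((L.filt l).F a).mkQ (L.bracket _ _ _ _ x y) =
        (-1 : k) • ((Forms.grMul k n q p r h₂ η ω) ⊗ₜ[k]
          ((L.filt l).F a).mkQ (L.bracket _ _ _ _ y x))
      have e : Forms.grMul k n p q r h ω η =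
          (-1 : k) ^ (p * q) • Forms.grMul k n q p r h₂ η ω :=
        Subtype.ext (Forms.gr_comm ω.2 η.2)
      rw [e, L.isDGLie.skew _ _ _ h' x y, negOnePow_smul (k := k) _ (p * q) (by simp), map_neg,
        map_smul, TensorProduct.tmul_neg, TensorProduct.tmul_smul, ← TensorProduct.smul_tmul',
        smul_smul, ← mul_pow, neg_mul_neg, mul_one, one_pow, one_smul]
      exact (neg_one_smul k (Forms.grMul k n q p r h₂ η ω ⊗ₜ[k]
        ((L.filt l).F a).mkQ (L.bracket _ _ _ h₂' y x))).symm

theorem dForm_level {n p q : ℕ} {h : p + 1 = q} {i : ℤ} (x : L.Comp n p i) (a : ℕ) :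
    (L.dForm n p q h i x).1 a = TensorProduct.map (Forms.grD k n p q h)
      (((L.filt i).F a).mapQ ((L.filt i).F a) LinearMap.id le_rfl) (x.1 a) := rfl

theorem dLie_level {n p : ℕ} {i j : ℤ} {h : i + 1 = j} (x : L.Comp n p i) (a : ℕ) :
    (L.dLie n p i j h x).1 a = TensorProduct.map LinearMap.id
      (((L.filt i).F a).mapQ ((L.filt j).F a) (L.d i j h) fun x hx => L.d_mem i j h a x hx)
        (x.1 a) := rfl

theorem compMul_jacobi (n : ℕ) {p q s a b c r : ℕ} (hpq : p + q = a) (hqs : q + s = b)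
    (hps : p + s = c) (h₁ : p + b = r) (h₂ : a + s = r) (h₃ : q + c = r) {l : ℤ}
    (g₀ : -(p : ℤ) + -q = -a) (g₀' : -(q : ℤ) + -s = -b) (g₀'' : -(p : ℤ) + -s = -c)
    (g₁ : -(p : ℤ) + -b = l) (g₂ : -(a : ℤ) + -s = l) (g₃ : -(q : ℤ) + -c = l)
    (x : L.Comp n p (-p)) (y : L.Comp n q (-q)) (z : L.Comp n s (-s)) :
    ((-1 : k) ^ (p * b) * (-1) ^ (q * s)) •
      L.compMul n p b r h₁ _ _ l g₁ x (L.compMul n q s b hqs _ _ _ g₀' y z) =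
    ((-1 : k) ^ (a * s) * (-1) ^ (p * q)) •
      L.compMul n a s r h₂ _ _ l g₂ (L.compMul n p q a hpq _ _ _ g₀ x y) z +
    ((-1 : k) ^ (q * c) * (-1) ^ (p * s)) •
      L.compMul n q c r h₃ _ _ l g₃ y (L.compMul n p s c hps _ _ _ g₀'' x z) := by
  apply CTensor.ext
  intro A
  change (_ : k) • (L.compMul n p b r h₁ _ _ l g₁ x (L.compMul n q s b hqs _ _ _ g₀' y z)).1 A =
    (_ : k) • (L.compMul n a s r h₂ _ _ l g₂ (L.compMul n p q a hpq _ _ _ g₀ x y) z).1 A +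
    (_ : k) • (L.compMul n q c r h₃ _ _ l g₃ y (L.compMul n p s c hps _ _ _ g₀'' x z)).1 A
  simp only [compMul_level]
  generalize x.1 A = x
  generalize y.1 A = y
  generalize z.1 A = z
  induction x using TensorProduct.induction_on with
  | zero => simp
  | add x x' hx hx' =>
    simp only [map_add, LinearMap.add_apply, smul_add, hx, hx']; abel
  | tmul ω x =>
    induction y using TensorProduct.induction_on with
    | zero => simp
    | add x x' hx hx' =>
      simp only [map_add, LinearMap.add_apply, smul_add, hx, hx']; abel
    | tmul η y =>
      induction z using TensorProduct.induction_on with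
      | zero => simp
      | add x x' hx hx' =>
        simp only [map_add, smul_add, hx, hx']; abel
      | tmul ζ z =>
        obtain ⟨x, rfl⟩ := Submodule.Quotient.mk_surjective _ x
        obtain ⟨y, rfl⟩ := Submodule.Quotient.mk_surjective _ y
        obtain ⟨z, rfl⟩ := Submodule.Quotient.mk_surjective _ z
        change (_ : k) • ((Forms.grMul k n p b r h₁ ω (Forms.grMul k n q s b hqs η ζ)) ⊗ₜ[k]
            ((L.filt l).F A).mkQ (L.bracket _ _ _ g₁ x (L.bracket _ _ _ g₀' y z))) =
          (_ : k) • ((Forms.grMul k n a s r h₂ (Forms.grMul k n p q a hpq ω η) ζ) ⊗ₜ[k]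
            ((L.filt l).F A).mkQ (L.bracket _ _ _ g₂ (L.bracket _ _ _ g₀ x y) z)) +
          (_ : k) • ((Forms.grMul k n q c r h₃ η (Forms.grMul k n p s c hps ω ζ)) ⊗ₜ[k]
            ((L.filt l).F A).mkQ (L.bracket _ _ _ g₃ y (L.bracket _ _ _ g₀'' x z)))
        have e₂ : Forms.grMul k n a s r h₂ (Forms.grMul k n p q a hpq ω η) ζ =
            Forms.grMul k n p b r h₁ ω (Forms.grMul k n q s b hqs η ζ) :=
          Subtype.ext (mul_assoc _ _ _)
        have e₃ : Forms.grMul k n q c r h₃ η (Forms.grMul k n p s c hps ω ζ) =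
            (-1 : k) ^ (p * q) • Forms.grMul k n p b r h₁ ω (Forms.grMul k n q s b hqs η ζ) := by
          apply Subtype.ext
          change η.1 * (ω.1 * ζ.1) = (-1 : k) ^ (p * q) • (ω.1 * (η.1 * ζ.1))
          rw [← mul_assoc, Forms.gr_comm η.2 ω.2, smul_mul_assoc, mul_assoc, mul_comm q p]
        rw [e₂, e₃, L.isDGLie.jacobi _ _ _ _ _ _ l g₀ g₀' g₀'' g₁ g₂ g₃,
          negOnePow_smul (k := k) _ (p * q) (by simp), map_add, map_smul,
          TensorProduct.tmul_add, TensorProduct.tmul_smul, ← TensorProduct.smul_tmul',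
          smul_add, smul_smul, smul_smul]
        subst hpq hqs hps
        congr 2
        · ring
        · have : (-1 : k) ^ (s * s) * (-1) ^ (s * s) = 1 := by rw [← mul_pow]; simp
          ring_nf

theorem dForm_compMul (n : ℕ) {p q r p' q' r' : ℕ} (h : p + q = r) (hp : p + 1 = p')
    (hq : q + 1 = q') (hr : r + 1 = r') (h₁ : p' + q = r') (h₂ : p + q' = r') {i j l : ℤ}
    (g : i + j = l) (x : L.Comp n p i) (y : L.Comp n q j) :
    L.dForm n r r' hr l (L.compMul n p q r h i j l g x y) =
      L.compMul n p' q r' h₁ i j l g (L.dForm n p p' hp i x) y +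
        (-1 : k) ^ p • L.compMul n p q' r' h₂ i j l g x (L.dForm n q q' hq j y) := by
  apply CTensor.ext
  intro A
  change (L.dForm n r r' hr l (L.compMul n p q r h i j l g x y)).1 A =
    (L.compMul n p' q r' h₁ i j l g (L.dForm n p p' hp i x) y).1 A +
    (-1 : k) ^ p • (L.compMul n p q' r' h₂ i j l g x (L.dForm n q q' hq j y)).1 A
  simp only [compMul_level, dForm_level]
  generalize x.1 A = x
  generalize y.1 A = y
  induction x using TensorProduct.induction_on with
  | zero => simp
  | add x x' hx hx' =>
    simp only [map_add, LinearMap.add_apply, smul_add, hx, hx']; abel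
  | tmul ω x =>
    induction y using TensorProduct.induction_on with
    | zero => simp
    | add x x' hx hx' =>
      simp only [map_add, smul_add, hx, hx']; abel
    | tmul η y =>
      obtain ⟨x, rfl⟩ := Submodule.Quotient.mk_surjective _ x
      obtain ⟨y, rfl⟩ := Submodule.Quotient.mk_surjective _ y
      change Forms.grD k n r r' hr (Forms.grMul k n p q r h ω η) ⊗ₜ[k]
          ((L.filt l).F A).mkQ (L.bracket _ _ _ g x y) =
        Forms.grMul k n p' q r' h₁ (Forms.grD k n p p' hp ω) η ⊗ₜ[k]
          ((L.filt l).F A).mkQ (L.bracket _ _ _ g x y) +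
        (-1 : k) ^ p • (Forms.grMul k n p q' r' h₂ ω (Forms.grD k n q q' hq η) ⊗ₜ[k]
          ((L.filt l).F A).mkQ (L.bracket _ _ _ g x y))
      rw [TensorProduct.smul_tmul', ← TensorProduct.add_tmul]
      congr 1
      exact Subtype.ext (Forms.d_mul ω.2 _)

theorem dLie_compMul (n : ℕ) {p q r : ℕ} (h : p + q = r) {j l i' j' l' : ℤ}
    (g : -(p : ℤ) + j = l) (hi : -(p : ℤ) + 1 = i') (hj : j + 1 = j') (hl : l + 1 = l')
    (g₁ : i' + j = l') (g₂ : -(p : ℤ) + j' = l') (x : L.Comp n p (-p)) (y : L.Comp n q j) :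
    L.dLie n r l l' hl (L.compMul n p q r h _ j l g x y) =
      L.compMul n p q r h i' j l' g₁ (L.dLie n p _ i' hi x) y +
        (-1 : k) ^ p • L.compMul n p q r h _ j' l' g₂ x (L.dLie n q j j' hj y) := by
  apply CTensor.ext
  intro A
  change (L.dLie n r l l' hl (L.compMul n p q r h _ j l g x y)).1 A =
    (L.compMul n p q r h i' j l' g₁ (L.dLie n p _ i' hi x) y).1 A +
    (-1 : k) ^ p • (L.compMul n p q r h _ j' l' g₂ x (L.dLie n q j j' hj y)).1 A
  simp only [compMul_level, dLie_level]
  generalize x.1 A = x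
  generalize y.1 A = y
  induction x using TensorProduct.induction_on with
  | zero => simp
  | add x x' hx hx' =>
    simp only [map_add, LinearMap.add_apply, smul_add, hx, hx']; abel
  | tmul ω x =>
    induction y using TensorProduct.induction_on with
    | zero => simp
    | add x x' hx hx' =>
      simp only [map_add, smul_add, hx, hx']; abel
    | tmul η y =>
      obtain ⟨x, rfl⟩ := Submodule.Quotient.mk_surjective _ x
      obtain ⟨y, rfl⟩ := Submodule.Quotient.mk_surjective _ y
      change Forms.grMul k n p q r h ω η ⊗ₜ[k]
          ((L.filt l').F A).mkQ (L.d l l' hl (L.bracket _ _ _ g x y)) =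
        Forms.grMul k n p q r h ω η ⊗ₜ[k]
          ((L.filt l').F A).mkQ (L.bracket _ _ _ g₁ (L.d _ _ hi x) y) +
        (-1 : k) ^ p • (Forms.grMul k n p q r h ω η ⊗ₜ[k]
          ((L.filt l').F A).mkQ (L.bracket _ _ _ g₂ x (L.d _ _ hj y)))
      rw [← TensorProduct.tmul_smul, ← TensorProduct.tmul_add, ← map_smul, ← map_add,
        L.isDGLie.leibniz _ _ _ _ _ _ g hi hj hl g₁ g₂, negOnePow_smul (k := k) _ p (by simp)]

end CompleteDGLie

namespace CompleteDGLie
variable {k : Type u} [Field k] (L : CompleteDGLie.{u, v} k)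

theorem comp0_bracket {n : ℕ} (ξ η : L.Omega n 0) (r : ℕ) :
    L.comp0 (L.omegaBracket n ξ η) r = sumAntidiag r fun p q h => (-1 : k) ^ (p * q) •
      L.compMul n p q r h (-p) (-q) (-r) (by omega) (L.comp0 ξ p) (L.comp0 η q) := rfl

theorem omega_ext {n : ℕ} {ξ η : L.Omega n 0} (h : ∀ p, L.comp0 ξ p = L.comp0 η p) : ξ = η := by
  funext ⟨⟨p, i⟩, e⟩
  obtain rfl : i = -p := by dsimp only at e; omega
  exact h p

theorem omegaBracket_skew {n : ℕ} (ξ η : L.Omega n 0) :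
    L.omegaBracket n ξ η = (-1 : k) • L.omegaBracket n η ξ := by
  apply L.omega_ext
  intro r
  change _ = (-1 : k) • L.comp0 (L.omegaBracket n η ξ) r
  rw [comp0_bracket, comp0_bracket, sumAntidiag_swap, ← LinearMap.lsmul_apply (R := k),
    map_sumAntidiag]
  refine sumAntidiag_congr fun p q e => ?_
  rw [L.compMul_skew n _ e _ (by omega), LinearMap.lsmul_apply, smul_comm, mul_comm]

theorem omegaBracket_jacobi {n : ℕ} (ξ η ζ : L.Omega n 0) :
    L.omegaBracket n ξ (L.omegaBracket n η ζ) =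
      L.omegaBracket n (L.omegaBracket n ξ η) ζ + L.omegaBracket n η (L.omegaBracket n ξ ζ) := by
  apply L.omega_ext
  intro r
  change _ = L.comp0 (L.omegaBracket n (L.omegaBracket n ξ η) ζ) r +
    L.comp0 (L.omegaBracket n η (L.omegaBracket n ξ ζ)) r
  have e₁ : L.comp0 (L.omegaBracket n ξ (L.omegaBracket n η ζ)) r =
      sumAntidiag r fun p b h => sumAntidiag b fun q s h' =>
        ((-1 : k) ^ (p * (q + s)) * (-1) ^ (q * s)) •
        L.compMul n p (q + s) r (by omega) (-p) (-((q + s : ℕ) : ℤ)) (-r) (by omega) (L.comp0 ξ p)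
          (L.compMul n q s (q + s) rfl (-q) (-s) (-((q + s : ℕ) : ℤ)) (by omega)
            (L.comp0 η q) (L.comp0 ζ s)) := by
    rw [comp0_bracket]
    refine sumAntidiag_congr fun p b h => ?_
    rw [comp0_bracket, map_sumAntidiag, ← LinearMap.lsmul_apply (R := k), map_sumAntidiag]
    refine sumAntidiag_congr fun q s h' => ?_
    subst h'
    rw [LinearMap.lsmul_apply, map_smul, smul_smul]
  have e₂ : L.comp0 (L.omegaBracket n (L.omegaBracket n ξ η) ζ) r =
      sumAntidiag r fun a s h => sumAntidiag a fun p q h' =>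
        ((-1 : k) ^ ((p + q) * s) * (-1) ^ (p * q)) •
        L.compMul n (p + q) s r (by omega) (-((p + q : ℕ) : ℤ)) (-s) (-r) (by omega)
          (L.compMul n p q (p + q) rfl (-p) (-q) (-((p + q : ℕ) : ℤ)) (by omega)
            (L.comp0 ξ p) (L.comp0 η q)) (L.comp0 ζ s) := by
    rw [comp0_bracket]
    refine sumAntidiag_congr fun p b h => ?_
    rw [comp0_bracket, ← LinearMap.flip_apply, map_sumAntidiag, ← LinearMap.lsmul_apply (R := k),
      map_sumAntidiag]
    refine sumAntidiag_congr fun q s h' => ?_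
    subst h'
    rw [LinearMap.lsmul_apply, map_smul, smul_smul, LinearMap.flip_apply]
  have e₃ : L.comp0 (L.omegaBracket n η (L.omegaBracket n ξ ζ)) r =
      sumAntidiag r fun q c h => sumAntidiag c fun p s h' =>
        ((-1 : k) ^ (q * (p + s)) * (-1) ^ (p * s)) •
        L.compMul n q (p + s) r (by omega) (-q) (-((p + s : ℕ) : ℤ)) (-r) (by omega) (L.comp0 η q)
          (L.compMul n p s (p + s) rfl (-p) (-s) (-((p + s : ℕ) : ℤ)) (by omega)
            (L.comp0 ξ p) (L.comp0 ζ s)) := by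
    rw [comp0_bracket]
    refine sumAntidiag_congr fun p b h => ?_
    rw [comp0_bracket, map_sumAntidiag, ← LinearMap.lsmul_apply (R := k), map_sumAntidiag]
    refine sumAntidiag_congr fun q s h' => ?_
    subst h'
    rw [LinearMap.lsmul_apply, map_smul, smul_smul]
  rw [e₁, e₂, e₃]
  refine sumAntidiag_three r (fun p q s e => ((-1 : k) ^ (p * (q + s)) * (-1) ^ (q * s)) •
        L.compMul n p (q + s) r (by omega) (-p) (-((q + s : ℕ) : ℤ)) (-r) (by omega) (L.comp0 ξ p)
          (L.compMul n q s (q + s) rfl (-q) (-s) (-((q + s : ℕ) : ℤ)) (by omega)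
            (L.comp0 η q) (L.comp0 ζ s)))
    (fun p q s e => ((-1 : k) ^ ((p + q) * s) * (-1) ^ (p * q)) •
        L.compMul n (p + q) s r (by omega) (-((p + q : ℕ) : ℤ)) (-s) (-r) (by omega)
          (L.compMul n p q (p + q) rfl (-p) (-q) (-((p + q : ℕ) : ℤ)) (by omega)
            (L.comp0 ξ p) (L.comp0 η q)) (L.comp0 ζ s))
    (fun p q s e => ((-1 : k) ^ (q * (p + s)) * (-1) ^ (p * s)) •
        L.compMul n q (p + s) r (by omega) (-q) (-((p + s : ℕ) : ℤ)) (-r) (by omega) (L.comp0 η q)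
          (L.compMul n p s (p + s) rfl (-p) (-s) (-((p + s : ℕ) : ℤ)) (by omega)
            (L.comp0 ξ p) (L.comp0 ζ s))) fun p q s e => ?_
  exact L.compMul_jacobi n rfl rfl rfl _ _ _ _ _ _ _ _ _ _ _ _

theorem omegaDLie_eq {n : ℕ} (ξ : L.Omega n 0) (p : ℕ) (j : ℤ) (h : (p : ℤ) + j = 0 + 1)
    (h' : -(p : ℤ) + 1 = j) : L.omegaDLie ξ p j h = L.dLie n p (-p) j h' (L.comp0 ξ p) := by
  have aux : ∀ (i : ℤ) (hi : i = -p) (hij : i + 1 = j) (hx : (p : ℤ) + i = 0),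
      L.dLie n p i j hij (ξ ⟨(p, i), hx⟩) = L.dLie n p (-p) j h' (L.comp0 ξ p) := by
    rintro _ rfl _ _
    rfl
  exact aux _ (by omega) _ _

theorem compMul_dForm_left {n : ℕ} (ξ : L.Omega n 0) (p : ℕ) (i : ℤ) (hi : i = -p) {q r : ℕ}
    (h : p + 1 + q = r) {j l : ℤ} (g : i + j = l) (g' : -(p : ℤ) + j = l)
    (h' : ((p + 1 : ℕ) : ℤ) + i = 0 + 1) (y : L.Comp n q j) :
    L.compMul n (p + 1) q r h i j l g (L.omegaDForm ξ (p + 1) i h') y =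
      L.compMul n (p + 1) q r h (-p) j l g' (L.dForm n p (p + 1) rfl (-p) (L.comp0 ξ p)) y := by
  subst hi; rfl

theorem compMul_dForm_right {n : ℕ} (η : L.Omega n 0) (q : ℕ) (j : ℤ) (hj : j = -q) {p r : ℕ}
    (h : p + (q + 1) = r) {i l : ℤ} (g : i + j = l) (g' : i + -(q : ℤ) = l)
    (h' : ((q + 1 : ℕ) : ℤ) + j = 0 + 1) (x : L.Comp n p i) :
    L.compMul n p (q + 1) r h i j l g x (L.omegaDForm η (q + 1) j h') =
      L.compMul n p (q + 1) r h i (-q) l g' x (L.dForm n q (q + 1) rfl (-q) (L.comp0 η q)) := by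
  subst hj; rfl

theorem dForm_bracket_term {n : ℕ} (ξ η : L.Omega n 0) (p q r : ℕ) (e : p + q = r)
    (g : -(p : ℤ) + -q = -r) (h₁ : p + 1 + q = r + 1) (h₂ : p + (q + 1) = r + 1)
    (g₁ : 1 - ((p + 1 : ℕ) : ℤ) + -q = -r) (g₂ : -(p : ℤ) + (1 - ((q + 1 : ℕ) : ℤ)) = -r)
    (k₁ : ((p + 1 : ℕ) : ℤ) + (1 - ((p + 1 : ℕ) : ℤ)) = 0 + 1)
    (k₂ : ((q + 1 : ℕ) : ℤ) + (1 - ((q + 1 : ℕ) : ℤ)) = 0 + 1) :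
    L.dForm n r (r + 1) rfl (-r) ((-1 : k) ^ (p * q) •
      L.compMul n p q r e (-p) (-q) (-r) g (L.comp0 ξ p) (L.comp0 η q)) =
    (-1 : k) ^ ((p + 1) * q + q) • L.compMul n (p + 1) q (r + 1) h₁ (1 - ((p + 1 : ℕ) : ℤ)) (-q) (-r)
        g₁ (L.omegaDForm ξ (p + 1) (1 - ((p + 1 : ℕ) : ℤ)) k₁) (L.comp0 η q) +
      (-1 : k) ^ (p * (q + 1)) • L.compMul n p (q + 1) (r + 1) h₂ (-p) (1 - ((q + 1 : ℕ) : ℤ)) (-r)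
        g₂ (L.comp0 ξ p) (L.omegaDForm η (q + 1) (1 - ((q + 1 : ℕ) : ℤ)) k₂) := by
  have s₁ : (-1 : k) ^ ((p + 1) * q + q) = (-1) ^ (p * q) := by
    have : (-1 : k) ^ (q * 2) = 1 := by simp
    rw [show (p + 1) * q + q = p * q + q * 2 by ring, pow_add, this, mul_one]
  have s₂ : (-1 : k) ^ (p * (q + 1)) = (-1) ^ (p * q) * (-1) ^ p := by
    rw [← pow_add]; congr 1
  rw [map_smul, L.compMul_dForm_left ξ p _ (by push_cast; omega) _ _ g,
    L.compMul_dForm_right η q _ (by push_cast; omega) _ _ g, s₁, s₂,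
    L.dForm_compMul n e rfl rfl rfl h₁ h₂ g, smul_add, smul_smul]

theorem omegaDForm_bracket {n : ℕ} (ξ η : L.Omega n 0) (r : ℕ) (i : ℤ) (h : (r : ℤ) + i = 0 + 1) :
    L.omegaDForm (L.omegaBracket n ξ η) r i h = sumAntidiag r fun p q e =>
      ((-1 : k) ^ (p * q + q) • L.compMul n p q r e (1 - p) (-q) i (by omega)
        (L.omegaDForm ξ p (1 - p) (by omega)) (L.comp0 η q) +
      (-1 : k) ^ (p * q) • L.compMul n p q r e (-p) (1 - q) i (by omega)
        (L.comp0 ξ p) (L.omegaDForm η q (1 - q) (by omega))) := by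
  have aux : ∀ (ξ : L.Omega n 0) (p : ℕ) (i : ℤ) (h : ((p + 1 : ℕ) : ℤ) + i = 0 + 1),
      L.omegaDForm ξ (p + 1) i h =
        L.dForm n p (p + 1) rfl i (ξ ⟨(p, i), by push_cast at h; dsimp only; omega⟩) :=
    fun _ _ _ _ => rfl
  have aux0 : ∀ (ξ : L.Omega n 0) (i : ℤ) (h : ((0 : ℕ) : ℤ) + i = 0 + 1),
      L.omegaDForm ξ 0 i h = 0 := fun _ _ _ => rfl
  rw [← sumAntidiag_add]
  cases r with
  | zero =>
    rw [aux0]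
    symm
    rw [sumAntidiag_add]
    apply Finset.sum_eq_zero
    rintro ⟨⟨p, q⟩, e⟩ -
    have := Finset.HasAntidiagonal.mem_antidiagonal.mp e
    obtain ⟨rfl, rfl⟩ : p = 0 ∧ q = 0 := by dsimp only at this; omega
    dsimp only
    rw [aux0, aux0, map_zero, map_zero, LinearMap.zero_apply]
    simp only [smul_zero, add_zero]
  | succ r =>
    obtain rfl : i = -r := by push_cast at h; omega
    rw [sumAntidiag_succ_left, aux0, sumAntidiag_succ_right r fun p q e =>
      (-1 : k) ^ (p * q) • L.compMul n p q (r + 1) e (-p) (1 - q) (-r) (by omega)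
        (L.comp0 ξ p) (L.omegaDForm η q (1 - q) (by omega)), aux0, map_zero, map_zero,
      LinearMap.zero_apply, smul_zero, smul_zero]
    refine Eq.trans ?_ (congrArg₂ (· + ·) (zero_add _) (zero_add _)).symm
    rw [sumAntidiag_add, aux]
    change L.dForm n r (r + 1) rfl (-r) (L.comp0 (L.omegaBracket n ξ η) r) = _
    rw [comp0_bracket, map_sumAntidiag]
    refine sumAntidiag_congr fun p q e => ?_
    exact L.dForm_bracket_term ξ η p q r e _ _ _ _ _ _ _

theorem omegaDLie_bracket {n : ℕ} (ξ η : L.Omega n 0) (r : ℕ) (i : ℤ) (h : (r : ℤ) + i = 0 + 1) :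
    L.omegaDLie (L.omegaBracket n ξ η) r i h = sumAntidiag r fun p q e =>
      ((-1 : k) ^ (p * q) • L.compMul n p q r e (1 - p) (-q) i (by omega)
        (L.omegaDLie ξ p (1 - p) (by omega)) (L.comp0 η q) +
      (-1 : k) ^ (p * q + p) • L.compMul n p q r e (-p) (1 - q) i (by omega)
        (L.comp0 ξ p) (L.omegaDLie η q (1 - q) (by omega))) := by
  rw [omegaDLie_eq _ _ _ _ _ (by omega), comp0_bracket, map_sumAntidiag]
  refine sumAntidiag_congr fun p q e => ?_
  rw [map_smul, L.dLie_compMul n e _ (i' := 1 - p) (j' := 1 - q) (by omega) (by omega) (by omega)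
    (by omega) (by omega), smul_add, smul_smul, pow_add, omegaDLie_eq _ _ _ _ _ (by omega),
    omegaDLie_eq _ _ _ _ _ (by omega)]

theorem mem_Z0 {n : ℕ} {ξ : L.Omega n 0} : ξ ∈ L.Z0 n ↔
    ∀ (p : ℕ) (i : ℤ) (h : (p : ℤ) + i = 0 + 1),
      L.omegaDForm ξ p i h + (-1 : k) ^ p • L.omegaDLie ξ p i h = 0 := by
  rw [Z0, LinearMap.mem_ker]
  constructor
  · intro H p i h
    exact congr_fun H ⟨(p, i), h⟩
  · intro H
    funext ⟨⟨p, i⟩, h⟩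
    exact H p i h

/-- The cocycles of degree zero form a Lie subalgebra. -/
theorem bracket_mem_Z0 {n : ℕ} {ξ η : L.Omega n 0} (hξ : ξ ∈ L.Z0 n) (hη : η ∈ L.Z0 n) :
    L.omegaBracket n ξ η ∈ L.Z0 n := by
  rw [mem_Z0] at *
  intro r i h
  rw [omegaDForm_bracket, omegaDLie_bracket, ← LinearMap.lsmul_apply (R := k) ((-1 : k) ^ r),
    map_sumAntidiag, sumAntidiag_add]
  apply Finset.sum_eq_zero
  rintro ⟨⟨p, q⟩, e⟩ -
  have e' := Finset.HasAntidiagonal.mem_antidiagonal.mp e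
  dsimp only at e' ⊢
  have h₁ := hξ p (1 - p) (by omega)
  have h₂ := hη q (1 - q) (by omega)
  rw [add_eq_zero_iff_eq_neg] at h₁ h₂
  rw [h₁, h₂, LinearMap.lsmul_apply, map_neg, map_neg, LinearMap.neg_apply, map_smul, map_smul,
    LinearMap.smul_apply, smul_add, smul_smul, smul_neg, smul_neg, smul_smul, smul_smul, smul_smul]
  subst e'
  rw [show (-1 : k) ^ (p + q) * (-1) ^ (p * q) = (-1) ^ (p * q + q) * (-1) ^ p by ring]
  have : (-1 : k) ^ (p + q) * (-1) ^ (p * q + p) = (-1) ^ (p * q) * (-1) ^ q := by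
    have : (-1 : k) ^ p * (-1) ^ p = 1 := by rw [← mul_pow]; simp
    linear_combination ((-1 : k) ^ q * (-1) ^ (p * q)) * this
  rw [this]
  abel

theorem omegaOp_compMul {m n : ℕ} (φ : Fin (m + 1) →o Fin (n + 1)) {p q r : ℕ} (h : p + q = r)
    {i j l : ℤ} (g : i + j = l) (x : L.Comp n p i) (y : L.Comp n q j) :
    CTensor.map (F' := L.filt l) (Forms.grOp k φ r) LinearMap.id (fun _ => le_rfl)
        (L.compMul n p q r h i j l g x y) =
      L.compMul m p q r h i j l g
        (CTensor.map (F' := L.filt i) (Forms.grOp k φ p) LinearMap.id (fun _ => le_rfl) x)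
        (CTensor.map (F' := L.filt j) (Forms.grOp k φ q) LinearMap.id (fun _ => le_rfl) y) := by
  have level : ∀ {p : ℕ} {i : ℤ} (x : L.Comp n p i) (a : ℕ),
      (CTensor.map (F' := L.filt i) (Forms.grOp k φ p) LinearMap.id (fun _ => le_rfl) x).1 a =
        TensorProduct.map (Forms.grOp k φ p)
          (((L.filt i).F a).mapQ ((L.filt i).F a) LinearMap.id le_rfl) (x.1 a) :=
    fun _ _ => rfl
  apply CTensor.ext
  intro A
  rw [level, compMul_level, compMul_level, level, level]
  generalize x.1 A = x
  generalize y.1 A = y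
  induction x using TensorProduct.induction_on with
  | zero => simp
  | add x x' hx hx' => simp only [map_add, LinearMap.add_apply, hx, hx']
  | tmul ω x =>
    induction y using TensorProduct.induction_on with
    | zero => simp
    | add x x' hx hx' => simp only [map_add, hx, hx']
    | tmul η y =>
      obtain ⟨x, rfl⟩ := Submodule.Quotient.mk_surjective _ x
      obtain ⟨y, rfl⟩ := Submodule.Quotient.mk_surjective _ y
      change Forms.grOp k φ r (Forms.grMul k n p q r h ω η) ⊗ₜ[k]
          ((L.filt l).F A).mkQ (L.bracket _ _ _ g x y) =
        Forms.grMul k m p q r h (Forms.grOp k φ p ω) (Forms.grOp k φ q η) ⊗ₜ[k]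
          ((L.filt l).F A).mkQ (L.bracket _ _ _ g x y)
      congr 1
      exact Subtype.ext (map_mul (Forms.op φ) _ _)

theorem omegaOp_bracket {m n : ℕ} (φ : Fin (m + 1) →o Fin (n + 1)) (ξ η : L.Omega n 0) :
    L.omegaOp φ 0 (L.omegaBracket n ξ η) =
      L.omegaBracket m (L.omegaOp φ 0 ξ) (L.omegaOp φ 0 η) := by
  apply L.omega_ext
  intro r
  rw [comp0_bracket]
  change CTensor.map (Forms.grOp k φ r) LinearMap.id (fun _ => le_rfl)
    (L.comp0 (L.omegaBracket n ξ η) r) = _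
  rw [comp0_bracket, map_sumAntidiag]
  refine sumAntidiag_congr fun p q e => ?_
  rw [map_smul, omegaOp_compMul]
  rfl

theorem op_mem_Z0 {m n : ℕ} (φ : Fin (m + 1) →o Fin (n + 1)) {ξ : L.Omega n 0}
    (hξ : ξ ∈ L.Z0 n) : L.omegaOp φ 0 ξ ∈ L.Z0 m := by
  rw [mem_Z0] at *
  intro p i h
  have e₁ : L.omegaDForm (L.omegaOp φ 0 ξ) p i h =
      CTensor.map (Forms.grOp k φ p) LinearMap.id (fun _ => le_rfl) (L.omegaDForm ξ p i h) := by
    cases p with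
    | zero => exact (map_zero _).symm
    | succ p =>
      simp only [omegaDForm, dForm, omegaOp, LinearMap.coe_mk, AddHom.coe_mk]
      rw [CTensor.map_map, CTensor.map_map]
      have hc : Forms.grD k m p (p + 1) rfl ∘ₗ Forms.grOp k φ p =
          Forms.grOp k φ (p + 1) ∘ₗ Forms.grD k n p (p + 1) rfl :=
        LinearMap.ext fun x => Subtype.ext (Forms.op_d φ x.1).symm
      simp only [hc]
  have e₂ : L.omegaDLie (L.omegaOp φ 0 ξ) p i h =
      CTensor.map (Forms.grOp k φ p) LinearMap.id (fun _ => le_rfl) (L.omegaDLie ξ p i h) := by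
    simp only [omegaDLie, dLie, omegaOp, LinearMap.coe_mk, AddHom.coe_mk]
    rw [CTensor.map_map, CTensor.map_map]
    rfl
  rw [e₁, e₂, ← map_smul, ← map_add, hξ, map_zero]

end CompleteDGLie

/-! ## Simplicial Lie algebras and their normalized chains -/

/-- A simplicial Lie algebra: a contravariant functor from the category of the ordered sets
`[n] = {0, …, n}` and monotone maps to Lie algebras. -/
structure SimplicialLieAlgebra (k : Type u) [Field k] where
  obj : ℕ → Type w
  [lieRing : ∀ n, LieRing (obj n)]
  [lieAlgebra : ∀ n, LieAlgebra k (obj n)]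
  map : ∀ {m n : ℕ}, (Fin (m + 1) →o Fin (n + 1)) → obj n →ₗ⁅k⁆ obj m
  map_id : ∀ (n : ℕ) (x : obj n), map (OrderHom.id : Fin (n + 1) →o Fin (n + 1)) x = x
  map_comp : ∀ {l m n : ℕ} (φ : Fin (m + 1) →o Fin (n + 1)) (ψ : Fin (l + 1) →o Fin (m + 1))
    (x : obj n), map (φ.comp ψ) x = map ψ (map φ x)

attribute [instance] SimplicialLieAlgebra.lieRing SimplicialLieAlgebra.lieAlgebra

/-- A permutation `σ = (μ_1, …, μ_p, ν_1, …, ν_q)` of `{0, …, r - 1}`, `r = p + q`, is a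
`(p, q)`-shuffle if `μ_1 < ⋯ < μ_p` and `ν_1 < ⋯ < ν_q`. -/
def IsShuffle (p : ℕ) {r : ℕ} (σ : Equiv.Perm (Fin r)) : Prop :=
  (∀ a b : Fin r, a < b → b.1 < p → σ a < σ b) ∧ ∀ a b : Fin r, p ≤ a.1 → a < b → σ a < σ b

instance (p : ℕ) {r : ℕ} : DecidablePred (IsShuffle p (r := r)) := fun σ => by
  unfold IsShuffle; infer_instance

/-- The set `{μ_1, …, μ_p}`. -/
def shuffleFst (p : ℕ) {r : ℕ} (σ : Equiv.Perm (Fin r)) : Finset (Fin r) := {a | (σ.symm a).1 < p}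

/-- The set `{ν_1, …, ν_q}`. -/
def shuffleSnd (p : ℕ) {r : ℕ} (σ : Equiv.Perm (Fin r)) : Finset (Fin r) := {a | p ≤ (σ.symm a).1}

theorem card_shuffleFst {p q r : ℕ} (h : p + q = r) (σ : Equiv.Perm (Fin r)) :
    (shuffleFst p σ).card = p := by
  have : shuffleFst p σ = (Finset.univ.filter fun a : Fin r => a.1 < p).map σ.toEmbedding := by
    ext a; simp [shuffleFst]
  rw [this, Finset.card_map, Fin.card_filter_val_lt]
  omega

theorem card_shuffleSnd {p q r : ℕ} (h : p + q = r) (σ : Equiv.Perm (Fin r)) :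
    (shuffleSnd p σ).card = q := by
  have : shuffleSnd p σ = (shuffleFst p σ)ᶜ := by ext a; simp [shuffleFst, shuffleSnd]
  rw [this, Finset.card_compl, card_shuffleFst h, Fintype.card_fin]
  omega

/-- The monotone surjection `[r] → [p]` which increases exactly at the steps `a → a + 1` with
`a ∈ S`, where `S` has `p` elements. In terms of the complement `{c_1 < ⋯ < c_q}` of `S`, this is
the monotone surjection that identifies `c_i` and `c_i + 1` for all `i`, so that the corresponding
simplicial operator is the iterated degeneracy `s_{c_q} ⋯ s_{c_1}`. -/
def stepMap {r p : ℕ} (S : Finset (Fin r)) (hS : S.card = p) : Fin (r + 1) →o Fin (p + 1) where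
  toFun j := ⟨(S.filter fun a => a.1 < j.1).card,
    Nat.lt_succ_of_le (hS ▸ Finset.card_le_card (Finset.filter_subset _ _))⟩
  monotone' i j hij := Finset.card_le_card fun a ha => by
    rw [Finset.mem_filter] at ha ⊢
    exact ⟨ha.1, lt_of_lt_of_le ha.2 hij⟩

namespace SimplicialLieAlgebra

variable {k : Type u} [Field k] (X : SimplicialLieAlgebra.{u, w} k)

/-- The face map `∂_i : X_{n+1} → X_n`. -/
def face {n : ℕ} (i : Fin (n + 2)) : X.obj (n + 1) →ₗ⁅k⁆ X.obj n :=
  X.map (Fin.succAboveOrderEmb i).toOrderHom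

/-- The boundary `∂ = ∑ (-1)^i ∂_i : X_n → X_m`, `n = m + 1`. -/
def boundary : ∀ (n m : ℕ), n = m + 1 → X.obj n →ₗ[k] X.obj m
  | _, m, rfl => ∑ i : Fin (m + 2), (-1 : k) ^ i.1 • (X.face i : X.obj (m + 1) →ₗ[k] X.obj m)

/-- The normalized chains `N_n X`: the intersection of the kernels of `∂_1, …, ∂_n`. -/
def normalized : ∀ n : ℕ, Submodule k (X.obj n)
  | 0 => ⊤
  | n + 1 => ⨅ i : Fin (n + 1), LinearMap.ker (X.face i.succ : X.obj (n + 1) →ₗ[k] X.obj n)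

theorem mem_normalized_succ {n : ℕ} {x : X.obj (n + 1)} :
    x ∈ X.normalized (n + 1) ↔ ∀ i : Fin (n + 1), X.face i.succ x = 0 := by
  simp [normalized]

theorem boundary_mem {n m : ℕ} (h : n = m + 1) {x : X.obj n} (hx : x ∈ X.normalized n) :
    X.boundary n m h x ∈ X.normalized m := by
  subst h
  rw [mem_normalized_succ] at hx
  have e : X.boundary (m + 1) m rfl x = X.face 0 x := by
    rw [boundary, LinearMap.sum_apply, Fin.sum_univ_succ, Finset.sum_eq_zero]
    · simp
    · intro i _
      simp [hx i]
  rw [e]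
  cases m with
  | zero => exact Submodule.mem_top
  | succ m =>
    rw [mem_normalized_succ]
    intro i
    have : ((Fin.succAboveOrderEmb (0 : Fin (m + 3))).toOrderHom).comp
        (Fin.succAboveOrderEmb i.succ).toOrderHom =
        ((Fin.succAboveOrderEmb i.succ.succ).toOrderHom).comp
          (Fin.succAboveOrderEmb (0 : Fin (m + 2))).toOrderHom := by
      ext j
      simp
    rw [face, face, ← X.map_comp, this, X.map_comp]
    have := hx i.succ
    rw [face] at this
    rw [this, map_zero]

theorem map_eq_zero {p m : ℕ} {x : X.obj p} (hx : x ∈ X.normalized p)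
    (f : Fin (m + 1) →o Fin (p + 1)) (c : Fin (p + 1)) (hc : c ≠ 0) (hf : ∀ j, f j ≠ c) :
    X.map f x = 0 := by
  cases p with
  | zero => exact absurd (Fin.ext (by omega)) hc
  | succ p =>
    obtain ⟨c, rfl⟩ := Fin.exists_succ_eq.mpr hc
    have : f = ((Fin.succAboveOrderEmb c.succ).toOrderHom).comp
        ((Fin.predAboveOrderHom c).comp f) := by
      ext j
      simp [Fin.succ_succAbove_predAbove (hf j)]
    rw [this, X.map_comp]
    have h := X.mem_normalized_succ.mp hx c
    rw [face] at h
    rw [h, map_zero]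

/-- The shuffle bracket
`[x, y] = ∑_{(μ, ν)} sgn(μ, ν) [s_{ν_q} ⋯ s_{ν_1} x, s_{μ_p} ⋯ s_{μ_1} y] ∈ X_{p + q}`
of `x ∈ X_p` and `y ∈ X_q`, the sum being over all `(p, q)`-shuffles. -/
def shuffleBracket (p q r : ℕ) (h : p + q = r) : X.obj p →ₗ[k] X.obj q →ₗ[k] X.obj r :=
  LinearMap.mk₂ k (fun x y => ∑ σ : Equiv.Perm (Fin r) with IsShuffle p σ,
      (Equiv.Perm.sign σ : ℤ) • ⁅X.map (stepMap (shuffleFst p σ) (card_shuffleFst h σ)) x,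
        X.map (stepMap (shuffleSnd p σ) (card_shuffleSnd h σ)) y⁆)
    (fun _ _ _ => by simp [Finset.sum_add_distrib])
    (fun c _ _ => by simp [Finset.smul_sum, smul_comm c])
    (fun _ _ _ => by simp [Finset.sum_add_distrib])
    (fun c _ _ => by simp [Finset.smul_sum, smul_comm c])

end SimplicialLieAlgebra

/-- If two consecutive steps are in `S` then the value in between is skipped by the face. -/
theorem stepMap_face_ne {m p : ℕ} (S : Finset (Fin (m + 1))) (hS : S.card = p) (i : Fin (m + 1))
    (hi : i ∈ S) (hi' : ∀ b : Fin (m + 1), b.1 = i.1 + 1 → b ∈ S) :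
    ∃ c : Fin (p + 1), c ≠ 0 ∧
      ∀ j, (stepMap S hS).comp (Fin.succAboveOrderEmb i.succ).toOrderHom j ≠ c := by
  refine ⟨stepMap S hS i.succ, ?_, fun j => ?_⟩
  · intro h
    have h' : (S.filter fun a => a.1 < i.succ.1).card = 0 := congrArg Fin.val h
    rw [Finset.card_eq_zero] at h'
    have : i ∈ (∅ : Finset (Fin (m + 1))) := h' ▸ Finset.mem_filter.mpr ⟨hi, by simp⟩
    simp at this
  · apply ne_of_apply_ne Fin.val
    simp only [OrderHom.comp_coe, Function.comp_apply, stepMap,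
      OrderEmbedding.toOrderHom_coe, Fin.succAboveOrderEmb_apply]
    rcases lt_or_ge j.castSucc i.succ with hlt | hge
    · rw [Fin.succAbove_of_castSucc_lt _ _ hlt]
      apply ne_of_lt
      apply Finset.card_lt_card
      rw [Finset.ssubset_iff_of_subset]
      · refine ⟨i, Finset.mem_filter.mpr ⟨hi, by simp⟩, ?_⟩
        simp only [Finset.mem_filter, not_and, not_lt]
        intro _
        have := Fin.lt_def.mp hlt
        simp at this ⊢
        omega
      · intro a
        simp only [Finset.mem_filter]
        have := Fin.lt_def.mp hlt
        simp at this ⊢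
        intro h1 h2
        exact ⟨h1, by omega⟩
    · rw [Fin.succAbove_of_le_castSucc _ _ hge]
      have hle := Fin.le_def.mp hge
      simp at hle
      apply ne_of_gt
      apply Finset.card_lt_card
      rw [Finset.ssubset_iff_of_subset]
      · refine ⟨⟨i.1 + 1, by omega⟩, Finset.mem_filter.mpr ⟨hi' _ rfl, by simp; omega⟩,
          fun hx => absurd (Finset.mem_filter.mp hx).2 (by simp)⟩
      · intro a
        simp only [Finset.mem_filter]
        simp
        intro h1 h2
        exact ⟨h1, by omega⟩

theorem stepMap_face_congr {m p : ℕ} (S T : Finset (Fin (m + 1))) (hS : S.card = p)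
    (hT : T.card = p) (i i' : Fin (m + 1)) (hi : i'.1 = i.1 + 1)
    (h : ∀ a, a ∈ T ↔ Equiv.swap i i' a ∈ S) :
    (stepMap S hS).comp (Fin.succAboveOrderEmb i.succ).toOrderHom =
      (stepMap T hT).comp (Fin.succAboveOrderEmb i.succ).toOrderHom := by
  ext j
  simp only [OrderHom.comp_coe, Function.comp_apply, stepMap,
      OrderEmbedding.toOrderHom_coe, Fin.succAboveOrderEmb_apply]
  have hne : (i.succ.succAbove j).1 ≠ i.1 + 1 := by
    intro e
    exact Fin.succAbove_ne i.succ j (Fin.ext (by simpa using e))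
  generalize (i.succ.succAbove j) = v at hne
  apply Finset.card_bij (fun a _ => Equiv.swap i i' a)
  · intro a ha
    rw [Finset.mem_filter] at ha ⊢
    refine ⟨(h _).mpr (by simpa using ha.1), ?_⟩
    rcases eq_or_ne a i with rfl | h1
    · rw [Equiv.swap_apply_left]; omega
    · rcases eq_or_ne a i' with rfl | h2
      · rw [Equiv.swap_apply_right]; omega
      · rw [Equiv.swap_apply_of_ne_of_ne h1 h2]; exact ha.2
  · intro a _ b _ e
    exact (Equiv.swap i i').injective e
  · intro b hb
    rw [Finset.mem_filter] at hb
    refine ⟨Equiv.swap i i' b, Finset.mem_filter.mpr ⟨(h b).mp hb.1, ?_⟩, by simp⟩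
    rcases eq_or_ne b i with rfl | h1
    · rw [Equiv.swap_apply_left]; omega
    · rcases eq_or_ne b i' with rfl | h2
      · rw [Equiv.swap_apply_right]; omega
      · rw [Equiv.swap_apply_of_ne_of_ne h1 h2]; exact hb.2

theorem IsShuffle.swap {p m : ℕ} {σ : Equiv.Perm (Fin (m + 1))} (hσ : IsShuffle p σ)
    (i i' : Fin (m + 1)) (hi : i'.1 = i.1 + 1)
    (h : ¬ ((σ.symm i).1 < p ↔ (σ.symm i').1 < p)) : IsShuffle p (Equiv.swap i i' * σ) := by
  have key : ∀ a b : Fin (m + 1), σ a < σ b → (a.1 < p ↔ b.1 < p) →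
      Equiv.swap i i' (σ a) < Equiv.swap i i' (σ b) := by
    intro a b hab hp
    have h1 : ¬ (σ a = i ∧ σ b = i') := by
      rintro ⟨ha, hb⟩
      apply h
      rw [← ha, ← hb]
      simpa using hp
    rw [Fin.lt_def] at hab ⊢
    rcases eq_or_ne (σ a) i with e1 | e1
    · rw [e1, Equiv.swap_apply_left]
      rcases eq_or_ne (σ b) i' with e2 | e2
      · exact absurd ⟨e1, e2⟩ h1
      · rw [Equiv.swap_apply_of_ne_of_ne (by rintro rfl; rw [e1] at hab; omega) e2]
        have := Fin.val_ne_of_ne e2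
        rw [e1] at hab
        omega
    · rcases eq_or_ne (σ a) i' with e3 | e3
      · rw [e3, Equiv.swap_apply_right]
        rw [e3] at hab
        rw [Equiv.swap_apply_of_ne_of_ne (Fin.ne_of_val_ne (by omega))
          (Fin.ne_of_val_ne (by omega))]
        omega
      · rw [Equiv.swap_apply_of_ne_of_ne e1 e3]
        have v1 := Fin.val_ne_of_ne e1
        have v3 := Fin.val_ne_of_ne e3
        rcases eq_or_ne (σ b) i with e4 | e4
        · rw [e4, Equiv.swap_apply_left]; rw [e4] at hab; omega
        · rcases eq_or_ne (σ b) i' with e5 | e5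
          · rw [e5, Equiv.swap_apply_right]; rw [e5] at hab; omega
          · rw [Equiv.swap_apply_of_ne_of_ne e4 e5]; omega
  constructor
  · intro a b hab hb
    have := Fin.lt_def.mp hab
    exact key a b (hσ.1 a b hab hb) (by omega)
  · intro a b ha hab
    have := Fin.lt_def.mp hab
    exact key a b (hσ.2 a b ha hab) (by omega)

namespace SimplicialLieAlgebra

variable {k : Type u} [Field k] (X : SimplicialLieAlgebra.{u, w} k)

/-- The normalized chains are closed under the shuffle bracket. -/
theorem shuffleBracket_mem {p q r : ℕ} (h : p + q = r) {x : X.obj p} {y : X.obj q}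
    (hx : x ∈ X.normalized p) (hy : y ∈ X.normalized q) :
    X.shuffleBracket p q r h x y ∈ X.normalized r := by
  cases r with
  | zero => exact Submodule.mem_top
  | succ m =>
  rw [mem_normalized_succ]
  intro i
  change X.face i.succ (∑ σ : Equiv.Perm (Fin (m + 1)) with IsShuffle p σ,
      (Equiv.Perm.sign σ : ℤ) • ⁅X.map (stepMap (shuffleFst p σ) (card_shuffleFst h σ)) x,
        X.map (stepMap (shuffleSnd p σ) (card_shuffleSnd h σ)) y⁆) = 0
  rw [map_sum]
  have term : ∀ σ : Equiv.Perm (Fin (m + 1)), X.face i.succ ((Equiv.Perm.sign σ : ℤ) •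
      ⁅X.map (stepMap (shuffleFst p σ) (card_shuffleFst h σ)) x,
        X.map (stepMap (shuffleSnd p σ) (card_shuffleSnd h σ)) y⁆) = (Equiv.Perm.sign σ : ℤ) •
      ⁅X.map ((stepMap (shuffleFst p σ) (card_shuffleFst h σ)).comp
          (Fin.succAboveOrderEmb i.succ).toOrderHom) x,
        X.map ((stepMap (shuffleSnd p σ) (card_shuffleSnd h σ)).comp
          (Fin.succAboveOrderEmb i.succ).toOrderHom) y⁆ := by
    intro σ
    rw [map_zsmul, LieHom.map_lie, face, X.map_comp, X.map_comp]
  simp only [term]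
  have zero₁ : ∀ σ : Equiv.Perm (Fin (m + 1)), i ∈ shuffleFst p σ →
      (∀ b : Fin (m + 1), b.1 = i.1 + 1 → b ∈ shuffleFst p σ) →
      X.map ((stepMap (shuffleFst p σ) (card_shuffleFst h σ)).comp
          (Fin.succAboveOrderEmb i.succ).toOrderHom) x = 0 := by
    intro σ h1 h2
    obtain ⟨c, hc, hj⟩ := stepMap_face_ne _ (card_shuffleFst h σ) i h1 h2
    exact X.map_eq_zero hx _ c hc hj
  have zero₂ : ∀ σ : Equiv.Perm (Fin (m + 1)), i ∈ shuffleSnd p σ →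
      (∀ b : Fin (m + 1), b.1 = i.1 + 1 → b ∈ shuffleSnd p σ) →
      X.map ((stepMap (shuffleSnd p σ) (card_shuffleSnd h σ)).comp
          (Fin.succAboveOrderEmb i.succ).toOrderHom) y = 0 := by
    intro σ h1 h2
    obtain ⟨c, hc, hj⟩ := stepMap_face_ne _ (card_shuffleSnd h σ) i h1 h2
    exact X.map_eq_zero hy _ c hc hj
  have mem₁ : ∀ (σ : Equiv.Perm (Fin (m + 1))) a, a ∈ shuffleFst p σ ↔ (σ.symm a).1 < p := by
    simp [shuffleFst]
  have mem₂ : ∀ (σ : Equiv.Perm (Fin (m + 1))) a, a ∈ shuffleSnd p σ ↔ p ≤ (σ.symm a).1 := by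
    simp [shuffleSnd]
  by_cases hi : ∃ i' : Fin (m + 1), i'.1 = i.1 + 1
  · obtain ⟨i', hi'⟩ := hi
    have uniq : ∀ b : Fin (m + 1), b.1 = i.1 + 1 → b = i' := fun b hb => Fin.ext (by omega)
    have hne : i ≠ i' := fun e => by rw [e] at hi'; omega
    rw [← Finset.sum_filter_add_sum_filter_not _
      (fun σ : Equiv.Perm (Fin (m + 1)) => ((σ.symm i).1 < p ↔ (σ.symm i').1 < p))]
    rw [Finset.sum_eq_zero, zero_add]
    · refine Finset.sum_involution (fun σ _ => Equiv.swap i i' * σ) ?_ ?_ ?_ ?_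
      · intro σ hσ
        have fst : ∀ a, a ∈ shuffleFst p (Equiv.swap i i' * σ) ↔
            Equiv.swap i i' a ∈ shuffleFst p σ := by
          intro a
          rw [mem₁, mem₁]
          simp [Equiv.Perm.mul_def]
        have snd : ∀ a, a ∈ shuffleSnd p (Equiv.swap i i' * σ) ↔
            Equiv.swap i i' a ∈ shuffleSnd p σ := by
          intro a
          rw [mem₂, mem₂]
          simp [Equiv.Perm.mul_def]
        rw [stepMap_face_congr _ _ (card_shuffleFst h σ) (card_shuffleFst h _) i i' hi' fst,
          stepMap_face_congr _ _ (card_shuffleSnd h σ) (card_shuffleSnd h _) i i' hi' snd,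
          Equiv.Perm.sign_mul, Equiv.Perm.sign_swap hne]
        simp
      · intro σ _ _ e
        have : Equiv.swap i i' = 1 := by simpa using e
        rw [Equiv.swap_eq_one_iff] at this
        exact hne this
      · intro σ hσ
        simp only [Finset.mem_filter, Finset.mem_univ, true_and] at hσ ⊢
        refine ⟨hσ.1.swap i i' hi' hσ.2, ?_⟩
        have := hσ.2
        simp [Equiv.Perm.mul_def]
        tauto
      · intro σ _
        simp
    · intro σ hσ
      rw [Finset.mem_filter] at hσ
      by_cases hp : (σ.symm i).1 < p
      · rw [zero₁ σ ((mem₁ _ _).mpr hp) fun b hb => uniq b hb ▸ (mem₁ _ _).mpr (hσ.2.mp hp)]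
        simp
      · have : ¬ (σ.symm i').1 < p := fun e => hp (hσ.2.mpr e)
        rw [zero₂ σ ((mem₂ _ _).mpr (not_lt.mp hp)) fun b hb =>
          uniq b hb ▸ (mem₂ _ _).mpr (not_lt.mp this)]
        simp
  · refine Finset.sum_eq_zero fun σ _ => ?_
    by_cases hp : (σ.symm i).1 < p
    · rw [zero₁ σ ((mem₁ _ _).mpr hp) fun b hb => absurd ⟨b, hb⟩ hi]
      simp
    · rw [zero₂ σ ((mem₂ _ _).mpr (not_lt.mp hp)) fun b hb => absurd ⟨b, hb⟩ hi]
      simp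

/-- The normalized chains in cohomological grading: `(N X)^i = N_{-i} X` for `i ≤ 0`, and zero
for `i > 0`. -/
def normalizedPart (i : ℤ) : Submodule k (X.obj (-i).toNat) :=
  if i ≤ 0 then X.normalized (-i).toNat else ⊥

theorem mem_normalizedPart {i : ℤ} (hi : i ≤ 0) {x : X.obj (-i).toNat} :
    x ∈ X.normalizedPart i ↔ x ∈ X.normalized (-i).toNat := by
  rw [normalizedPart, if_pos hi]

/-- The normalized chains `N X` of a simplicial Lie algebra, with the differential `∂` and the
shuffle bracket. -/
def N : DGLieData.{u, w} k where
  X i := X.normalizedPart i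
  d i j h := if hi : i < 0 then
      (X.boundary (-i).toNat (-j).toNat (by omega)).restrict fun x hx =>
        (X.mem_normalizedPart (by omega)).mpr
          (X.boundary_mem _ ((X.mem_normalizedPart hi.le).mp hx))
    else 0
  bracket i j l h := if hij : i ≤ 0 ∧ j ≤ 0 then
      LinearMap.mk₂ k (fun x y => ⟨X.shuffleBracket (-i).toNat (-j).toNat (-l).toNat (by omega)
          x.1 y.1, by
        exact (X.mem_normalizedPart (by omega)).mpr (X.shuffleBracket_mem _
          ((X.mem_normalizedPart hij.1).mp x.2) ((X.mem_normalizedPart hij.2).mp y.2))⟩)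
      (fun _ _ _ => Subtype.ext (by simp)) (fun _ _ _ => Subtype.ext (by simp))
      (fun _ _ _ => Subtype.ext (by simp)) (fun _ _ _ => Subtype.ext (by simp))
    else 0

variable {X} in
/-- A morphism of simplicial Lie algebras. -/
structure Hom (X Y : SimplicialLieAlgebra.{u, w} k) where
  f : ∀ n, X.obj n →ₗ⁅k⁆ Y.obj n
  naturality : ∀ {m n : ℕ} (φ : Fin (m + 1) →o Fin (n + 1)) (x : X.obj n),
    f m (X.map φ x) = Y.map φ (f n x)

theorem Hom.mem_normalizedPart {X Y : SimplicialLieAlgebra.{u, w} k} (f : Hom X Y) {i : ℤ}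
    {x : X.obj (-i).toNat} (hx : x ∈ X.normalizedPart i) :
    f.f _ x ∈ Y.normalizedPart i := by
  have key : ∀ {n : ℕ} {x : X.obj n}, x ∈ X.normalized n → f.f n x ∈ Y.normalized n := by
    intro n x hx
    cases n with
    | zero => exact Submodule.mem_top
    | succ n =>
      rw [mem_normalized_succ] at hx ⊢
      intro i
      rw [face, ← f.naturality]
      have := hx i
      rw [face] at this
      rw [this, map_zero]
  unfold normalizedPart at hx ⊢
  split_ifs at hx ⊢ with hi
  · exact key hx
  · rw [Submodule.mem_bot] at hx ⊢
    rw [hx, map_zero]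

/-- The map of normalized chains induced by a morphism of simplicial Lie algebras. -/
def Hom.mapN {X Y : SimplicialLieAlgebra.{u, w} k} (f : Hom X Y) (i : ℤ) :
    X.N.X i →ₗ[k] Y.N.X i :=
  (f.f (-i).toNat : X.obj (-i).toNat →ₗ[k] Y.obj (-i).toNat).restrict
    fun _ hx => f.mem_normalizedPart hx

end SimplicialLieAlgebra

/-! ## The simplicial Lie algebra `L_• = Z^0 Ω_•(L)` and the integration map -/

namespace CompleteDGLie

variable {k : Type u} [Field k] (L : CompleteDGLie.{u, v} k)

namespace Hom

variable {L} {L' : CompleteDGLie.{u, v} k} (f : Hom L L')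

/-- The map `Ω_n(L) → Ω_n(L')`, `ω ⊗ x ↦ ω ⊗ f x`, in degree `c`. -/
def omegaMap (n : ℕ) (c : ℤ) : L.Omega n c →ₗ[k] L'.Omega n c where
  toFun ξ x := CTensor.map LinearMap.id (f.f x.1.2) (fun a y hy => f.map_filt _ a y hy) (ξ x)
  map_add' _ _ := by funext x; simp
  map_smul' _ _ := by funext x; simp

theorem omegaMap_mem_Z0 {n : ℕ} {ξ : L.Omega n 0} (hξ : ξ ∈ L.Z0 n) :
    f.omegaMap n 0 ξ ∈ L'.Z0 n := by
  rw [mem_Z0] at *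
  intro p i h
  have e₁ : L'.omegaDForm (f.omegaMap n 0 ξ) p i h = CTensor.map LinearMap.id (f.f i)
      (fun a y hy => f.map_filt _ a y hy) (L.omegaDForm ξ p i h) := by
    cases p with
    | zero => exact (map_zero _).symm
    | succ p =>
      simp only [omegaDForm, dForm, omegaMap, LinearMap.coe_mk, AddHom.coe_mk]
      rw [CTensor.map_map, CTensor.map_map]
      rfl
  have e₂ : L'.omegaDLie (f.omegaMap n 0 ξ) p i h = CTensor.map LinearMap.id (f.f i)
      (fun a y hy => f.map_filt _ a y hy) (L.omegaDLie ξ p i h) := by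
    simp only [omegaDLie, dLie, omegaMap, LinearMap.coe_mk, AddHom.coe_mk]
    rw [CTensor.map_map, CTensor.map_map]
    have hc : L'.d (i - 1) i (sub_add_cancel i 1) ∘ₗ f.f (i - 1) =
        f.f i ∘ₗ L.d (i - 1) i (sub_add_cancel i 1) :=
      LinearMap.ext fun x => (f.isHom.map_d _ _ _ x).symm
    simp only [hc]
  rw [e₁, e₂, ← map_smul, ← map_add, hξ, map_zero]

theorem omegaMap_bracket {n : ℕ} (ξ η : L.Omega n 0) :
    f.omegaMap n 0 (L.omegaBracket n ξ η) =
      L'.omegaBracket n (f.omegaMap n 0 ξ) (f.omegaMap n 0 η) := by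
  apply L'.omega_ext
  intro r
  rw [comp0_bracket]
  change CTensor.map LinearMap.id (f.f (-r)) (fun a y hy => f.map_filt _ a y hy)
    (L.comp0 (L.omegaBracket n ξ η) r) = _
  rw [comp0_bracket, map_sumAntidiag]
  refine sumAntidiag_congr fun p q e => ?_
  rw [map_smul]
  congr 1
  change _ = L'.compMul n p q r e (-p) (-q) (-r) _
    (CTensor.map LinearMap.id (f.f (-p)) (fun a y hy => f.map_filt _ a y hy) (L.comp0 ξ p))
    (CTensor.map LinearMap.id (f.f (-q)) (fun a y hy => f.map_filt _ a y hy) (L.comp0 η q))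
  have level : ∀ {p : ℕ} {i : ℤ} (x : L.Comp n p i) (a : ℕ),
      (CTensor.map (F' := L'.filt i) LinearMap.id (f.f i)
        (fun a y hy => f.map_filt _ a y hy) x).1 a =
        TensorProduct.map LinearMap.id
          (((L.filt i).F a).mapQ ((L'.filt i).F a) (f.f i)
            (fun y hy => f.map_filt _ a y hy)) (x.1 a) := fun _ _ => rfl
  generalize L.comp0 ξ p = x
  generalize L.comp0 η q = y
  apply CTensor.ext
  intro A
  rw [level, compMul_level, compMul_level, level, level]
  generalize x.1 A = x
  generalize y.1 A = y
  induction x using TensorProduct.induction_on with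
  | zero => simp
  | add x x' hx hx' => simp only [map_add, LinearMap.add_apply, hx, hx']
  | tmul ω x =>
    induction y using TensorProduct.induction_on with
    | zero => simp
    | add x x' hx hx' => simp only [map_add, hx, hx']
    | tmul η y =>
      obtain ⟨x, rfl⟩ := Submodule.Quotient.mk_surjective _ x
      obtain ⟨y, rfl⟩ := Submodule.Quotient.mk_surjective _ y
      change Forms.grMul k n p q r e ω η ⊗ₜ[k]
          ((L'.filt (-r)).F A).mkQ (f.f _ (L.bracket _ _ _ _ x y)) =
        Forms.grMul k n p q r e ω η ⊗ₜ[k]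
          ((L'.filt (-r)).F A).mkQ (L'.bracket _ _ _ _ (f.f _ x) (f.f _ y))
      rw [f.isHom.map_bracket]

end Hom

variable [CharZero k]

instance (n : ℕ) : LieRing (L.Z0 n) where
  bracket ξ η := ⟨L.omegaBracket n ξ.1 η.1, L.bracket_mem_Z0 ξ.2 η.2⟩
  add_lie _ _ _ := Subtype.ext (by simp)
  lie_add _ _ _ := Subtype.ext (by simp)
  lie_self ξ := by
    have h := L.omegaBracket_skew ξ.1 ξ.1
    have h₂ : L.omegaBracket n ξ.1 ξ.1 + L.omegaBracket n ξ.1 ξ.1 =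
        (-1 : k) • L.omegaBracket n ξ.1 ξ.1 + (1 : k) • L.omegaBracket n ξ.1 ξ.1 := by
      rw [← h, one_smul]
    rw [← add_smul, neg_add_cancel, zero_smul, ← two_smul k] at h₂
    exact Subtype.ext ((smul_eq_zero.mp h₂).resolve_left two_ne_zero)
  leibniz_lie ξ η ζ := Subtype.ext (L.omegaBracket_jacobi ξ.1 η.1 ζ.1)

instance (n : ℕ) : LieAlgebra k (L.Z0 n) where
  lie_smul c ξ η := Subtype.ext (map_smul (L.omegaBracket n ξ.1) c η.1)

/-- The simplicial Lie algebra `L_• = Z^0 Ω_•(L)`. -/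
def simplicial : SimplicialLieAlgebra.{u, max u v} k where
  obj n := L.Z0 n
  map φ :=
    { (L.omegaOp φ 0).restrict (fun _ hξ => L.op_mem_Z0 φ hξ) with
      map_lie' := fun {ξ η} => Subtype.ext (L.omegaOp_bracket φ ξ.1 η.1) }
  map_id n ξ := by
    apply Subtype.ext
    funext x
    change CTensor.map (Forms.grOp k OrderHom.id x.1.1) LinearMap.id _ (ξ.1 x) = ξ.1 x
    have : Forms.grOp k (OrderHom.id : Fin (n + 1) →o Fin (n + 1)) x.1.1 = LinearMap.id :=
      LinearMap.ext fun ω => Subtype.ext (DFunLike.congr_fun Forms.op_id ω.1)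
    simp only [this]
    exact CTensor.map_id _
  map_comp φ ψ ξ := by
    apply Subtype.ext
    funext x
    change CTensor.map (Forms.grOp k (φ.comp ψ) x.1.1) LinearMap.id _ (ξ.1 x) =
      CTensor.map (Forms.grOp k ψ x.1.1) LinearMap.id _
        (CTensor.map (Forms.grOp k φ x.1.1) LinearMap.id _ (ξ.1 x))
    have : Forms.grOp k (φ.comp ψ) x.1.1 = Forms.grOp k ψ x.1.1 ∘ₗ Forms.grOp k φ x.1.1 :=
      LinearMap.ext fun ω => Subtype.ext (DFunLike.congr_fun (Forms.op_comp φ ψ) ω.1)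
    simp only [this]
    rw [CTensor.map_map]
    rfl

/-- The normalized chains `N L_•`. -/
def NL : DGLieData.{u, max u v} k := L.simplicial.N

/-- The map `∫_{Δ^n} ⊗ 1 : Ω_n^n ⊗̂ L^i → L^i`, `ω ⊗ x ↦ ∫_{Δ^n} ω • x`. -/
noncomputable def integrate (n : ℕ) (i : ℤ) : L.Comp n n i →ₗ[k] L.X i :=
  (LinearEquiv.ofBijective (toFiltLim (L.filt i)) (L.complete i)).symm.toLinearMap ∘ₗ
    CTensor.eval (Forms.grIntegral k n)

/-- The map `I` on `L_n = Z^0 Ω_n(L)`: it sends `ξ`, with component `ξ_n ∈ Ω_n^n ⊗̂ L_n`, to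
`(-1)^{n(n-1)/2} (∫_{Δ^n} ⊗ 1) ξ_n ∈ L_n = L^i`, `i = -n`. -/
noncomputable def integrateZ0 (n : ℕ) (i : ℤ) (h : (n : ℤ) + i = 0) : L.Z0 n →ₗ[k] L.X i where
  toFun ξ := (-1 : k) ^ n.choose 2 • L.integrate n i (ξ.1 ⟨(n, i), h⟩)
  map_add' ξ η := by
    rw [← smul_add, ← map_add]
    rfl
  map_smul' c ξ := by
    rw [RingHom.id_apply, smul_comm c, ← map_smul (L.integrate n i) c]
    rfl

/-- The map `I : N L_• → L`. -/
noncomputable def I (i : ℤ) : L.NL.X i →ₗ[k] L.X i :=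
  if hi : i ≤ 0 then
    { toFun := fun x : L.simplicial.normalizedPart i =>
        L.integrateZ0 (-i).toNat i (by omega) x.1
      map_add' := fun x y : L.simplicial.normalizedPart i =>
        map_add (L.integrateZ0 (-i).toNat i (by omega)) x.1 y.1
      map_smul' := fun c (x : L.simplicial.normalizedPart i) =>
        map_smul (L.integrateZ0 (-i).toNat i (by omega)) c x.1 }
  else 0

namespace Hom

variable {L} {L' : CompleteDGLie.{u, v} k} (f : Hom L L')

/-- The morphism of simplicial Lie algebras `L_• → L'_•` induced by a morphism `L → L'`. -/
def simplicialMap : SimplicialLieAlgebra.Hom L.simplicial L'.simplicial where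
  f n :=
    { (f.omegaMap n 0).restrict (fun _ hξ => f.omegaMap_mem_Z0 hξ) with
      map_lie' := fun {ξ η} => Subtype.ext (f.omegaMap_bracket ξ.1 η.1) }
  naturality φ ξ := by
    apply Subtype.ext
    funext x
    change CTensor.map LinearMap.id (f.f x.1.2) _
        (CTensor.map (Forms.grOp k φ x.1.1) LinearMap.id _ (ξ.1 x)) =
      CTensor.map (Forms.grOp k φ x.1.1) LinearMap.id _
        (CTensor.map LinearMap.id (f.f x.1.2) _ (ξ.1 x))
    rw [CTensor.map_map, CTensor.map_map]
    rfl

/-- The map `N L_• → N L'_•` induced by a morphism `L → L'`. -/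
def mapNL (i : ℤ) : L.NL.X i →ₗ[k] L'.NL.X i := f.simplicialMap.mapN i

end Hom

end CompleteDGLie

end LieDoldKan

/-!
The bracket of normalized chains is rewritten as a sum over subsets: a `(p, q)`-shuffle is
determined by the set `S` of its first `p` values, its sign is the parity of the number of
inversions between `S` and its complement, and the two iterated degeneracies step exactly along
`S` and along the complement (`shuffleBracket_eq`). Skew symmetry is then the exchange of `S` and
its complement, the Jacobi identity reduces to that of the Lie algebras `X_n` by summing over
ordered partitions of the steps into three blocks, and the Leibniz rule follows by splitting the
subsets according to whether they contain the first step, since on normalized chains `∂` is the face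
opposite to the vertex `0`. This is `SimplicialLieAlgebra.N_isDGLie`.

The analysis on the simplex rests on one operator, the cone contraction onto the vertex `0`. The
dilation towards this vertex splits `Ω_n` into parts of weight `w = 0, 1, 2, …`; by Cartan's formula,
contraction with the Euler vector field, divided by `w` on the part of weight `w`, is a homotopy
between the identity and the evaluation at the vertex (`Forms.d_cone_add_cone_d`). It commutes with
the faces that contain the vertex `0`, and Dirichlet's integral shows that the integral of a top form
is the integral of its cone over the face opposite to this vertex (`Forms.integral_eq_integral_cone`).
Three facts follow by induction on the dimension:

* Stokes' theorem, `Forms.integral_d`;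
* the integral of a shuffle product of top forms is the product of the integrals
  (`Forms.integral_shuffleMul`), since the cone of the first factor gives a primitive of the product
  that vanishes on all faces but one;
* the complex of forms that vanish on the boundary and have integral zero is contractible
  (`Forms.exists_relativeZero_homotopy`). Together with an extension of forms from a face, this gives
  linear chain maps `T : Ω_n → Ω_{n+1}` that extend such forms from the face opposite to the vertex
  `0` to forms that vanish on the other faces (`Forms.exists_chain_extension`).

Everything passes to completed tensor products, because only linear maps of the first factor are
used. Stokes' theorem makes `I` a chain map, and the multiplicativity of the integral makes it
compatible with brackets: for degree reasons only the components in `Ω_p^p` and `Ω_q^q` contribute to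
the top component of a bracket in `Ω_{p+q}`. For the homology, let `∫ ω = 1`. If `dx = 0`, then
`ω ⊗ x` is a normalized cycle with integral `x`; in general a correction by the cone of `ω` shows
that `I` is surjective on chains in positive degrees. So for injectivity it is enough to show that a
normalized cycle `ξ` with `I ξ = 0` is a boundary. A linear map that vanishes on the forms with zero
boundary values and zero integral is a combination of the face maps and the integral, hence kills `ξ`
(`CTensor.mapLeft_eq_zero`). Therefore `T ⊗ 1` applied to `ξ` is normalized with boundary `ξ`. In
negative homological degrees `N L_•` is zero, which gives the criterion for a quasi-isomorphism.
-/

namespace LieDoldKan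

/-! ### Shuffles as subsets -/

/-- The sign `∏ (-1)` over all pairs `(a, b) ∈ A × B` with `b < a`: the sign of the shuffle that
lists `A` before `B`, when `A` and `B` are complementary. -/
def crossSign {r : ℕ} (A B : Finset (Fin r)) : ℤ :=
  ∏ a ∈ A, ∏ b ∈ B, if b < a then -1 else 1

theorem crossSign_union_right {r : ℕ} (A : Finset (Fin r)) {B C : Finset (Fin r)}
    (h : Disjoint B C) : crossSign A (B ∪ C) = crossSign A B * crossSign A C := by
  simp only [crossSign, Finset.prod_union h, Finset.prod_mul_distrib]

theorem crossSign_union_left {r : ℕ} {A B : Finset (Fin r)} (C : Finset (Fin r))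
    (h : Disjoint A B) : crossSign (A ∪ B) C = crossSign A C * crossSign B C := by
  simp only [crossSign, Finset.prod_union h]

theorem crossSign_map {r s : ℕ} (e : Fin r ↪o Fin s) (A B : Finset (Fin r)) :
    crossSign (A.map e.toEmbedding) (B.map e.toEmbedding) = crossSign A B := by
  simp [crossSign]

theorem crossSign_mul_comm {r : ℕ} {A B : Finset (Fin r)} (h : Disjoint A B) :
    crossSign A B * crossSign B A = (-1) ^ (A.card * B.card) := by
  rw [crossSign, crossSign, Finset.prod_comm (s := B), ← Finset.prod_mul_distrib]
  simp only [← Finset.prod_mul_distrib]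
  rw [Finset.prod_congr rfl fun a ha => Finset.prod_congr rfl fun b hb =>
    show ((if b < a then -1 else 1) * if a < b then -1 else 1 : ℤ) = -1 from ?_]
  · simp only [Finset.prod_const, ← pow_mul, mul_comm]
  · have : a ≠ b := fun e => Finset.disjoint_left.mp h ha (e ▸ hb)
    rcases lt_or_gt_of_ne this with h | h
    · simp [h, h.le]
    · simp [h, h.le]

theorem crossSign_mul_self {r : ℕ} (A B : Finset (Fin r)) :
    crossSign A B * crossSign A B = 1 := by
  simp only [crossSign, ← Finset.prod_mul_distrib]
  refine Finset.prod_eq_one fun a _ => Finset.prod_eq_one fun b _ => ?_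
  split_ifs <;> rfl

theorem crossSign_comm {r : ℕ} {A B : Finset (Fin r)} (h : Disjoint A B) :
    crossSign A B = (-1) ^ (A.card * B.card) * crossSign B A := by
  rw [← crossSign_mul_comm h, mul_assoc, crossSign_mul_self, mul_one]

theorem shuffleSnd_eq_compl (p : ℕ) {r : ℕ} (σ : Equiv.Perm (Fin r)) :
    shuffleSnd p σ = (shuffleFst p σ)ᶜ := by
  ext a; simp [shuffleFst, shuffleSnd]

/-- The sign of a shuffle counts the inversions between its two blocks. -/
theorem IsShuffle.sign_eq {p r : ℕ} {σ : Equiv.Perm (Fin r)} (h : IsShuffle p σ) :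
    (Equiv.Perm.sign σ : ℤ) = crossSign (shuffleFst p σ) (shuffleSnd p σ) := by
  have e₁ : shuffleFst p σ = (Finset.univ.filter fun a : Fin r => a.1 < p).map σ.toEmbedding := by
    ext a; simp [shuffleFst]
  have e₂ : shuffleSnd p σ = (Finset.univ.filter fun a : Fin r => p ≤ a.1).map σ.toEmbedding := by
    ext a; simp [shuffleSnd]
  rw [e₁, e₂, crossSign, Finset.prod_map, Equiv.Perm.sign_eq_prod_prod_Ioi, Units.coe_prod,
    Finset.prod_filter]
  refine Finset.prod_congr rfl fun i _ => ?_
  rw [Units.coe_prod, Finset.prod_map]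
  split_ifs with hi
  · have hsub : (Finset.univ.filter fun a : Fin r => p ≤ a.1) ⊆ Finset.Ioi i := by
      intro a ha
      simp only [Finset.mem_filter, Finset.mem_univ, true_and, Finset.mem_Ioi] at ha ⊢
      exact Fin.lt_def.mpr (by omega)
    rw [← Finset.prod_subset hsub]
    · refine Finset.prod_congr rfl fun j hj => ?_
      have hne : σ i ≠ σ j := by
        have := Finset.mem_Ioi.mp (hsub hj)
        exact fun e => this.ne (σ.injective e)
      rcases lt_or_gt_of_ne hne with h | h
      · simp [h, h.le]
      · simp [h, h.le]
    · intro j hj hj'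
      simp only [Finset.mem_filter, Finset.mem_univ, true_and, not_le] at hj'
      rw [if_pos (h.1 i j (Finset.mem_Ioi.mp hj) hj')]
      rfl
  · refine Finset.prod_eq_one fun j hj => ?_
    rw [if_pos (h.2 i j (not_lt.mp hi) (Finset.mem_Ioi.mp hj))]
    rfl

/-- A shuffle is determined by its first block. -/
theorem IsShuffle.ext {p r : ℕ} {σ τ : Equiv.Perm (Fin r)} (hσ : IsShuffle p σ)
    (hτ : IsShuffle p τ) (h : shuffleFst p σ = shuffleFst p τ) : σ = τ := by
  -- `τ⁻¹ σ` is monotone on each of the blocks `[0, p)` and `[p, r)`, and preserves them.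
  have hlt : ∀ a : Fin r, (τ.symm (σ a)).1 < p ↔ a.1 < p := by
    intro a
    have := Finset.ext_iff.mp h (σ a)
    simpa [shuffleFst] using this.symm
  have hmono : StrictMono fun a => τ.symm (σ a) := by
    intro a b hab
    have hab' := Fin.lt_def.mp hab
    by_cases hb : b.1 < p
    · have h1 := hσ.1 a b hab hb
      by_contra hn
      rcases (not_lt.mp hn).lt_or_eq with hc | hc
      · have := hτ.1 _ _ hc ((hlt a).mpr (by omega))
        simp only [Equiv.apply_symm_apply] at this
        exact absurd h1 this.asymm
      · exact hab.ne (σ.injective (τ.symm.injective hc.symm))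
    · by_cases ha : a.1 < p
      · have h1 := (hlt a).mpr ha
        have h2 := mt (hlt b).mp hb
        exact Fin.lt_def.mpr (by dsimp only; omega)
      · have h1 := hσ.2 a b (not_lt.mp ha) hab
        by_contra hn
        rcases (not_lt.mp hn).lt_or_eq with hc | hc
        · have := hτ.2 _ _ (not_lt.mp (mt (hlt b).mp hb)) hc
          simp only [Equiv.apply_symm_apply] at this
          exact absurd h1 this.asymm
        · exact hab.ne (σ.injective (τ.symm.injective hc.symm))
  have hid : (fun a => τ.symm (σ a)) = id :=
    (hmono.range_inj strictMono_id).mp (by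
      rw [Set.range_id, Set.range_eq_univ]
      exact τ.symm.surjective.comp σ.surjective)
  ext1 a
  have := congr_fun hid a
  simpa [Equiv.symm_apply_eq] using this

/-- Every subset is the first block of a shuffle. -/
theorem exists_isShuffle {p r : ℕ} (S : Finset (Fin r)) (hS : S.card = p) :
    ∃ σ : Equiv.Perm (Fin r), IsShuffle p σ ∧ shuffleFst p σ = S := by
  have hpr : p ≤ r := by simpa [hS] using Finset.card_le_univ S
  obtain ⟨q, rfl⟩ := Nat.exists_eq_add_of_le hpr
  have hc : Sᶜ.card = q := by rw [Finset.card_compl, hS, Fintype.card_fin]; omega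
  let σ : Equiv.Perm (Fin (p + q)) := finSumFinEquiv.symm.trans (finSumEquivOfFinset hS hc)
  have h₁ : ∀ i : Fin p, σ (Fin.castAdd q i) = S.orderEmbOfFin hS i := fun i => by simp [σ]
  have h₂ : ∀ i : Fin q, σ (Fin.natAdd p i) = Sᶜ.orderEmbOfFin hc i := fun i => by simp [σ]
  refine ⟨σ, ⟨?_, ?_⟩, ?_⟩
  · intro a b hab hb
    have := Fin.lt_def.mp hab
    have ea : σ a = _ := h₁ ⟨a.1, by omega⟩
    have eb : σ b = _ := h₁ ⟨b.1, hb⟩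
    rw [ea, eb]
    exact (S.orderEmbOfFin hS).strictMono this
  · intro a b ha hab
    have := Fin.lt_def.mp hab
    have ea : σ a = _ := (congrArg σ (Fin.ext (by simp; omega))).trans (h₂ ⟨a.1 - p, by omega⟩)
    have eb : σ b = _ := (congrArg σ (Fin.ext (by simp; omega))).trans (h₂ ⟨b.1 - p, by omega⟩)
    rw [ea, eb]
    exact (Sᶜ.orderEmbOfFin hc).strictMono (Fin.lt_def.mpr (by dsimp only; omega))
  · ext a
    obtain ⟨b, rfl⟩ := σ.surjective a
    simp only [shuffleFst, Finset.mem_filter, Finset.mem_univ, true_and, Equiv.symm_apply_apply]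
    induction b using Fin.addCases with
    | left i => rw [h₁]; simp
    | right i =>
      rw [h₂]
      have := Finset.mem_compl.mp (Finset.orderEmbOfFin_mem Sᶜ hc i)
      simp [this]

/-- Summation over shuffles is summation over subsets. -/
theorem sum_isShuffle {M : Type*} [AddCommMonoid M] (p : ℕ) {r : ℕ} (F : Finset (Fin r) → M)
    (hF : ∀ S, S.card ≠ p → F S = 0) (hp : p ≤ r) :
    ∑ σ : Equiv.Perm (Fin r) with IsShuffle p σ, F (shuffleFst p σ) = ∑ S, F S := by
  obtain ⟨q, rfl⟩ := Nat.exists_eq_add_of_le hp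
  rw [← Finset.sum_filter_of_ne (p := fun S => S.card = p) fun S _ h => not_imp_comm.mp (hF S) h]
  refine Finset.sum_bij (fun σ _ => shuffleFst p σ) ?_ ?_ ?_ fun _ _ => rfl
  · intro σ _
    simp [card_shuffleFst rfl σ]
  · intro σ hσ τ hτ e
    exact IsShuffle.ext (Finset.mem_filter.mp hσ).2 (Finset.mem_filter.mp hτ).2 e
  · intro S hS
    obtain ⟨σ, h, e⟩ := exists_isShuffle S (Finset.mem_filter.mp hS).2
    exact ⟨σ, Finset.mem_filter.mpr ⟨Finset.mem_univ _, h⟩, e⟩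

theorem lt_card_filter_orderEmb {b r : ℕ} (e : Fin b ↪o Fin r) (t : Fin b) (j : ℕ) :
    t.1 < (Finset.univ.filter fun i => (e i).1 < j).card ↔ (e t).1 < j := by
  constructor
  · intro h
    by_contra hn
    have : (Finset.univ.filter fun i => (e i).1 < j) ⊆ Finset.Iio t := by
      intro i hi
      rw [Finset.mem_filter] at hi
      rw [Finset.mem_Iio]
      by_contra hit
      have := Fin.le_def.mp (e.monotone (not_lt.mp hit))
      omega
    have := Finset.card_le_card this
    rw [Fin.card_Iio] at this
    omega
  · intro h
    have : Finset.Iic t ⊆ (Finset.univ.filter fun i => (e i).1 < j) := by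
      intro i hi
      have := Fin.le_def.mp (e.monotone (Finset.mem_Iic.mp hi))
      simp
      omega
    have := Finset.card_le_card this
    rw [Fin.card_Iic] at this
    omega

theorem stepMap_val {r p : ℕ} (S : Finset (Fin r)) (hS : S.card = p) (j : Fin (r + 1)) :
    (stepMap S hS j).1 = (S.filter fun a => a.1 < j.1).card := rfl

theorem stepMap_comp {r b q : ℕ} (S : Finset (Fin r)) (hS : S.card = b) (T : Finset (Fin b))
    (hT : T.card = q) (hT' : (T.map (S.orderEmbOfFin hS).toEmbedding).card = q) :
    (stepMap T hT).comp (stepMap S hS) =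
      stepMap (T.map (S.orderEmbOfFin hS).toEmbedding) hT' := by
  ext j
  rw [OrderHom.comp_coe, Function.comp_apply, stepMap_val _ hT, stepMap_val _ hT']
  have e : (S.filter fun a => a.1 < j.1).card =
      (Finset.univ.filter fun i => (S.orderEmbOfFin hS i).1 < j.1).card := by
    conv_lhs => rw [← Finset.map_orderEmbOfFin_univ S hS, Finset.filter_map, Finset.card_map]
    rfl
  rw [Finset.filter_map, Finset.card_map]
  congr 1
  ext t
  rw [Finset.mem_filter, Finset.mem_filter, stepMap_val, e, lt_card_filter_orderEmb]
  rfl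

/-- If the first step is in the set, then the face opposite to the vertex `0` commutes with the
degeneracy. -/
theorem stepMap_insert_zero {r p : ℕ} (S : Finset (Fin r)) (hS : S.card = p)
    (h : (insert 0 (S.map (Fin.succEmb r))).card = p + 1) :
    (stepMap (insert 0 (S.map (Fin.succEmb r))) h).comp
        (Fin.succAboveOrderEmb (0 : Fin (r + 2))).toOrderHom =
      ((Fin.succAboveOrderEmb (0 : Fin (p + 2))).toOrderHom).comp (stepMap S hS) := by
  ext j
  simp [stepMap_val, Finset.filter_insert, Finset.filter_map, Function.comp_def]
  rfl

/-- If the first step is not in the set, then the face opposite to the vertex `0` cancels a step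
of the degeneracy. -/
theorem stepMap_map_succ {r p : ℕ} (S : Finset (Fin r)) (hS : S.card = p)
    (h : (S.map (Fin.succEmb r)).card = p) :
    (stepMap (S.map (Fin.succEmb r)) h).comp
        (Fin.succAboveOrderEmb (0 : Fin (r + 2))).toOrderHom = stepMap S hS := by
  ext j
  simp [stepMap_val, Finset.filter_map, Function.comp_def]
  rfl

/-- The subsets of `Fin (r + 1)` that do, or do not, contain `0`. -/
theorem sum_finset_fin_succ {M : Type*} [AddCommMonoid M] {r : ℕ} (F : Finset (Fin (r + 1)) → M) :
    ∑ S, F S = ∑ S : Finset (Fin r), F (S.map (Fin.succEmb r)) +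
      ∑ S : Finset (Fin r), F (insert 0 (S.map (Fin.succEmb r))) := by
  have h0 : (0 : Fin (r + 1)) ∉ Finset.univ.map (Fin.succEmb r) := by simp
  have e : ∀ G : Finset (Fin (r + 1)) → M,
      ∑ S ∈ (Finset.univ.map (Fin.succEmb r)).powerset, G S =
        ∑ S : Finset (Fin r), G (S.map (Fin.succEmb r)) := by
    intro G
    have : (Finset.univ.map (Fin.succEmb r)).powerset =
        (Finset.univ : Finset (Finset (Fin r))).map
          (Finset.mapEmbedding (Fin.succEmb r)).toEmbedding := by
      ext S
      simp [Finset.subset_map_iff, eq_comm]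
    rw [this, Finset.sum_map]
    rfl
  have hu : (Finset.univ : Finset (Fin (r + 1))) = insert 0 (Finset.univ.map (Fin.succEmb r)) := by
    ext a
    simp only [Finset.mem_univ, Finset.mem_insert, Finset.mem_map, true_and, true_iff,
      Fin.coe_succEmb]
    exact (Fin.eq_zero_or_eq_succ a).imp id fun ⟨j, hj⟩ => ⟨j, hj.symm⟩
  rw [← Finset.powerset_univ, hu, Finset.sum_powerset_insert h0, e, e]

theorem compl_map_succ {r : ℕ} (S : Finset (Fin r)) :
    (S.map (Fin.succEmb r))ᶜ = insert 0 (Sᶜ.map (Fin.succEmb r)) := by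
  ext a
  induction a using Fin.cases <;> simp

theorem compl_insert_zero {r : ℕ} (S : Finset (Fin r)) :
    (insert 0 (S.map (Fin.succEmb r)))ᶜ = Sᶜ.map (Fin.succEmb r) := by
  rw [← compl_compl (Sᶜ.map (Fin.succEmb r)), compl_map_succ, compl_compl]

theorem crossSign_insert_zero_left {r : ℕ} (A B : Finset (Fin r)) :
    crossSign (insert 0 (A.map (Fin.succEmb r))) (B.map (Fin.succEmb r)) = crossSign A B := by
  simp [crossSign, Finset.prod_insert]

theorem crossSign_insert_zero_right {r : ℕ} (A B : Finset (Fin r)) :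
    crossSign (A.map (Fin.succEmb r)) (insert 0 (B.map (Fin.succEmb r))) =
      (-1) ^ A.card * crossSign A B := by
  simp [crossSign, Finset.prod_insert, Finset.prod_neg]

/-! ### The dg Lie algebra of normalized chains -/

namespace SimplicialLieAlgebra

variable {k : Type u} [Field k] (X : SimplicialLieAlgebra.{u, w} k)

/-- The iterated degeneracy `X_p → X_r` that increases at the steps in `S`; it is extended by zero
to the sets `S` that do not have `p` elements. -/
def act {p r : ℕ} (S : Finset (Fin r)) : X.obj p →ₗ⁅k⁆ X.obj r :=
  if h : S.card = p then X.map (stepMap S h) else 0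

theorem act_of_card {p r : ℕ} {S : Finset (Fin r)} (h : S.card = p) (x : X.obj p) :
    X.act S x = X.map (stepMap S h) x := by
  rw [act, dif_pos h]

theorem act_of_card_ne {p r : ℕ} {S : Finset (Fin r)} (h : S.card ≠ p) (x : X.obj p) :
    X.act S x = 0 := by
  rw [act, dif_neg h]; rfl

theorem act_act {b q r : ℕ} (S : Finset (Fin r)) (hS : S.card = b) (T : Finset (Fin b))
    (y : X.obj q) :
    X.act S (X.act T y) = X.act (T.map (S.orderEmbOfFin hS).toEmbedding) y := by
  rw [X.act_of_card hS]
  by_cases hT : T.card = q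
  · rw [X.act_of_card hT, X.act_of_card ((Finset.card_map _).trans hT), ← X.map_comp,
      stepMap_comp]
  · rw [X.act_of_card_ne hT, X.act_of_card_ne (by rwa [Finset.card_map]), map_zero]

theorem face_zero_act_insert {p r : ℕ} (S : Finset (Fin r)) (x : X.obj (p + 1)) :
    X.face 0 (X.act (insert 0 (S.map (Fin.succEmb r))) x) = X.act S (X.face 0 x) := by
  have hc : (insert 0 (S.map (Fin.succEmb r))).card = S.card + 1 := by
    rw [Finset.card_insert_of_notMem (by simp), Finset.card_map]
  by_cases hS : S.card = p
  · rw [X.act_of_card hS, X.act_of_card (hc.trans (congrArg (· + 1) hS)), face, face,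
      ← X.map_comp, ← X.map_comp, stepMap_insert_zero S hS]
  · rw [X.act_of_card_ne hS, X.act_of_card_ne (by omega), map_zero]

theorem face_zero_act_map {p r : ℕ} (S : Finset (Fin r)) (x : X.obj p) :
    X.face 0 (X.act (S.map (Fin.succEmb r)) x) = X.act S x := by
  by_cases hS : S.card = p
  · rw [X.act_of_card hS, X.act_of_card ((Finset.card_map _).trans hS), face, ← X.map_comp,
      stepMap_map_succ S hS]
  · rw [X.act_of_card_ne hS, X.act_of_card_ne (by rwa [Finset.card_map]), map_zero]

/-- The shuffle bracket as a sum over subsets. -/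
theorem shuffleBracket_eq {p q r : ℕ} (h : p + q = r) (x : X.obj p) (y : X.obj q) :
    X.shuffleBracket p q r h x y =
      ∑ S : Finset (Fin r), crossSign S Sᶜ • ⁅X.act S x, X.act Sᶜ y⁆ := by
  rw [← sum_isShuffle p _ _ (by omega)]
  · refine Finset.sum_congr rfl fun σ hσ => ?_
    rw [(Finset.mem_filter.mp hσ).2.sign_eq, X.act_of_card (card_shuffleFst h σ),
      ← shuffleSnd_eq_compl, X.act_of_card (card_shuffleSnd h σ)]
  · intro S hS
    rw [X.act_of_card_ne hS, zero_lie, smul_zero]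

theorem shuffleBracket_skew {p q r : ℕ} (h : p + q = r) (h' : q + p = r) (x : X.obj p)
    (y : X.obj q) : X.shuffleBracket p q r h x y =
      -((-1 : ℤ) ^ (p * q) • X.shuffleBracket q p r h' y x) := by
  rw [X.shuffleBracket_eq, X.shuffleBracket_eq, Finset.smul_sum, ← Finset.sum_neg_distrib]
  refine Finset.sum_bij (fun S _ => Sᶜ) (fun _ _ => Finset.mem_univ _)
    (fun _ _ _ _ e => compl_injective e) (fun S _ => ⟨Sᶜ, Finset.mem_univ _, compl_compl S⟩) ?_
  intro S _
  rw [compl_compl, ← lie_skew (X.act S x), smul_neg, smul_smul]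
  by_cases hS : S.card = p
  · have hc : Sᶜ.card = q := by rw [Finset.card_compl, hS, Fintype.card_fin]; omega
    rw [crossSign_comm disjoint_compl_right, hS, hc]
  · rw [X.act_of_card_ne hS, lie_zero, smul_zero, smul_zero]

/-- A degeneracy of a shuffle bracket is a sum over the partitions of the set of its steps. -/
theorem act_shuffleBracket {q s b r : ℕ} (h : q + s = b) (S : Finset (Fin r)) (y : X.obj q)
    (z : X.obj s) : X.act S (X.shuffleBracket q s b h y z) =
      ∑ B ∈ S.powerset, crossSign B (S \ B) • ⁅X.act B y, X.act (S \ B) z⁆ := by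
  by_cases hS : S.card = b
  · have hE := Finset.map_orderEmbOfFin_univ S hS
    have e : S.powerset = (Finset.univ : Finset (Finset (Fin b))).map
        (Finset.mapEmbedding (S.orderEmbOfFin hS).toEmbedding).toEmbedding := by
      ext B
      have := Finset.subset_map_iff (f := (S.orderEmbOfFin hS).toEmbedding) (s := B)
        (t := Finset.univ)
      rw [hE] at this
      simpa [eq_comm] using this
    rw [e, Finset.sum_map, X.shuffleBracket_eq, map_sum]
    refine Finset.sum_congr rfl fun T _ => ?_
    have hc : S \ T.map (S.orderEmbOfFin hS).toEmbedding =
        Tᶜ.map (S.orderEmbOfFin hS).toEmbedding := by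
      rw [Finset.compl_eq_univ_sdiff, Finset.map_sdiff, hE]
    simp only [RelEmbedding.coe_toEmbedding, Finset.mapEmbedding_apply]
    rw [hc, crossSign_map, map_zsmul, LieHom.map_lie, X.act_act S hS, X.act_act S hS]
  · rw [X.act_of_card_ne hS]
    refine (Finset.sum_eq_zero fun B hB => ?_).symm
    by_cases hB' : B.card = q
    · have := Finset.card_sdiff_add_card_eq_card (Finset.mem_powerset.mp hB)
      rw [X.act_of_card_ne (S := S \ B) (by omega), lie_zero, smul_zero]
    · rw [X.act_of_card_ne hB', zero_lie, smul_zero]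

/-- Both sides of the Jacobi identity are sums over the ordered partitions of the set of steps into
three parts. -/
theorem shuffleBracket_shuffleBracket {p q s b r : ℕ} (h : q + s = b) (h' : p + b = r)
    (x : X.obj p) (y : X.obj q) (z : X.obj s) :
    X.shuffleBracket p b r h' x (X.shuffleBracket q s b h y z) =
      ∑ A : Finset (Fin r), ∑ B ∈ Aᶜ.powerset,
        (crossSign A B * crossSign A (A ∪ B)ᶜ * crossSign B (A ∪ B)ᶜ) •
          ⁅X.act A x, ⁅X.act B y, X.act (A ∪ B)ᶜ z⁆⁆ := by
  rw [X.shuffleBracket_eq]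
  refine Finset.sum_congr rfl fun A _ => ?_
  rw [X.act_shuffleBracket, lie_sum, Finset.smul_sum]
  refine Finset.sum_congr rfl fun B hB => ?_
  have hB' := Finset.mem_powerset.mp hB
  have hc : Aᶜ \ B = (A ∪ B)ᶜ := by ext a; simp
  rw [lie_zsmul, smul_smul, hc]
  congr 2
  rw [← crossSign_union_right, ← hc, Finset.union_sdiff_of_subset hB']
  rw [← hc]
  exact Finset.disjoint_sdiff

theorem shuffleBracket_shuffleBracket_left {p q s a r : ℕ} (h : p + q = a) (h' : a + s = r)
    (x : X.obj p) (y : X.obj q) (z : X.obj s) :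
    X.shuffleBracket a s r h' (X.shuffleBracket p q a h x y) z =
      ∑ A : Finset (Fin r), ∑ B ∈ Aᶜ.powerset,
        (crossSign A B * crossSign A (A ∪ B)ᶜ * crossSign B (A ∪ B)ᶜ) •
          ⁅⁅X.act A x, X.act B y⁆, X.act (A ∪ B)ᶜ z⁆ := by
  rw [X.shuffleBracket_eq]
  have e : ∀ U : Finset (Fin r),
      crossSign U Uᶜ • ⁅X.act U (X.shuffleBracket p q a h x y), X.act Uᶜ z⁆ =
      ∑ A ∈ U.powerset, (crossSign U Uᶜ * crossSign A (U \ A)) •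
          ⁅⁅X.act A x, X.act (U \ A) y⁆, X.act Uᶜ z⁆ := by
    intro U
    rw [X.act_shuffleBracket, sum_lie, Finset.smul_sum]
    refine Finset.sum_congr rfl fun A _ => ?_
    rw [zsmul_lie, smul_smul]
  simp only [e]
  rw [Finset.sum_sigma', Finset.sum_sigma']
  refine Finset.sum_bij' (fun w _ => ⟨w.2, w.1 \ w.2⟩) (fun w _ => ⟨w.1 ∪ w.2, w.1⟩) ?_ ?_ ?_ ?_ ?_
  · rintro ⟨U, A⟩ hw
    simp only [Finset.mem_sigma, Finset.mem_univ, Finset.mem_powerset, true_and] at hw ⊢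
    intro a
    simp
  · rintro ⟨A, B⟩ _
    exact Finset.mem_sigma.mpr ⟨Finset.mem_univ _,
      Finset.mem_powerset.mpr Finset.subset_union_left⟩
  · rintro ⟨U, A⟩ hw
    simp only [Finset.mem_sigma, Finset.mem_univ, Finset.mem_powerset, true_and] at hw
    simp [Finset.union_sdiff_of_subset hw]
  · rintro ⟨A, B⟩ hw
    simp only [Finset.mem_sigma, Finset.mem_univ, Finset.mem_powerset, true_and] at hw
    have : Disjoint A B := (Finset.subset_compl_iff_disjoint_left.mp hw)
    simp [Finset.union_sdiff_cancel_left this]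
  · rintro ⟨U, A⟩ hw
    simp only [Finset.mem_sigma, Finset.mem_univ, Finset.mem_powerset, true_and] at hw
    have hU := Finset.union_sdiff_of_subset hw
    dsimp only
    rw [hU, mul_assoc, ← crossSign_union_left _ Finset.disjoint_sdiff, hU, mul_comm]

theorem shuffleBracket_jacobi {p q s a b c r : ℕ} (hpq : p + q = a) (hqs : q + s = b)
    (hps : p + s = c) (h₁ : p + b = r) (h₂ : a + s = r) (h₃ : q + c = r)
    (x : X.obj p) (y : X.obj q) (z : X.obj s) :
    X.shuffleBracket p b r h₁ x (X.shuffleBracket q s b hqs y z) =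
      X.shuffleBracket a s r h₂ (X.shuffleBracket p q a hpq x y) z +
        (-1 : ℤ) ^ (p * q) • X.shuffleBracket q c r h₃ y (X.shuffleBracket p s c hps x z) := by
  have e₃ := (X.shuffleBracket_shuffleBracket hps h₃ y x z).trans
    (Finset.sum_comm' (t' := Finset.univ) (s' := fun A => Aᶜ.powerset) fun B A => by
      simp [Finset.subset_compl_comm])
  rw [X.shuffleBracket_shuffleBracket, X.shuffleBracket_shuffleBracket_left, e₃,
    Finset.smul_sum, ← Finset.sum_add_distrib]
  refine Finset.sum_congr rfl fun A _ => ?_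
  rw [Finset.smul_sum, ← Finset.sum_add_distrib]
  refine Finset.sum_congr rfl fun B hB => ?_
  have hd : Disjoint A B := Finset.subset_compl_iff_disjoint_left.mp (Finset.mem_powerset.mp hB)
  rw [leibniz_lie (X.act A x), smul_add, smul_smul, Finset.union_comm B A]
  congr 1
  by_cases hAp : A.card = p
  · by_cases hBq : B.card = q
    · rw [crossSign_comm hd, hAp, hBq]
      congr 1
      ring
    · rw [X.act_of_card_ne hBq, zero_lie, smul_zero, smul_zero]
  · rw [X.act_of_card_ne hAp, zero_lie, lie_zero, smul_zero, smul_zero]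

theorem boundary_eq_face {n m : ℕ} (h : n = m + 1) {x : X.obj n} (hx : x ∈ X.normalized n) :
    X.boundary n m h x = X.face 0 (h ▸ x) := by
  subst h
  rw [mem_normalized_succ] at hx
  rw [boundary, LinearMap.sum_apply, Fin.sum_univ_succ, Finset.sum_eq_zero]
  · simp
  · intro i _
    simp [hx i]

/-- The face opposite to the vertex `0` is a derivation of the shuffle product. -/
theorem face_zero_shuffleBracket {p q r : ℕ} (h : p + 1 + (q + 1) = r + 1)
    (h₁ : p + (q + 1) = r) (h₂ : p + 1 + q = r) (x : X.obj (p + 1)) (y : X.obj (q + 1)) :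
    X.face 0 (X.shuffleBracket (p + 1) (q + 1) (r + 1) h x y) =
      X.shuffleBracket p (q + 1) r h₁ (X.face 0 x) y +
        (-1 : ℤ) ^ (p + 1) • X.shuffleBracket (p + 1) q r h₂ x (X.face 0 y) := by
  simp only [X.shuffleBracket_eq]
  rw [map_sum, sum_finset_fin_succ, add_comm, Finset.smul_sum]
  congr 1
  · refine Finset.sum_congr rfl fun S _ => ?_
    rw [map_zsmul, LieHom.map_lie, X.face_zero_act_insert, compl_insert_zero,
      X.face_zero_act_map, crossSign_insert_zero_left]
  · refine Finset.sum_congr rfl fun S _ => ?_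
    rw [map_zsmul, LieHom.map_lie, X.face_zero_act_map, compl_map_succ,
      X.face_zero_act_insert, crossSign_insert_zero_right, smul_smul]
    by_cases hS : S.card = p + 1
    · rw [hS]
    · rw [X.act_of_card_ne hS, zero_lie, smul_zero, smul_zero]

theorem face_zero_shuffleBracket_zero_left {q r : ℕ} (h : 0 + (q + 1) = r + 1)
    (h₂ : 0 + q = r) (x : X.obj 0) (y : X.obj (q + 1)) :
    X.face 0 (X.shuffleBracket 0 (q + 1) (r + 1) h x y) =
      X.shuffleBracket 0 q r h₂ x (X.face 0 y) := by
  simp only [X.shuffleBracket_eq]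
  rw [map_sum, sum_finset_fin_succ, add_comm, Finset.sum_eq_zero, zero_add]
  · refine Finset.sum_congr rfl fun S _ => ?_
    rw [map_zsmul, LieHom.map_lie, X.face_zero_act_map, compl_map_succ,
      X.face_zero_act_insert, crossSign_insert_zero_right]
    by_cases hS : S.card = 0
    · rw [hS, pow_zero, one_mul]
    · rw [X.act_of_card_ne hS, zero_lie, smul_zero, smul_zero]
  · intro S _
    rw [X.act_of_card_ne (by simp), zero_lie, smul_zero, map_zero]

theorem face_zero_shuffleBracket_zero_right {p r : ℕ} (h : p + 1 + 0 = r + 1)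
    (h₁ : p + 0 = r) (x : X.obj (p + 1)) (y : X.obj 0) :
    X.face 0 (X.shuffleBracket (p + 1) 0 (r + 1) h x y) =
      X.shuffleBracket p 0 r h₁ (X.face 0 x) y := by
  simp only [X.shuffleBracket_eq]
  rw [map_sum, sum_finset_fin_succ, add_comm, add_eq_left.mpr]
  · refine Finset.sum_congr rfl fun S _ => ?_
    rw [map_zsmul, LieHom.map_lie, X.face_zero_act_insert, compl_insert_zero,
      X.face_zero_act_map, crossSign_insert_zero_left]
  · refine Finset.sum_eq_zero fun S _ => ?_
    rw [X.act_of_card_ne (S := (S.map (Fin.succEmb r))ᶜ) (by simp [compl_map_succ]), lie_zero,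
      smul_zero, map_zero]

theorem boundary_boundary {n m l : ℕ} (h : n = m + 1) (h' : m = l + 1) {x : X.obj n}
    (hx : x ∈ X.normalized n) : X.boundary m l h' (X.boundary n m h x) = 0 := by
  rw [X.boundary_eq_face h' (X.boundary_mem h hx), X.boundary_eq_face h hx]
  subst h h'
  have : ((Fin.succAboveOrderEmb (0 : Fin (l + 3))).toOrderHom).comp
      (Fin.succAboveOrderEmb (0 : Fin (l + 2))).toOrderHom =
      ((Fin.succAboveOrderEmb (1 : Fin (l + 3))).toOrderHom).comp
        (Fin.succAboveOrderEmb (0 : Fin (l + 2))).toOrderHom := by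
    ext j
    simp [Fin.succAbove, Fin.lt_def]
  have hx1 : X.map (Fin.succAboveOrderEmb (1 : Fin (l + 3))).toOrderHom x = 0 :=
    X.mem_normalized_succ.mp hx 0
  rw [face, face]
  change X.map _ (X.map _ x) = 0
  rw [← X.map_comp, this, X.map_comp, hx1, map_zero]

theorem boundary_shuffleBracket {p q r p' q' r' : ℕ} (h : p + q = r) (hp : p = p' + 1)
    (hq : q = q' + 1) (hr : r = r' + 1) (h₁ : p' + q = r') (h₂ : p + q' = r') {x : X.obj p}
    {y : X.obj q} (hx : x ∈ X.normalized p) (hy : y ∈ X.normalized q) :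
    X.boundary r r' hr (X.shuffleBracket p q r h x y) =
      X.shuffleBracket p' q r' h₁ (X.boundary p p' hp x) y +
        (-1 : ℤ) ^ p • X.shuffleBracket p q' r' h₂ x (X.boundary q q' hq y) := by
  rw [X.boundary_eq_face hr (X.shuffleBracket_mem h hx hy), X.boundary_eq_face hp hx,
    X.boundary_eq_face hq hy]
  subst hp hq hr
  exact X.face_zero_shuffleBracket h h₁ h₂ x y

theorem boundary_shuffleBracket_zero_left {p q r q' r' : ℕ} (h : p + q = r) (hp : p = 0)
    (hq : q = q' + 1) (hr : r = r' + 1) (h₂ : p + q' = r') {x : X.obj p}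
    {y : X.obj q} (hx : x ∈ X.normalized p) (hy : y ∈ X.normalized q) :
    X.boundary r r' hr (X.shuffleBracket p q r h x y) =
      X.shuffleBracket p q' r' h₂ x (X.boundary q q' hq y) := by
  rw [X.boundary_eq_face hr (X.shuffleBracket_mem h hx hy), X.boundary_eq_face hq hy]
  subst hp hq hr
  exact X.face_zero_shuffleBracket_zero_left h h₂ x y

theorem boundary_shuffleBracket_zero_right {p q r p' r' : ℕ} (h : p + q = r) (hp : p = p' + 1)
    (hq : q = 0) (hr : r = r' + 1) (h₁ : p' + q = r') {x : X.obj p}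
    {y : X.obj q} (hx : x ∈ X.normalized p) (hy : y ∈ X.normalized q) :
    X.boundary r r' hr (X.shuffleBracket p q r h x y) =
      X.shuffleBracket p' q r' h₁ (X.boundary p p' hp x) y := by
  rw [X.boundary_eq_face hr (X.shuffleBracket_mem h hx hy), X.boundary_eq_face hp hx]
  subst hp hq hr
  exact X.face_zero_shuffleBracket_zero_right h h₁ x y

theorem N_ext {i : ℤ} {x y : X.N.X i} (h : i ≤ 0 → (x.1 : X.obj (-i).toNat) = y.1) : x = y := by
  rcases le_or_gt i 0 with hi | hi
  · exact Subtype.ext (h hi)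
  · have hbot : X.normalizedPart i = ⊥ := if_neg (by omega)
    have h₁ := (Submodule.mem_bot k).mp (hbot ▸ x.2 : (x.1 : X.obj (-i).toNat) ∈ ⊥)
    have h₂ := (Submodule.mem_bot k).mp (hbot ▸ y.2 : (y.1 : X.obj (-i).toNat) ∈ ⊥)
    exact Subtype.ext (h₁.trans h₂.symm)

theorem N_subsingleton {i : ℤ} (hi : 0 < i) : Subsingleton (X.N.X i) :=
  ⟨fun _ _ => X.N_ext fun h => absurd h (by omega)⟩

theorem N_mem {i : ℤ} (hi : i ≤ 0) (x : X.N.X i) :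
    (x.1 : X.obj (-i).toNat) ∈ X.normalized (-i).toNat :=
  (X.mem_normalizedPart hi).mp x.2

theorem N_d_coe {i j : ℤ} (h : i + 1 = j) (hi : i < 0) (x : X.N.X i) :
    ((X.N.d i j h x).1 : X.obj (-j).toNat) =
      X.boundary (-i).toNat (-j).toNat (by omega) x.1 := by
  change ((dite _ _ _ : X.normalizedPart i →ₗ[k] X.normalizedPart j) x).1 = _
  rw [dif_pos hi]
  rfl

theorem N_bracket_coe {i j l : ℤ} (h : i + j = l) (hi : i ≤ 0) (hj : j ≤ 0) (x : X.N.X i)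
    (y : X.N.X j) : ((X.N.bracket i j l h x y).1 : X.obj (-l).toNat) =
      X.shuffleBracket (-i).toNat (-j).toNat (-l).toNat (by omega) x.1 y.1 := by
  change ((dite _ _ _ : X.normalizedPart i →ₗ[k] X.normalizedPart j →ₗ[k]
    X.normalizedPart l) x y).1 = _
  rw [dif_pos ⟨hi, hj⟩]
  rfl

theorem negOnePow_smul_toNat {W : Type*} [AddCommGroup W] (i j : ℤ) (hi : i ≤ 0) (hj : j ≤ 0)
    (x : W) : (i * j).negOnePow • x = (-1 : ℤ) ^ ((-i).toNat * (-j).toNat) • x := by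
  obtain ⟨p, rfl⟩ : ∃ p : ℕ, i = -p := ⟨(-i).toNat, by omega⟩
  obtain ⟨q, rfl⟩ : ∃ q : ℕ, j = -q := ⟨(-j).toNat, by omega⟩
  have : (-(p : ℤ)) * -(q : ℤ) = ((p * q : ℕ) : ℤ) := by push_cast; ring
  rw [this, Units.smul_def, Int.negOnePow_def, zpow_natCast]
  simp

/-- The normalized chains of a simplicial Lie algebra form a dg Lie algebra. -/
theorem N_isDGLie : X.N.IsDGLie where
  d_d i j l hij hjl x := by
    apply X.N_ext
    intro hl
    rw [X.N_d_coe _ (by omega), X.N_d_coe _ (by omega)]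
    exact X.boundary_boundary _ _ (X.N_mem (by omega) x)
  skew i j l h x y := by
    rcases le_or_gt i 0 with hi | hi
    · rcases le_or_gt j 0 with hj | hj
      · apply X.N_ext
        intro hl
        rw [negOnePow_smul_toNat i j hi hj]
        refine (X.N_bracket_coe h hi hj x y).trans ((X.shuffleBracket_skew _ ?_ _ _).trans ?_)
        · omega
        · rw [← X.N_bracket_coe ((add_comm j i).trans h) hj hi y x]
          rfl
      · have := X.N_subsingleton hj
        rw [Subsingleton.elim y 0]; simp
    · have := X.N_subsingleton hi
      rw [Subsingleton.elim x 0]; simp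
  jacobi i j m ij jm im l hij hjm him h₁ h₂ h₃ x y z := by
    rcases le_or_gt i 0 with hi | hi
    · rcases le_or_gt j 0 with hj | hj
      · rcases le_or_gt m 0 with hm | hm
        · apply X.N_ext
          intro hl
          rw [negOnePow_smul_toNat i j hi hj]
          refine (X.N_bracket_coe h₁ hi (by omega) x _).trans ?_
          rw [X.N_bracket_coe hjm hj hm]
          refine (X.shuffleBracket_jacobi (a := (-ij).toNat) (c := (-im).toNat) ?_ _ ?_ _ ?_ ?_
            _ _ _).trans ?_
          · omega
          · omega
          · omega
          · omega
          · rw [← X.N_bracket_coe hij hi hj, ← X.N_bracket_coe him hi hm,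
              ← X.N_bracket_coe h₂ (by omega) hm, ← X.N_bracket_coe h₃ hj (by omega)]
            rfl
        · have := X.N_subsingleton hm
          rw [Subsingleton.elim z 0]; simp
      · have := X.N_subsingleton hj
        rw [Subsingleton.elim y 0]; simp
    · have := X.N_subsingleton hi
      rw [Subsingleton.elim x 0]; simp
  leibniz i j l i' j' l' h hi hj hl h₁ h₂ x y := by
    rcases le_or_gt i 0 with hi0 | hi0
    swap
    · have := X.N_subsingleton hi0
      rw [Subsingleton.elim x 0]; simp
    rcases le_or_gt j 0 with hj0 | hj0
    swap
    · have := X.N_subsingleton hj0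
      rw [Subsingleton.elim y 0]; simp
    apply X.N_ext
    intro hl0
    have hs : ∀ w : X.N.X l', i.negOnePow • w = (-1 : ℤ) ^ (-i).toNat • w := by
      intro w
      have := negOnePow_smul_toNat i (-1) hi0 (by omega) w
      simpa using this
    rw [hs]
    have hx := X.N_mem hi0 x
    have hy := X.N_mem hj0 y
    refine (X.N_d_coe hl (by omega) _).trans ?_
    rw [X.N_bracket_coe h hi0 hj0]
    rcases hi0.lt_or_eq with hi1 | hi1
    · rcases hj0.lt_or_eq with hj1 | hj1
      · refine (X.boundary_shuffleBracket (p' := (-i').toNat) (q' := (-j').toNat) _ ?_ ?_ _ ?_ ?_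
          hx hy).trans ?_
        · omega
        · omega
        · omega
        · omega
        · rw [← X.N_d_coe hi hi1, ← X.N_d_coe hj hj1, ← X.N_bracket_coe h₁ (by omega) hj0,
            ← X.N_bracket_coe h₂ hi0 (by omega)]
          rfl
      · have := X.N_subsingleton (i := j') (by omega)
        rw [Subsingleton.elim (X.N.d j j' hj y) 0, map_zero, smul_zero, add_zero]
        refine (X.boundary_shuffleBracket_zero_right (p' := (-i').toNat) _ ?_ ?_ _ ?_
          hx hy).trans ?_
        · omega
        · omega
        · omega
        · rw [← X.N_d_coe hi hi1, ← X.N_bracket_coe h₁ (by omega) hj0]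
    · have := X.N_subsingleton (i := i') (by omega)
      rw [Subsingleton.elim (X.N.d i i' hi x) 0, map_zero, LinearMap.zero_apply, zero_add]
      refine (X.boundary_shuffleBracket_zero_left (q' := (-j').toNat) _ ?_ ?_ _ ?_
          hx hy).trans ?_
      · omega
      · omega
      · omega
      · have e : (-1 : ℤ) ^ (-i).toNat = 1 := by rw [hi1]; rfl
        rw [e, one_smul, ← X.N_d_coe hj (by omega), ← X.N_bracket_coe h₂ hi0 (by omega)]

theorem Hom.map_boundary {X Y : SimplicialLieAlgebra.{u, w} k} (f : Hom X Y) {n m : ℕ}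
    (h : n = m + 1) (x : X.obj n) :
    f.f m (X.boundary n m h x) = Y.boundary n m h (f.f n x) := by
  subst h
  simp only [boundary, LinearMap.sum_apply, map_sum, LinearMap.smul_apply, map_smul]
  refine Finset.sum_congr rfl fun i _ => congrArg _ ?_
  exact f.naturality _ _

theorem Hom.map_shuffleBracket {X Y : SimplicialLieAlgebra.{u, w} k} (f : Hom X Y) {p q r : ℕ}
    (h : p + q = r) (x : X.obj p) (y : X.obj q) :
    f.f r (X.shuffleBracket p q r h x y) = Y.shuffleBracket p q r h (f.f p x) (f.f q y) := by
  simp only [shuffleBracket, LinearMap.mk₂_apply, map_sum, map_zsmul, LieHom.map_lie,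
    f.naturality]

/-- A morphism of simplicial Lie algebras induces a morphism of dg Lie algebras. -/
theorem Hom.mapN_isHom {X Y : SimplicialLieAlgebra.{u, w} k} (f : Hom X Y) :
    DGLieData.IsHom X.N Y.N f.mapN where
  map_d i j h x := by
    apply Y.N_ext
    intro hj
    refine Eq.trans (congrArg (f.f _) (X.N_d_coe h (by omega) x)) ?_
    rw [f.map_boundary, Y.N_d_coe h (by omega)]
    rfl
  map_bracket i j l h x y := by
    rcases le_or_gt i 0 with hi | hi
    · rcases le_or_gt j 0 with hj | hj
      · apply Y.N_ext
        intro hl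
        refine Eq.trans (congrArg (f.f _) (X.N_bracket_coe h hi hj x y)) ?_
        rw [f.map_shuffleBracket, Y.N_bracket_coe h hi hj]
        rfl
      · have := X.N_subsingleton hj
        rw [Subsingleton.elim y 0]; simp
    · have := X.N_subsingleton hi
      rw [Subsingleton.elim x 0]; simp

end SimplicialLieAlgebra

namespace Forms

variable {k : Type u} [Field k] {n m l : ℕ}

/-! ### The cone contraction onto the vertex `0` -/

/-- The barycentric coordinates of the vertex `0`. -/
def vertexCoord (k : Type u) [Field k] {n : ℕ} (i : Fin (n + 1)) : k := if i = 0 then 1 else 0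

theorem sum_vertexCoord : ∑ i : Fin (n + 1), vertexCoord k i = 1 := by
  simp [vertexCoord]

theorem sum_filter_vertexCoord {φ : Fin (m + 1) →o Fin (n + 1)} (hφ : φ 0 = 0)
    (i : Fin (n + 1)) : ∑ j with φ j = i, vertexCoord k j = vertexCoord k i := by
  simp [vertexCoord, Finset.sum_ite_eq', hφ, eq_comm]

/-- Contraction with the Euler vector field `∑ (t_i - e_i) ∂/∂t_i` centred at the vertex `0`. -/
def euler (k : Type u) [Field k] (n : ℕ) : Forms k n →ₗ[k] Forms k n :=
  antider 0 (fun i => t k i - algebraMap k _ (vertexCoord k i)) (by simp) (by simp)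
    (fun i j => by rw [sub_mul, mul_sub, t_mul_t, Algebra.commutes])
    (fun i j => by rw [sub_mul, mul_sub, t_mul_dt, Algebra.commutes]) (by simp)
    (by rw [Finset.sum_sub_distrib, sum_t, ← map_sum, sum_vertexCoord, map_one, sub_self])

@[simp] theorem euler_t (i : Fin (n + 1)) : euler k n (t k i) = 0 := by simp [euler]

@[simp] theorem euler_dt (i : Fin (n + 1)) :
    euler k n (dt k i) = t k i - algebraMap k _ (vertexCoord k i) := by simp [euler]

theorem euler_mul (x y : Forms k n) :
    euler k n (x * y) = euler k n x * y + parity k n x * euler k n y := antider_mul ..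

@[simp] theorem euler_algebraMap (c : k) : euler k n (algebraMap k _ c) = 0 := by
  have h := euler_mul (1 : Forms k n) 1
  simp only [mul_one, one_mul, map_one] at h
  rw [Algebra.algebraMap_eq_smul_one, map_smul, left_eq_add.mp h, smul_zero]

theorem parity_euler (x : Forms k n) : parity k n (euler k n x) = -euler k n (parity k n x) := by
  induction x using Forms.induction with
  | hc c => simp
  | ht i => simp
  | hd i => simp
  | hadd x y hx hy => simp [hx, hy]; abel
  | hmul x y hx hy => simp [euler_mul, hx, hy]; abel

theorem op_euler {φ : Fin (m + 1) →o Fin (n + 1)} (hφ : φ 0 = 0) (x : Forms k n) :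
    op φ (euler k n x) = euler k m (op φ x) := by
  induction x using Forms.induction with
  | hc c => simp
  | ht i => simp
  | hd i =>
    rw [euler_dt, op_dt, map_sum, map_sub, op_t, AlgHom.commutes, ← sum_filter_vertexCoord hφ,
      map_sum, ← Finset.sum_sub_distrib]
    exact Finset.sum_congr rfl fun j _ => (euler_dt j).symm
  | hadd x y hx hy => simp [hx, hy]
  | hmul x y hx hy => simp [euler_mul, hx, hy, op_parity]

theorem commute_monomial {A : Type*} [Semiring A] {x y : A} (h : x * y = y * x) (p q : ℕ) :
    Commute (Polynomial.monomial p x) (Polynomial.monomial q y) := by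
  rw [Commute, SemiconjBy, Polynomial.monomial_mul_monomial, Polynomial.monomial_mul_monomial, h,
    add_comm]

/-- The dilation `t_i ↦ e_i + s (t_i - e_i)`, `dt_i ↦ s dt_i`, where `s` is the polynomial
variable. Its coefficient at `s ^ w` is the part of weight `w` of a form. -/
noncomputable def dilate (k : Type u) [Field k] (n : ℕ) :
    Forms k n →ₐ[k] Polynomial (Forms k n) :=
  lift (fun i => Polynomial.monomial 0 (algebraMap k _ (vertexCoord k i)) +
      Polynomial.monomial 1 (t k i - algebraMap k _ (vertexCoord k i)))
    (fun i => Polynomial.monomial 1 (dt k i))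
    (fun i j => by
      have h : Commute (t k i - algebraMap k _ (vertexCoord k i))
          (t k j - algebraMap k _ (vertexCoord k j)) :=
        ((show Commute (t k i) (t k j) from t_mul_t i j).sub_right
          (Algebra.commute_algebraMap_right _ _)).sub_left (Algebra.commute_algebraMap_left _ _)
      exact Commute.add_left
        (Commute.add_right (commute_monomial (Algebra.commutes _ _) _ _)
          (commute_monomial (Algebra.commutes _ _) _ _))
        (Commute.add_right (commute_monomial (Algebra.commutes _ _).symm _ _)
          (commute_monomial h _ _)))
    (fun i j => by
      have h : Commute (t k i - algebraMap k _ (vertexCoord k i)) (dt k j) :=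
        (show Commute (t k i) (dt k j) from t_mul_dt i j).sub_left
          (Algebra.commute_algebraMap_left _ _)
      exact Commute.add_left (commute_monomial (Algebra.commutes _ _) _ _)
        (commute_monomial h _ _))
    (fun i j => by
      rw [Polynomial.monomial_mul_monomial, Polynomial.monomial_mul_monomial, dt_mul_dt i j,
        map_neg])
    (by
      rw [Finset.sum_add_distrib, ← map_sum, ← map_sum, ← map_sum, Finset.sum_sub_distrib, sum_t,
        ← map_sum, sum_vertexCoord, map_one, sub_self, map_zero, add_zero]
      rfl)
    (by rw [← map_sum, sum_dt, map_zero])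

@[simp] theorem dilate_t (i : Fin (n + 1)) : dilate k n (t k i) =
    Polynomial.monomial 0 (algebraMap k _ (vertexCoord k i)) +
      Polynomial.monomial 1 (t k i - algebraMap k _ (vertexCoord k i)) := by
  unfold dilate; exact lift_t i

@[simp] theorem dilate_dt (i : Fin (n + 1)) :
    dilate k n (dt k i) = Polynomial.monomial 1 (dt k i) := by
  unfold dilate; exact lift_dt i

theorem dilate_algebraMap (c : k) :
    dilate k n (algebraMap k _ c) = Polynomial.monomial 0 (algebraMap k _ c) := by
  rw [AlgHom.commutes]; rfl

/-- The part of weight `w` of a form. -/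
noncomputable def weightPart (k : Type u) [Field k] (n w : ℕ) : Forms k n →ₗ[k] Forms k n :=
  (Polynomial.lcoeff (Forms k n) w).restrictScalars k ∘ₗ (dilate k n).toLinearMap

theorem weightPart_apply (w : ℕ) (x : Forms k n) :
    weightPart k n w x = (dilate k n x).coeff w := rfl

theorem weightPart_mul (w : ℕ) (x y : Forms k n) : weightPart k n w (x * y) =
    ∑ a ∈ Finset.HasAntidiagonal.antidiagonal w, weightPart k n a.1 x * weightPart k n a.2 y := by
  simp only [weightPart_apply, map_mul, Polynomial.coeff_mul]

theorem weightPart_algebraMap (w : ℕ) (c : k) :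
    weightPart k n w (algebraMap k _ c) = if 0 = w then algebraMap k _ c else 0 := by
  rw [weightPart_apply, dilate_algebraMap, Polynomial.coeff_monomial]

theorem weightPart_t (w : ℕ) (i : Fin (n + 1)) : weightPart k n w (t k i) =
    (if 0 = w then algebraMap k _ (vertexCoord k i) else 0) +
      if 1 = w then t k i - algebraMap k _ (vertexCoord k i) else 0 := by
  rw [weightPart_apply, dilate_t, Polynomial.coeff_add, Polynomial.coeff_monomial,
    Polynomial.coeff_monomial]

theorem weightPart_dt (w : ℕ) (i : Fin (n + 1)) : weightPart k n w (dt k i) =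
    if 1 = w then dt k i else 0 := by
  rw [weightPart_apply, dilate_dt, Polynomial.coeff_monomial]

theorem weightPart_parity (w : ℕ) (x : Forms k n) :
    weightPart k n w (parity k n x) = parity k n (weightPart k n w x) := by
  induction x using Forms.induction generalizing w with
  | hc c => simp only [AlgHom.commutes, weightPart_algebraMap]; split_ifs <;> simp
  | ht i => simp only [parity_t, weightPart_t]; split_ifs <;> simp
  | hd i => simp only [parity_dt, map_neg, weightPart_dt]; split_ifs <;> simp
  | hadd x y hx hy => simp [hx, hy]
  | hmul x y hx hy => simp [weightPart_mul, hx, hy]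

theorem weightPart_d (w : ℕ) (x : Forms k n) :
    weightPart k n w (d k n x) = d k n (weightPart k n w x) := by
  induction x using Forms.induction generalizing w with
  | hc c => simp only [d_algebraMap, weightPart_algebraMap]; split_ifs <;> simp
  | ht i => simp only [d_t, weightPart_t, weightPart_dt]; split_ifs <;> simp
  | hd i => simp only [d_dt, weightPart_dt]; split_ifs <;> simp
  | hadd x y hx hy => simp [hx, hy]
  | hmul x y hx hy =>
    simp [weightPart_mul, hx, hy, d_mul', weightPart_parity, Finset.sum_add_distrib]

theorem weightPart_op {φ : Fin (m + 1) →o Fin (n + 1)} (hφ : φ 0 = 0) (w : ℕ) (x : Forms k n) :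
    weightPart k m w (op φ x) = op φ (weightPart k n w x) := by
  induction x using Forms.induction generalizing w with
  | hc c => simp only [AlgHom.commutes, weightPart_algebraMap]; split_ifs <;> simp
  | ht i =>
    simp only [op_t, map_sum, weightPart_t, map_add, apply_ite (op φ), AlgHom.commutes, map_sub,
      map_zero, Finset.sum_add_distrib]
    congr 1
    · split_ifs
      · rw [← map_sum, sum_filter_vertexCoord hφ]
      · simp
    · split_ifs
      · rw [Finset.sum_sub_distrib, ← map_sum, sum_filter_vertexCoord hφ]
      · simp
  | hd i =>
    simp only [op_dt, map_sum, weightPart_dt, apply_ite (op φ), map_zero]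
    split_ifs <;> simp
  | hadd x y hx hy => simp [hx, hy]
  | hmul x y hx hy => simp [weightPart_mul, hx, hy]

/-- Cartan's formula: the Lie derivative along the Euler vector field is the weight. -/
theorem d_euler_weightPart (w : ℕ) (x : Forms k n) :
    d k n (euler k n (weightPart k n w x)) + euler k n (d k n (weightPart k n w x)) =
      (w : k) • weightPart k n w x := by
  have leib : ∀ a b : Forms k n, d k n (euler k n (a * b)) + euler k n (d k n (a * b)) =
      (d k n (euler k n a) + euler k n (d k n a)) * b +
        a * (d k n (euler k n b) + euler k n (d k n b)) := by
    intro a b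
    simp only [euler_mul, d_mul', map_add, parity_d, parity_euler, parity_parity]
    noncomm_ring
  induction x using Forms.induction generalizing w with
  | hc c =>
    rw [weightPart_algebraMap]
    split_ifs with h
    · subst h; simp
    · simp
  | ht i =>
    rw [weightPart_t]
    rcases w with _ | _ | w
    · simp
    · simp
    · simp
  | hd i =>
    rw [weightPart_dt]
    split_ifs with h
    · subst h; simp
    · simp
  | hadd x y hx hy =>
    simp only [map_add, smul_add, ← hx, ← hy]
    abel
  | hmul x y hx hy =>
    rw [weightPart_mul, map_sum, map_sum, map_sum, map_sum, Finset.smul_sum,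
      ← Finset.sum_add_distrib]
    refine Finset.sum_congr rfl fun a ha => ?_
    rw [leib, hx, hy, smul_mul_assoc, mul_smul_comm, ← add_smul, ← Nat.cast_add,
      Finset.HasAntidiagonal.mem_antidiagonal.mp ha]

/-- The cone contraction: contraction with the Euler vector field, divided by the weight. (The
part of weight zero is dropped, since `0⁻¹ = 0`.) -/
noncomputable def cone (k : Type u) [Field k] (n : ℕ) : Forms k n →ₗ[k] Forms k n :=
  Polynomial.lsum (fun w => (w : k)⁻¹ • euler k n) ∘ₗ (dilate k n).toLinearMap

theorem cone_eq_sum {N : ℕ} {x : Forms k n} (h : (dilate k n x).natDegree < N) :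
    cone k n x = ∑ w ∈ Finset.range N, (w : k)⁻¹ • euler k n (weightPart k n w x) :=
  Polynomial.sum_over_range' _ (by simp) _ h

theorem sum_weightPart {N : ℕ} {x : Forms k n} (h : (dilate k n x).natDegree < N) :
    ∑ w ∈ Finset.range N, weightPart k n w x = x := by
  have key : (dilate k n x).eval 1 = x := by
    clear h
    induction x using Forms.induction with
    | hc c => simp
    | ht i => simp
    | hd i => simp
    | hadd x y hx hy => simp [hx, hy]
    | hmul x y hx hy =>
      rw [map_mul, Polynomial.eval, Polynomial.eval₂_mul_noncomm _ _ fun _ => Commute.one_right _]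
      exact congrArg₂ _ hx hy
  rw [Polynomial.eval_eq_sum_range' h] at key
  simpa [weightPart_apply] using key

/-- The cone contraction is a homotopy between the identity and the evaluation at the vertex. -/
theorem d_cone_add_cone_d [CharZero k] (x : Forms k n) :
    d k n (cone k n x) + cone k n (d k n x) = x - weightPart k n 0 x := by
  obtain ⟨N, h₁, h₂⟩ : ∃ N, (dilate k n x).natDegree < N + 1 ∧
      (dilate k n (d k n x)).natDegree < N + 1 :=
    ⟨max (dilate k n x).natDegree (dilate k n (d k n x)).natDegree, by omega, by omega⟩
  have hs := sum_weightPart h₁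
  rw [Finset.sum_range_succ'] at hs
  rw [cone_eq_sum h₁, cone_eq_sum h₂, map_sum,
    ← Finset.sum_add_distrib]
  have e : ∀ w : ℕ, d k n ((w : k)⁻¹ • euler k n (weightPart k n w x)) +
      (w : k)⁻¹ • euler k n (weightPart k n w (d k n x)) =
        if w = 0 then 0 else weightPart k n w x := by
    intro w
    rw [map_smul, weightPart_d, ← smul_add, d_euler_weightPart, smul_smul]
    split_ifs with h
    · simp [h]
    · rw [inv_mul_cancel₀ (by exact_mod_cast h), one_smul]
  simp only [e]
  rw [Finset.sum_range_succ', eq_sub_iff_add_eq]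
  simpa using hs

theorem op_cone {φ : Fin (m + 1) →o Fin (n + 1)} (hφ : φ 0 = 0) (x : Forms k n) :
    op φ (cone k n x) = cone k m (op φ x) := by
  obtain ⟨N, h₁, h₂⟩ : ∃ N, (dilate k n x).natDegree < N ∧ (dilate k m (op φ x)).natDegree < N :=
    ⟨max (dilate k n x).natDegree (dilate k m (op φ x)).natDegree + 1, by omega, by omega⟩
  rw [cone_eq_sum h₁, cone_eq_sum h₂, map_sum]
  refine Finset.sum_congr rfl fun w _ => ?_
  rw [map_smul, op_euler hφ, weightPart_op hφ]

/-! ### Degrees -/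

theorem one_mem_polys : (1 : Forms k n) ∈ polys k n := one_mem (Algebra.adjoin k (Set.range (t k)))

theorem algebraMap_mem_polys (c : k) : algebraMap k (Forms k n) c ∈ polys k n :=
  algebraMap_mem (Algebra.adjoin k (Set.range (t k))) c

theorem t_mem_polys (i : Fin (n + 1)) : t k i ∈ polys k n := Algebra.subset_adjoin ⟨i, rfl⟩

theorem dt_mem_dts (i : Fin (n + 1)) : dt k i ∈ dts k n := Submodule.subset_span ⟨i, rfl⟩

theorem gr_zero : gr k n 0 = polys k n := by rw [gr, pow_zero, mul_one]

theorem weightPart_mem_gr {p : ℕ} {x : Forms k n} (hx : x ∈ gr k n p) (w : ℕ) :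
    weightPart k n w x ∈ gr k n p := by
  have h₁ : ∀ {f : Forms k n}, f ∈ polys k n → ∀ w, weightPart k n w f ∈ polys k n := by
    intro f hf w
    induction hf using Algebra.adjoin_induction generalizing w with
    | mem y hy =>
      obtain ⟨i, rfl⟩ := hy
      rw [weightPart_t]
      refine add_mem ?_ ?_ <;> split_ifs
      · exact algebraMap_mem_polys _
      · exact zero_mem _
      · exact sub_mem (t_mem_polys i) (algebraMap_mem_polys _)
      · exact zero_mem _
    | algebraMap c =>
      rw [weightPart_algebraMap]
      split_ifs
      · exact algebraMap_mem_polys c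
      · exact zero_mem _
    | add x y _ _ hx hy => rw [map_add]; exact add_mem (hx w) (hy w)
    | mul x y _ _ hx hy =>
      rw [weightPart_mul]
      exact sum_mem fun a _ => polys_mul (hx _) (hy _)
  have h₂ : ∀ {f : Forms k n}, f ∈ dts k n → ∀ w, weightPart k n w f ∈ dts k n := by
    intro f hf w
    induction hf using Submodule.span_induction with
    | mem y hy =>
      obtain ⟨j, rfl⟩ := hy
      rw [weightPart_dt]
      split_ifs
      · exact dt_mem_dts j
      · exact zero_mem _
    | zero => rw [map_zero]; exact zero_mem _
    | add a b _ _ ha hb => rw [map_add]; exact add_mem ha hb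
    | smul c a _ ha => rw [map_smul]; exact Submodule.smul_mem _ c ha
  have h₃ : ∀ (p : ℕ) {f : Forms k n}, f ∈ dts k n ^ p →
      ∀ w, weightPart k n w f ∈ dts k n ^ p := by
    intro p
    induction p with
    | zero =>
      intro f hf w
      rw [pow_zero] at hf ⊢
      obtain ⟨c, rfl⟩ := Submodule.mem_one.mp hf
      rw [weightPart_algebraMap]
      split_ifs
      · exact Submodule.mem_one.mpr ⟨c, rfl⟩
      · exact zero_mem _
    | succ p ih =>
      intro f hf w
      rw [pow_succ] at hf ⊢
      induction hf using Submodule.mul_induction_on' with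
      | mem_mul_mem a ha b hb =>
        rw [weightPart_mul]
        exact sum_mem fun c _ => Submodule.mul_mem_mul (ih ha _) (h₂ hb _)
      | add a _ b _ ha hb => rw [map_add]; exact add_mem ha hb
  induction hx using gr_induction with
  | hadd a _ b _ ha hb => rw [map_add]; exact add_mem ha hb
  | hmul f hf w' hw =>
    rw [weightPart_mul]
    exact sum_mem fun c _ => Submodule.mul_mem_mul (h₁ hf _) (h₃ p hw _)

/-- A contraction by a vector field kills the forms of degree zero. -/
theorem euler_polys {f : Forms k n} (hf : f ∈ polys k n) : euler k n f = 0 := by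
  induction hf using Algebra.adjoin_induction with
  | mem y hy => obtain ⟨i, rfl⟩ := hy; simp
  | algebraMap c => simp
  | add x y _ _ hx hy => rw [map_add, hx, hy, add_zero]
  | mul x y _ _ hx hy => rw [euler_mul, hx, hy, zero_mul, mul_zero, add_zero]

theorem dts_pow_le_gr {p : ℕ} : dts k n ^ p ≤ gr k n p := fun x hx => by
  rw [← one_mul x]; exact Submodule.mul_mem_mul one_mem_polys hx

theorem polys_le_gr_zero : polys k n ≤ gr k n 0 := gr_zero.ge

theorem euler_mem_gr {p : ℕ} {x : Forms k n} (hx : x ∈ gr k n (p + 1)) :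
    euler k n x ∈ gr k n p := by
  have h₁ : ∀ {f : Forms k n}, f ∈ dts k n → euler k n f ∈ polys k n := by
    intro f hf
    induction hf using Submodule.span_induction with
    | mem y hy =>
      obtain ⟨j, rfl⟩ := hy
      rw [euler_dt]
      exact sub_mem (t_mem_polys j) (algebraMap_mem_polys _)
    | zero => rw [map_zero]; exact zero_mem _
    | add a b _ _ ha hb => rw [map_add]; exact add_mem ha hb
    | smul c a _ ha => rw [map_smul]; exact Submodule.smul_mem _ c ha
  have h₂ : ∀ (p : ℕ) {f : Forms k n}, f ∈ dts k n ^ (p + 1) → euler k n f ∈ gr k n p := by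
    intro p
    induction p with
    | zero =>
      intro f hf
      rw [zero_add, pow_one] at hf
      exact polys_le_gr_zero (h₁ hf)
    | succ p ih =>
      intro f hf
      rw [pow_succ] at hf
      induction hf using Submodule.mul_induction_on' with
      | mem_mul_mem a ha b hb =>
        rw [euler_mul, parity_dts_pow ha]
        refine add_mem (mul_mem_gr rfl (ih ha) (dts_pow_le_gr (by rwa [pow_one]))) ?_
        exact mul_mem_gr (add_zero _) (Submodule.smul_mem _ _ (dts_pow_le_gr ha))
          (polys_le_gr_zero (h₁ hb))
      | add a _ b _ ha hb => rw [map_add]; exact add_mem ha hb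
  induction hx using gr_induction with
  | hadd a _ b _ ha hb => rw [map_add]; exact add_mem ha hb
  | hmul f hf w' hw =>
    rw [euler_mul, euler_polys hf, zero_mul, zero_add, parity_polys hf]
    exact mul_mem_gr (zero_add _) (polys_le_gr_zero hf) (h₂ p hw)

theorem cone_mem_gr {p : ℕ} {x : Forms k n} (hx : x ∈ gr k n (p + 1)) :
    cone k n x ∈ gr k n p := by
  rw [cone_eq_sum (Nat.lt_succ_self _)]
  exact sum_mem fun w _ => Submodule.smul_mem _ _ (euler_mem_gr (weightPart_mem_gr hx w))

theorem cone_gr_zero {x : Forms k n} (hx : x ∈ gr k n 0) : cone k n x = 0 := by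
  rw [cone_eq_sum (Nat.lt_succ_self _)]
  refine Finset.sum_eq_zero fun w _ => ?_
  rw [euler_polys (gr_zero (k := k) ▸ weightPart_mem_gr hx w), smul_zero]

/-- The part of weight zero is the value at the vertex. -/
theorem weightPart_zero (x : Forms k n) : ∃ c : k, weightPart k n 0 x = algebraMap k _ c := by
  induction x using Forms.induction with
  | hc c => exact ⟨c, by simp [weightPart_algebraMap]⟩
  | ht i => exact ⟨vertexCoord k i, by simp [weightPart_t]⟩
  | hd i => exact ⟨0, by simp [weightPart_dt]⟩
  | hadd x y hx hy =>
    obtain ⟨a, ha⟩ := hx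
    obtain ⟨b, hb⟩ := hy
    exact ⟨a + b, by rw [map_add, ha, hb, map_add]⟩
  | hmul x y hx hy =>
    obtain ⟨a, ha⟩ := hx
    obtain ⟨b, hb⟩ := hy
    exact ⟨a * b, by simp [weightPart_mul, ha, hb]⟩

theorem weightPart_zero_of_mem {p : ℕ} {x : Forms k n} (hx : x ∈ gr k n (p + 1)) :
    weightPart k n 0 x = 0 := by
  have h₁ : ∀ {f : Forms k n}, f ∈ dts k n → weightPart k n 0 f = 0 := by
    intro f hf
    induction hf using Submodule.span_induction with
    | mem y hy => obtain ⟨j, rfl⟩ := hy; simp [weightPart_dt]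
    | zero => rw [map_zero]
    | add a b _ _ ha hb => rw [map_add, ha, hb, add_zero]
    | smul c a _ ha => rw [map_smul, ha, smul_zero]
  induction hx using gr_induction with
  | hadd a _ b _ ha hb => rw [map_add, ha, hb, add_zero]
  | hmul f hf w' hw =>
    rw [weightPart_mul]
    rw [pow_succ] at hw
    have : weightPart k n 0 w' = 0 := by
      induction hw using Submodule.mul_induction_on' with
      | mem_mul_mem a ha b hb => simp [weightPart_mul, h₁ hb]
      | add a _ b _ ha hb => rw [map_add, ha, hb, add_zero]
    simp [this]

theorem d_cone_of_mem [CharZero k] {p : ℕ} {x : Forms k n} (hx : x ∈ gr k n (p + 1)) :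
    d k n (cone k n x) = x - cone k n (d k n x) := by
  rw [eq_sub_iff_add_eq, d_cone_add_cone_d, weightPart_zero_of_mem hx, sub_zero]

end Forms

namespace Forms

variable {k : Type u} [Field k] {n m l : ℕ}

/-! ### Forms of top degree -/

open scoped IsMulCommutative in
/-- The inclusion `k[t_1, …, t_n] → Ω_n`. -/
noncomputable def ofPoly (k : Type u) [Field k] (n : ℕ) :
    MvPolynomial (Fin n) k →ₐ[k] Forms k n :=
  haveI := Algebra.isMulCommutative_adjoin k (s := Set.range (t k (n := n)))
    (by rintro _ ⟨i, rfl⟩ _ ⟨j, rfl⟩; exact t_mul_t i j)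
  (Algebra.adjoin k (Set.range (t k (n := n)))).val.comp
    (MvPolynomial.aeval fun i => ⟨t k i.succ, t_mem_polys i.succ⟩)

theorem ofPoly_X (i : Fin n) : ofPoly k n (MvPolynomial.X i) = t k i.succ := by
  simp [ofPoly]

theorem polys_le_range_ofPoly {f : Forms k n} (hf : f ∈ polys k n) : ∃ P, ofPoly k n P = f := by
  have : Algebra.adjoin k (Set.range (t k)) ≤ (ofPoly k n).range := by
    rw [Algebra.adjoin_le_iff]
    rintro _ ⟨i, rfl⟩
    have hs : ∀ i : Fin n, t k i.succ ∈ (ofPoly k n).range := fun i => ⟨_, ofPoly_X i⟩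
    refine Fin.cases ?_ hs i
    have h0 : t k (0 : Fin (n + 1)) = 1 - ∑ i : Fin n, t k i.succ := by
      rw [← sum_t (k := k) (n := n), Fin.sum_univ_succ, add_sub_cancel_right]
    rw [h0]
    exact sub_mem (one_mem _) (sum_mem fun i _ => hs i)
  exact this hf

theorem ofPoly_mem_polys (P : MvPolynomial (Fin n) k) : ofPoly k n P ∈ polys k n := by
  unfold ofPoly; exact Subtype.prop _

@[simp] theorem toPoly_t (i : Fin (n + 1)) : toPoly k n (t k i) =
    (Fin.cons (1 - ∑ i, MvPolynomial.X i) MvPolynomial.X : Fin (n + 1) → MvPolynomial (Fin n) k) i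
    := by
  unfold toPoly; exact lift_t i

theorem toPoly_ofPoly (P : MvPolynomial (Fin n) k) : toPoly k n (ofPoly k n P) = P := by
  have : (toPoly k n).comp (ofPoly k n) = AlgHom.id k _ := by
    apply MvPolynomial.algHom_ext
    intro i
    simp [ofPoly_X]
  exact DFunLike.congr_fun this P

/-- The volume form `dt_1 ⋯ dt_n`. -/
def vol (k : Type u) [Field k] (n : ℕ) : Forms k n := (List.ofFn fun i : Fin n => dt k i.succ).prod

theorem dts_mul_self [CharZero k] {v : Forms k n} (hv : v ∈ dts k n) : v * v = 0 := by
  have h := dts_anticomm hv hv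
  have h₂ : (2 : k) • (v * v) = 0 := by
    rw [two_smul]; nth_rewrite 1 [h]; exact neg_add_cancel _
  exact (smul_eq_zero.mp h₂).resolve_left two_ne_zero

theorem dts_mul_list_prod [CharZero k] {v : Forms k n} {l : List (Forms k n)} (hv : v ∈ l)
    (hl : ∀ x ∈ l, x ∈ dts k n) : v * l.prod = 0 := by
  induction l with
  | nil => simp at hv
  | cons a l ih =>
    rw [List.prod_cons, ← mul_assoc]
    rcases List.mem_cons.mp hv with rfl | h
    · rw [dts_mul_self (hl v List.mem_cons_self), zero_mul]
    · rw [dts_anticomm (hl v hv) (hl a List.mem_cons_self), neg_mul, mul_assoc,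
        ih h fun x hx => hl x (List.mem_cons_of_mem _ hx), mul_zero, neg_zero]

/-- Since `v` anticommutes with `W` and `v ^ 2 = 0`, at most one factor `v` survives in a product. -/
theorem span_sup_pow_le [CharZero k] {v : Forms k n} (hv : v ∈ dts k n)
    {W : Submodule k (Forms k n)} (hW : W ≤ dts k n) (p : ℕ) :
    (k ∙ v ⊔ W) ^ (p + 1) ≤ W ^ (p + 1) ⊔ (k ∙ v) * W ^ p := by
  have comm : ∀ p, W ^ p * (k ∙ v) ≤ (k ∙ v) * W ^ p := by
    intro p
    rw [Submodule.mul_le]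
    intro a ha b hb
    obtain ⟨c, rfl⟩ := Submodule.mem_span_singleton.mp hb
    have hc : c • v ∈ dts k n ^ 1 := by rw [pow_one]; exact Submodule.smul_mem _ c hv
    rw [dts_pow_comm (pow_le_pow_left' hW p ha) hc]
    exact Submodule.smul_mem _ _ (Submodule.mul_mem_mul hb ha)
  have sq : (k ∙ v) * (k ∙ v) = ⊥ := by
    rw [Submodule.span_mul_span, Set.singleton_mul_singleton, dts_mul_self hv,
      Submodule.span_singleton_eq_bot]
  induction p with
  | zero => simp [sup_comm]
  | succ p ih =>
    rw [pow_succ]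
    refine (mul_le_mul' ih le_rfl).trans ?_
    rw [Submodule.sup_mul, Submodule.mul_sup, Submodule.mul_sup, ← pow_succ, mul_assoc,
      mul_assoc, ← pow_succ]
    refine sup_le (sup_le ((comm _).trans le_sup_right) le_sup_left) (sup_le ?_ le_sup_right)
    refine (mul_le_mul' le_rfl (comm p)).trans ?_
    rw [← mul_assoc, sq, Submodule.bot_mul]
    exact bot_le

/-- The products of one-forms from a list of length `m` span a line in degree `m`, and vanish in
higher degrees. -/
theorem span_list_pow [CharZero k] (l : List (Forms k n)) (hl : ∀ x ∈ l, x ∈ dts k n) :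
    Submodule.span k {x | x ∈ l} ^ l.length ≤ k ∙ l.prod ∧
      ∀ p, l.length < p → Submodule.span k {x | x ∈ l} ^ p = ⊥ := by
  induction l with
  | nil =>
    constructor
    · simp [Submodule.one_eq_span]
    · intro p hp
      obtain ⟨p, rfl⟩ := Nat.exists_eq_succ_of_ne_zero hp.ne'
      simp [pow_succ]
  | cons v l ih =>
    obtain ⟨ih₁, ih₂⟩ := ih fun x hx => hl x (List.mem_cons_of_mem _ hx)
    have hW : Submodule.span k {x | x ∈ l} ≤ dts k n := by
      rw [Submodule.span_le]
      exact fun x hx => hl x (List.mem_cons_of_mem _ hx)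
    have e : Submodule.span k {x | x ∈ v :: l} = (k ∙ v) ⊔ Submodule.span k {x | x ∈ l} := by
      rw [← Submodule.span_union]
      congr 1
      ext x
      simp
    have h := span_sup_pow_le (hl v List.mem_cons_self) hW
    rw [e, List.length_cons]
    constructor
    · refine (h _).trans ?_
      rw [ih₂ _ (Nat.lt_succ_self _), bot_sup_eq, List.prod_cons]
      refine (mul_le_mul' le_rfl ih₁).trans ?_
      rw [Submodule.span_mul_span, Set.singleton_mul_singleton]
    · intro p hp
      obtain ⟨p, rfl⟩ := Nat.exists_eq_succ_of_ne_zero (Nat.ne_zero_of_lt hp)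
      rw [eq_bot_iff]
      refine (h _).trans ?_
      rw [ih₂ _ (by omega), ih₂ _ (by omega), Submodule.mul_bot, sup_bot_eq]

theorem dts_eq_span : dts k n =
    Submodule.span k {x | x ∈ List.ofFn fun i : Fin n => dt k i.succ} := by
  apply le_antisymm
  · rw [dts, Submodule.span_le]
    rintro _ ⟨i, rfl⟩
    have hs : ∀ i : Fin n, dt k i.succ ∈
        Submodule.span k {x | x ∈ List.ofFn fun i : Fin n => dt k i.succ} := fun i =>
      Submodule.subset_span (by simp)
    refine Fin.cases ?_ hs i
    have h0 : dt k (0 : Fin (n + 1)) = - ∑ i : Fin n, dt k i.succ := by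
      rw [eq_neg_iff_add_eq_zero, ← Fin.sum_univ_succ, sum_dt]
    rw [h0]
    exact neg_mem (sum_mem fun i _ => hs i)
  · rw [Submodule.span_le]
    intro x hx
    obtain ⟨i, rfl⟩ := (List.mem_ofFn' _ _).mp hx
    exact dt_mem_dts _

theorem ofFn_dt_mem (x : Forms k n) (hx : x ∈ List.ofFn fun i : Fin n => dt k i.succ) :
    x ∈ dts k n := by
  obtain ⟨i, rfl⟩ := (List.mem_ofFn' _ _).mp hx
  exact dt_mem_dts _

/-- There are no forms of degree greater than the dimension. -/
theorem gr_eq_bot [CharZero k] {p : ℕ} (h : n < p) : gr k n p = ⊥ := by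
  rw [gr, dts_eq_span, (span_list_pow _ ofFn_dt_mem).2 p (by simpa), Submodule.mul_bot]

theorem eq_zero_of_mem_gr [CharZero k] {p : ℕ} (h : n < p) {x : Forms k n}
    (hx : x ∈ gr k n p) : x = 0 := by
  rwa [gr_eq_bot h, Submodule.mem_bot] at hx

/-- A form of top degree is a multiple of the volume form. -/
theorem exists_eq_ofPoly_mul_vol [CharZero k] {x : Forms k n} (hx : x ∈ gr k n n) :
    ∃ P, x = ofPoly k n P * vol k n := by
  induction hx using gr_induction with
  | hadd a _ b _ ha hb =>
    obtain ⟨P, rfl⟩ := ha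
    obtain ⟨Q, rfl⟩ := hb
    exact ⟨P + Q, by rw [map_add, add_mul]⟩
  | hmul f hf w hw =>
    obtain ⟨P, rfl⟩ := polys_le_range_ofPoly hf
    have h := (span_list_pow (List.ofFn fun i : Fin n => dt k i.succ) ofFn_dt_mem).1
    rw [List.length_ofFn, ← dts_eq_span] at h
    obtain ⟨c, rfl⟩ := Submodule.mem_span_singleton.mp (h hw)
    exact ⟨c • P, by rw [map_smul, smul_mul_assoc, mul_smul_comm]; rfl⟩

theorem list_prod_mem_dts_pow (L : List (Forms k n)) (hL : ∀ x ∈ L, x ∈ dts k n) :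
    L.prod ∈ dts k n ^ L.length := by
  induction L with
  | nil => exact Submodule.mem_one.mpr ⟨1, map_one _⟩
  | cons a L ih =>
    rw [List.prod_cons, List.length_cons, pow_succ']
    exact Submodule.mul_mem_mul (hL a List.mem_cons_self)
      (ih fun x hx => hL x (List.mem_cons_of_mem _ hx))

theorem vol_mem_dts_pow : vol k n ∈ dts k n ^ n := by
  have := list_prod_mem_dts_pow (List.ofFn fun i : Fin n => dt k i.succ) ofFn_dt_mem
  rwa [List.length_ofFn] at this

theorem vol_mem_gr : vol k n ∈ gr k n n := dts_pow_le_gr vol_mem_dts_pow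

/-! ### Integration -/

theorem contractCoord_mul (i : Fin n) (x y : Forms k n) : contractCoord k n i (x * y) =
    contractCoord k n i x * y + parity k n x * contractCoord k n i y := antider_mul ..

theorem contractCoord_t (i : Fin n) (j : Fin (n + 1)) : contractCoord k n i (t k j) = 0 := by
  unfold contractCoord contract; rw [antider_t]; rfl

theorem contractCoord_dt_succ (i j : Fin n) :
    contractCoord k n i (dt k j.succ) = if j = i then 1 else 0 := by
  unfold contractCoord contract
  rw [antider_dt]
  simp only [Pi.sub_apply, Pi.single_apply, Fin.succ_inj, Fin.succ_ne_zero, if_false, sub_zero]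
  split_ifs <;> simp

theorem contractCoord_algebraMap (i : Fin n) (c : k) :
    contractCoord k n i (algebraMap k _ c) = 0 := by
  have h := contractCoord_mul i (1 : Forms k n) 1
  simp only [mul_one, one_mul, map_one] at h
  rw [Algebra.algebraMap_eq_smul_one, map_smul, left_eq_add.mp h, smul_zero]

theorem contractCoord_polys (i : Fin n) {f : Forms k n} (hf : f ∈ polys k n) :
    contractCoord k n i f = 0 := by
  induction hf using Algebra.adjoin_induction with
  | mem y hy => obtain ⟨j, rfl⟩ := hy; exact contractCoord_t _ _
  | algebraMap c => exact contractCoord_algebraMap _ _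
  | add x y _ _ hx hy => rw [map_add, hx, hy, add_zero]
  | mul x y _ _ hx hy => rw [contractCoord_mul, hx, hy, zero_mul, mul_zero, add_zero]

theorem contractCoord_list_prod (i : Fin n) (L : List (Fin n)) (hi : i ∉ L) :
    contractCoord k n i (L.map fun j => dt k j.succ).prod = 0 := by
  induction L with
  | nil =>
    have := contractCoord_algebraMap (k := k) i 1
    rwa [map_one] at this
  | cons a L ih =>
    rw [List.mem_cons, not_or] at hi
    rw [List.map_cons, List.prod_cons, contractCoord_mul, ih hi.2, contractCoord_dt_succ,
      if_neg (Ne.symm hi.1), zero_mul, mul_zero, add_zero]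

/-- The successive contractions with coordinate vector fields remove the factors of a product of
coordinate one-forms, beginning with the first. -/
theorem contract_list (L : List (Fin n)) (hL : L.Nodup) {f : Forms k n} (hf : f ∈ polys k n) :
    ((L.map (contractCoord k n)).reverse.prod : Module.End k (Forms k n))
      (f * (L.map fun j => dt k j.succ).prod) = f := by
  induction L with
  | nil => simp
  | cons a L ih =>
    rw [List.nodup_cons] at hL
    rw [List.map_cons, List.map_cons, List.prod_cons, List.reverse_cons, List.prod_append,
      List.prod_singleton, Module.End.mul_apply, contractCoord_mul, contractCoord_polys a hf,
      parity_polys hf, contractCoord_mul, contractCoord_list_prod a L hL.1, contractCoord_dt_succ,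
      if_pos rfl, zero_mul, mul_zero, zero_add, add_zero, one_mul, ih hL.2]

theorem integral_mul_vol {f : Forms k n} (hf : f ∈ polys k n) :
    integral k n (f * vol k n) = polyIntegral k n (toPoly k n f) := by
  have h := contract_list (List.finRange n) (List.nodup_finRange n) hf
  rw [← List.ofFn_eq_map, ← List.ofFn_eq_map] at h
  unfold integral vol
  rw [LinearMap.comp_apply, LinearMap.comp_apply, h]
  rfl

theorem polyIntegral_monomial (a : Fin n →₀ ℕ) :
    polyIntegral k n (MvPolynomial.monomial a 1) =
      (∏ i, ((a i).factorial : k)) / ((n + ∑ i, a i).factorial : k) := by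
  have := (MvPolynomial.basisMonomials (Fin n) k).constr_basis k (fun a =>
    (∏ i, ((a i).factorial : k)) / ((n + ∑ i, a i).factorial : k)) a
  rwa [MvPolynomial.coe_basisMonomials] at this

/-- Dirichlet's integral `∫ t_0^b t_1^{a_1} ⋯ t_n^{a_n} = b! a_1! ⋯ a_n! / (n + b + |a|)!`. -/
theorem polyIntegral_dirichlet [CharZero k] (b : ℕ) (a : Fin n →₀ ℕ) :
    polyIntegral k n ((1 - ∑ i, MvPolynomial.X i) ^ b * MvPolynomial.monomial a 1) =
      (b.factorial : k) * (∏ i, ((a i).factorial : k)) / ((n + b + ∑ i, a i).factorial : k) := by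
  induction b generalizing a with
  | zero => simp [polyIntegral_monomial]
  | succ b ih =>
    have e : ((1 - ∑ i, MvPolynomial.X i) ^ (b + 1) * MvPolynomial.monomial a 1 :
        MvPolynomial (Fin n) k) = (1 - ∑ i, MvPolynomial.X i) ^ b * MvPolynomial.monomial a 1 -
        ∑ i, (1 - ∑ i, MvPolynomial.X i) ^ b *
          MvPolynomial.monomial (a + Finsupp.single i 1) 1 := by
      have : ∀ i, (MvPolynomial.monomial (a + Finsupp.single i 1) 1 : MvPolynomial (Fin n) k) =
          MvPolynomial.monomial a 1 * MvPolynomial.X i := by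
        intro i
        rw [MvPolynomial.X, MvPolynomial.monomial_mul, one_mul]
      simp only [this]
      rw [← Finset.mul_sum, ← Finset.mul_sum]
      ring
    have h₁ : ∀ i, ∏ j, (((a + Finsupp.single i 1 : Fin n →₀ ℕ) j).factorial : k) =
        (a i + 1) * ∏ j, ((a j).factorial : k) := by
      intro i
      rw [← Finset.mul_prod_erase _ _ (Finset.mem_univ i),
        ← Finset.mul_prod_erase _ (fun j => ((a j).factorial : k)) (Finset.mem_univ i), ← mul_assoc]
      congr 1
      · simp [Nat.factorial_succ]
      · refine Finset.prod_congr rfl fun j hj => ?_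
        simp [(Finset.ne_of_mem_erase hj).symm]
    have h₂ : ∀ i, ∑ j, (a + Finsupp.single i 1 : Fin n →₀ ℕ) j = ∑ j, a j + 1 := by
      intro i
      simp [Finset.sum_add_distrib, Finsupp.single_apply]
    rw [e, map_sub, map_sum, ih]
    simp only [ih, h₁, h₂]
    have e₁ : n + b + (∑ j, a j + 1) = n + b + ∑ j, a j + 1 := by ring
    have e₂ : n + (b + 1) + ∑ j, a j = n + b + ∑ j, a j + 1 := by ring
    rw [e₁, e₂, ← Finset.sum_div, ← Finset.mul_sum, ← Finset.sum_mul, Finset.sum_add_distrib,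
      Nat.factorial_succ, Nat.factorial_succ]
    have hN : ((n + b + ∑ j, a j).factorial : k) ≠ 0 := by
      exact_mod_cast Nat.factorial_ne_zero _
    have hN' : ((n + b + ∑ j, a j + 1 : ℕ) : k) ≠ 0 :=
      Nat.cast_ne_zero.mpr (Nat.succ_ne_zero _)
    have hs : (∑ i, (a i : k)) = ((∑ j, a j : ℕ) : k) := by push_cast; rfl
    rw [hs]
    simp only [Finset.sum_const, Finset.card_univ, Fintype.card_fin, nsmul_eq_mul, mul_one]
    push_cast at hN' ⊢
    field_simp
    ring

/-- The face inclusion `[n] → [n + 1]` that skips `i`. -/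
abbrev coface {n : ℕ} (i : Fin (n + 2)) : Fin (n + 1) →o Fin (n + 2) :=
  (Fin.succAboveOrderEmb i).toOrderHom

theorem op_coface_t (i : Fin (n + 2)) (j : Fin (n + 1)) :
    op (coface i) (t k (i.succAbove j)) = t k j := by
  simp [Finset.filter_eq']

theorem op_coface_dt (i : Fin (n + 2)) (j : Fin (n + 1)) :
    op (coface i) (dt k (i.succAbove j)) = dt k j := by
  simp [Finset.filter_eq']

theorem op_coface_t_self (i : Fin (n + 2)) : op (k := k) (coface i) (t k i) = 0 := by
  simp [Fin.succAbove_ne]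

theorem op_coface_dt_self (i : Fin (n + 2)) : op (k := k) (coface i) (dt k i) = 0 := by
  simp [Fin.succAbove_ne]

/-- The contraction of the volume form with the Euler field restricts to the volume form of the
opposite face. -/
theorem op_euler_vol [CharZero k] :
    op (coface 0) (euler k (n + 1) (vol k (n + 1))) = vol k n := by
  set rest : Forms k (n + 1) := (List.ofFn fun i : Fin n => dt k i.succ.succ).prod with hrest
  have hmem : ∀ x ∈ List.ofFn fun i : Fin n => dt k i.succ.succ, x ∈ dts k (n + 1) := by
    intro x hx
    obtain ⟨i, rfl⟩ := (List.mem_ofFn' _ _).mp hx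
    exact dt_mem_dts _
  -- Since `∑ dt_i = 0`, the factor `dt_1` of the volume form can be replaced by `-dt_0`.
  have h₁ : vol k (n + 1) = -(dt k 0 * rest) := by
    have h := sum_dt (k := k) (n := n + 1)
    rw [Fin.sum_univ_succ, Fin.sum_univ_succ, ← add_assoc] at h
    have h' : dt k (Fin.succ (0 : Fin (n + 1))) = -dt k 0 - ∑ i : Fin n, dt k i.succ.succ := by
      rw [eq_sub_iff_add_eq, eq_neg_iff_add_eq_zero, ← h]
      abel
    rw [vol, List.ofFn_succ, List.prod_cons, h', sub_mul, Finset.sum_mul, Finset.sum_eq_zero,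
      sub_zero, neg_mul]
    intro i _
    exact dts_mul_list_prod (by simp) hmem
  have h₂ : op (coface 0) rest = vol k n := by
    rw [hrest, map_list_prod, List.map_ofFn, vol]
    congr 2
    funext i
    have := op_coface_dt (k := k) (0 : Fin (n + 2)) i.succ
    rwa [Fin.succAbove_zero] at this
  rw [h₁, map_neg, euler_mul, euler_dt, map_neg, map_add, map_mul, map_mul, parity_dt, map_neg,
    op_coface_dt_self, map_sub, op_coface_t_self, h₂, AlgHom.commutes]
  simp [vertexCoord]

theorem cone_of_dilate {x : Forms k n} {w : ℕ} (h : dilate k n x = Polynomial.monomial w x) :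
    cone k n x = (w : k)⁻¹ • euler k n x := by
  unfold cone
  rw [LinearMap.comp_apply, AlgHom.toLinearMap_apply, h]
  exact Polynomial.sum_monomial_index _ _ (by simp)

theorem dilate_vol : dilate k n (vol k n) = Polynomial.monomial n (vol k n) := by
  have key : ∀ L : List (Fin n), dilate k n (L.map fun j => dt k j.succ).prod =
      Polynomial.monomial L.length (L.map fun j => dt k j.succ).prod := by
    intro L
    induction L with
    | nil => simp
    | cons a L ih =>
      rw [List.map_cons, List.prod_cons, map_mul, ih, dilate_dt, Polynomial.monomial_mul_monomial,
        List.length_cons, add_comm]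
  have := key (List.finRange n)
  rwa [← List.ofFn_eq_map, List.length_finRange] at this

theorem dilate_ofPoly_monomial (a : Fin n →₀ ℕ) :
    dilate k n (ofPoly k n (MvPolynomial.monomial a 1)) =
      Polynomial.monomial (∑ i, a i) (ofPoly k n (MvPolynomial.monomial a 1)) := by
  induction a using Finsupp.induction_linear with
  | zero =>
    have : (MvPolynomial.monomial (0 : Fin n →₀ ℕ) (1 : k)) = 1 := rfl
    simp [this]
  | add a b ha hb =>
    have : (MvPolynomial.monomial (a + b) (1 : k)) =
        MvPolynomial.monomial a 1 * MvPolynomial.monomial b 1 := by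
      rw [MvPolynomial.monomial_mul, one_mul]
    rw [this, map_mul, map_mul, ha, hb, Polynomial.monomial_mul_monomial]
    simp [Finset.sum_add_distrib]
  | single i e =>
    rw [← MvPolynomial.X_pow_eq_monomial, map_pow, map_pow, ofPoly_X, dilate_t]
    simp [vertexCoord, Polynomial.monomial_pow, Finsupp.single_apply]

/-- Integration over the simplex is integration over the face opposite to the vertex `0` of the
cone contraction. -/
theorem integral_eq_integral_cone [CharZero k] {x : Forms k (n + 1)}
    (hx : x ∈ gr k (n + 1) (n + 1)) :
    integral k (n + 1) x = integral k n (op (coface 0) (cone k (n + 1) x)) := by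
  obtain ⟨P, rfl⟩ := exists_eq_ofPoly_mul_vol hx
  clear hx
  induction P using MvPolynomial.induction_on' with
  | add p q hp hq => simp only [map_add, add_mul, hp, hq]
  | monomial a c =>
  have hc : MvPolynomial.monomial a c = c • MvPolynomial.monomial a (1 : k) := by
    rw [MvPolynomial.smul_monomial, smul_eq_mul, mul_one]
  rw [hc]
  simp only [map_smul, smul_mul_assoc]
  congr 1
  clear hc c
  have hd : dilate k (n + 1) (ofPoly k (n + 1) (MvPolynomial.monomial a 1) * vol k (n + 1)) =
      Polynomial.monomial (∑ i, a i + (n + 1))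
        (ofPoly k (n + 1) (MvPolynomial.monomial a 1) * vol k (n + 1)) := by
    rw [map_mul, dilate_ofPoly_monomial, dilate_vol, Polynomial.monomial_mul_monomial]
  have hP := ofPoly_mem_polys (MvPolynomial.monomial a (1 : k))
  have hop : op (coface 0) (ofPoly k (n + 1) (MvPolynomial.monomial a 1)) ∈ polys k n := by
    rw [← gr_zero] at hP ⊢
    exact op_mem_gr _ hP
  have htp : toPoly k n (op (coface 0) (ofPoly k (n + 1) (MvPolynomial.monomial a 1))) =
      (1 - ∑ i, MvPolynomial.X i) ^ a 0 *
        MvPolynomial.monomial (Finsupp.equivFunOnFinite.symm fun i => a i.succ) 1 := by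
    have : ((toPoly k n).comp ((op (coface 0)).comp (ofPoly k (n + 1)))) =
        MvPolynomial.aeval
          (Fin.cons (1 - ∑ i, MvPolynomial.X i) MvPolynomial.X : Fin (n + 1) → _) := by
      apply MvPolynomial.algHom_ext
      intro i
      have := op_coface_t (k := k) (0 : Fin (n + 2)) i
      rw [Fin.succAbove_zero] at this
      simp only [AlgHom.comp_apply, ofPoly_X, this, toPoly_t, MvPolynomial.aeval_X]
    refine (DFunLike.congr_fun this _).trans ?_
    rw [MvPolynomial.aeval_monomial, map_one, one_mul, Finsupp.prod_fintype _ _ (by simp),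
      Fin.prod_univ_succ, MvPolynomial.monomial_eq, Finsupp.prod_fintype _ _ (by simp)]
    simp
  rw [cone_of_dilate hd, euler_mul, euler_polys hP, zero_mul, zero_add, parity_polys hP,
    map_smul, map_smul, map_mul (op _), op_euler_vol, integral_mul_vol hop, htp, integral_mul_vol hP,
    toPoly_ofPoly, polyIntegral_monomial, polyIntegral_dirichlet, Fin.prod_univ_succ,
    Fin.sum_univ_succ]
  have e : n + 1 + (a 0 + ∑ i : Fin n, a i.succ) = n + a 0 + ∑ i : Fin n, a i.succ + 1 := by ring
  have e' : a 0 + ∑ i : Fin n, a i.succ + (n + 1) = n + a 0 + ∑ i : Fin n, a i.succ + 1 := by ring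
  rw [e, e', Nat.factorial_succ]
  simp only [Finsupp.equivFunOnFinite_symm_apply_apply, smul_eq_mul]
  push_cast
  rw [mul_comm ((_ : k) + 1), ← div_div]
  ring

end Forms

namespace Forms

variable {k : Type u} [Field k] {n m l : ℕ}

/-! ### Stokes' theorem -/

theorem coface_succ_zero (i : Fin (n + 1)) : coface i.succ 0 = 0 := by
  simp

theorem op_coface_op_coface_zero (i : Fin (n + 2)) (x : Forms k (n + 2)) :
    op (coface i) (op (coface 0) x) = op (coface 0) (op (coface i.succ) x) := by
  have : (coface (0 : Fin (n + 3))).comp (coface i) =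
      (coface i.succ).comp (coface (0 : Fin (n + 2))) := by
    ext j
    simp
  rw [← AlgHom.comp_apply, ← op_comp, this, op_comp, AlgHom.comp_apply]

theorem d_eq_zero_of_top [CharZero k] {x : Forms k n} (hx : x ∈ gr k n n) : d k n x = 0 :=
  eq_zero_of_mem_gr (Nat.lt_succ_self n) (d_mem_gr rfl hx)

theorem op_coface_eq_zero_of_top [CharZero k] {x : Forms k (n + 1)}
    (hx : x ∈ gr k (n + 1) (n + 1)) (i : Fin (n + 2)) : op (coface i) x = 0 :=
  eq_zero_of_mem_gr (Nat.lt_succ_self n) (op_mem_gr _ hx)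

theorem d_cone_of_top [CharZero k] {x : Forms k (n + 1)} (hx : x ∈ gr k (n + 1) (n + 1)) :
    d k (n + 1) (cone k (n + 1) x) = x := by
  rw [d_cone_of_mem hx, d_eq_zero_of_top hx, map_zero, sub_zero]

/-- A closed form of degree zero is constant. -/
theorem eq_algebraMap_of_d_eq_zero [CharZero k] {x : Forms k n} (hx : x ∈ gr k n 0)
    (hd : d k n x = 0) : ∃ c : k, x = algebraMap k _ c := by
  obtain ⟨c, hc⟩ := weightPart_zero x
  have := d_cone_add_cone_d x
  rw [cone_gr_zero hx, hd, map_zero, map_zero, add_zero, eq_comm, sub_eq_zero] at this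
  exact ⟨c, this.trans hc⟩

theorem integral_zero_algebraMap (c : k) : integral k 0 (algebraMap k _ c) = c := by
  have h := integral_mul_vol (k := k) (n := 0) one_mem_polys
  have hp := polyIntegral_monomial (k := k) (n := 0) 0
  have hv : vol k 0 = 1 := rfl
  have h1 : (MvPolynomial.monomial (0 : Fin 0 →₀ ℕ) (1 : k)) = 1 := rfl
  rw [hv, mul_one, map_one (toPoly k 0), ← h1, hp] at h
  rw [Algebra.algebraMap_eq_smul_one, map_smul, h]
  simp

/-- Stokes' theorem, by induction on the dimension. The integral of `dx` is that of `x - d (cone x)`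
over the face opposite to the vertex `0`. By the induction hypothesis, the second term is a sum over
the faces of `cone x` on that face; these are cones of the other faces of `x`, and have the same
integrals as these faces. -/
theorem integral_d [CharZero k] {x : Forms k (n + 1)} (hx : x ∈ gr k (n + 1) n) :
    integral k (n + 1) (d k (n + 1) x) =
      ∑ i : Fin (n + 2), (-1 : k) ^ i.1 • integral k n (op (coface i) x) := by
  induction n with
  | zero =>
    obtain ⟨c, hc⟩ := weightPart_zero x
    have h₁ : cone k 1 (d k 1 x) = x - weightPart k 1 0 x := by
      rw [← d_cone_add_cone_d, cone_gr_zero hx, map_zero, zero_add]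
    have hy := op_mem_gr (coface (1 : Fin 2)) hx
    obtain ⟨c', hc'⟩ := eq_algebraMap_of_d_eq_zero hy (d_eq_zero_of_top hy)
    have h₂ := weightPart_op (k := k) (coface_succ_zero (0 : Fin 1)) 0 x
    have e : (Fin.succ (0 : Fin 1)) = 1 := rfl
    rw [e, hc', hc, weightPart_algebraMap, if_pos rfl, AlgHom.commutes] at h₂
    rw [integral_eq_integral_cone (d_mem_gr rfl hx), h₁, map_sub, map_sub, hc, AlgHom.commutes,
      Fin.sum_univ_two, hc', h₂]
    simp [sub_eq_add_neg]
  | succ n ih =>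
    have hc : cone k (n + 2) (d k (n + 2) x) = x - d k (n + 2) (cone k (n + 2) x) := by
      rw [d_cone_of_mem hx, sub_sub_cancel]
    have hy := op_mem_gr (coface (0 : Fin (n + 3))) (cone_mem_gr hx)
    rw [integral_eq_integral_cone (d_mem_gr rfl hx), hc, map_sub, map_sub, op_d, ih hy]
    conv_rhs => rw [Fin.sum_univ_succ]
    rw [sub_eq_add_neg, ← Finset.sum_neg_distrib]
    congr 1
    · simp
    · refine Finset.sum_congr rfl fun i _ => ?_
      rw [op_coface_op_coface_zero, op_cone (coface_succ_zero i),
        ← integral_eq_integral_cone (op_mem_gr _ hx), Fin.val_succ, pow_succ, mul_neg_one, neg_smul]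

/-! ### Extension of forms from a face -/

theorem mem_gr_of_algHom {p : ℕ} (f : Forms k n →ₐ[k] Forms k m) (ht : ∀ i, f (t k i) ∈ polys k m)
    (hd : ∀ i, f (dt k i) ∈ dts k m) {x : Forms k n} (hx : x ∈ gr k n p) : f x ∈ gr k m p := by
  have h1 : (polys k n).map f.toLinearMap ≤ polys k m := by
    rintro _ ⟨g, hg, rfl⟩
    change f g ∈ Algebra.adjoin k _
    induction hg using Algebra.adjoin_induction with
    | mem y hy => obtain ⟨j, rfl⟩ := hy; exact ht j
    | algebraMap c => simp
    | add a b _ _ ha hb => rw [map_add]; exact add_mem ha hb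
    | mul a b _ _ ha hb => rw [map_mul]; exact mul_mem ha hb
  have h2 : (dts k n).map f.toLinearMap ≤ dts k m := by
    rw [dts, Submodule.map_span_le]
    rintro _ ⟨j, rfl⟩
    exact hd j
  have h3 : (gr k n p).map f.toLinearMap ≤ gr k m p := by
    rw [gr, Submodule.map_mul, Submodule.map_pow]
    exact mul_le_mul' h1 (pow_le_pow_left' h2 p)
  exact h3 ⟨x, hx, rfl⟩

/-- The pullback of forms along the affine map given by an arbitrary (not necessarily monotone)
map of the vertices. Extension from a face uses maps that are not monotone. -/
def pull (φ : Fin (m + 1) → Fin (n + 1)) : Forms k n →ₐ[k] Forms k m :=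
  lift (fun i => ∑ j with φ j = i, t k j) (fun i => ∑ j with φ j = i, dt k j)
    (fun i j => Commute.sum_left _ _ _ fun x _ => Commute.sum_right _ _ _ fun y _ => t_mul_t x y)
    (fun i j => Commute.sum_left _ _ _ fun x _ => Commute.sum_right _ _ _ fun y _ => t_mul_dt x y)
    (fun i j => dts_anticomm (sum_mem fun _ _ => dt_mem_dts _) (sum_mem fun _ _ => dt_mem_dts _))
    (by rw [Finset.sum_fiberwise]; exact sum_t) (by rw [Finset.sum_fiberwise]; exact sum_dt)

theorem pull_t (φ : Fin (m + 1) → Fin (n + 1)) (i : Fin (n + 1)) :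
    pull φ (t k i) = ∑ j with φ j = i, t k j := by
  unfold pull; exact lift_t i

theorem pull_dt (φ : Fin (m + 1) → Fin (n + 1)) (i : Fin (n + 1)) :
    pull φ (dt k i) = ∑ j with φ j = i, dt k j := by
  unfold pull; exact lift_dt i

theorem op_eq_pull (φ : Fin (m + 1) →o Fin (n + 1)) (x : Forms k n) : op φ x = pull φ x := by
  have : op (k := k) φ = pull φ := by
    apply algHom_ext <;> intro i <;> simp [pull_t, pull_dt]
  rw [this]

theorem pull_id (x : Forms k n) : pull id x = x := by
  have : pull (k := k) (id : Fin (n + 1) → Fin (n + 1)) = AlgHom.id k _ := by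
    apply algHom_ext <;> intro i <;> simp [pull_t, pull_dt, Finset.filter_eq']
  rw [this]; rfl

theorem pull_pull (φ : Fin (m + 1) → Fin (n + 1)) (ψ : Fin (l + 1) → Fin (m + 1))
    (x : Forms k n) : pull ψ (pull φ x) = pull (φ ∘ ψ) x := by
  have : (pull (k := k) ψ).comp (pull φ) = pull (φ ∘ ψ) := by
    apply algHom_ext <;> intro i <;>
    · simp only [pull_t, pull_dt, Function.comp_apply, AlgHom.comp_apply, map_sum]
      rw [← Finset.sum_fiberwise_of_maps_to (g := ψ) (t := Finset.univ.filter fun j => φ j = i)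
        (by simp)]
      refine Finset.sum_congr rfl fun j hj => Finset.sum_congr ?_ fun _ _ => rfl
      ext x
      simp only [Finset.mem_filter, Finset.mem_univ, true_and] at hj ⊢
      constructor
      · rintro rfl; exact ⟨hj, rfl⟩
      · exact fun h => h.2
  rw [← AlgHom.comp_apply, this]

theorem pull_mem_gr {p : ℕ} (φ : Fin (m + 1) → Fin (n + 1)) {x : Forms k n}
    (hx : x ∈ gr k n p) : pull φ x ∈ gr k m p :=
  mem_gr_of_algHom _ (fun i => by rw [pull_t]; exact sum_mem fun j _ => t_mem_polys j)
    (fun i => by rw [pull_dt]; exact sum_mem fun j _ => dt_mem_dts j) hx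

/-- The extension of a form from the face opposite to the vertex `0`: the sum of its pullbacks
along the projections that send the vertex `0` to the vertex `j` of the face, each multiplied by
the barycentric coordinate of that vertex. -/
def extend (k : Type u) [Field k] (n : ℕ) : Forms k n →ₗ[k] Forms k (n + 1) :=
  ∑ j : Fin (n + 1), LinearMap.mulLeft k (t k j.succ) ∘ₗ
    (pull (Fin.cases j id : Fin (n + 2) → Fin (n + 1))).toLinearMap

theorem extend_apply (x : Forms k n) : extend k n x = ∑ j : Fin (n + 1), t k j.succ *
    pull (Fin.cases j id : Fin (n + 2) → Fin (n + 1)) x := by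
  simp [extend]

theorem extend_mem_gr {p : ℕ} {x : Forms k n} (hx : x ∈ gr k n p) :
    extend k n x ∈ gr k (n + 1) p := by
  rw [extend_apply]
  exact sum_mem fun j _ => mul_mem_gr (zero_add p) (polys_le_gr_zero (t_mem_polys _))
    (pull_mem_gr _ hx)

theorem op_coface_zero_extend (x : Forms k n) : op (coface 0) (extend k n x) = x := by
  rw [extend_apply, map_sum]
  have : ∀ j : Fin (n + 1), op (coface 0) (t k j.succ *
      pull (Fin.cases j id : Fin (n + 2) → Fin (n + 1)) x) = t k j * x := by
    intro j
    have h := op_coface_t (k := k) (0 : Fin (n + 2)) j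
    rw [Fin.succAbove_zero] at h
    rw [map_mul, h, op_eq_pull _ (pull _ x), pull_pull]
    congr 1
    convert! pull_id x using 2
  simp only [this]
  rw [← Finset.sum_mul, sum_t, one_mul]

/-- The forms that vanish on the boundary of the simplex. -/
def relative (k : Type u) [Field k] : ∀ n : ℕ, Submodule k (Forms k n)
  | 0 => ⊤
  | n + 1 => ⨅ i : Fin (n + 2), LinearMap.ker (op (k := k) (coface i)).toLinearMap

theorem mem_relative_succ {x : Forms k (n + 1)} :
    x ∈ relative k (n + 1) ↔ ∀ i, op (coface i) x = 0 := by
  simp [relative]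

theorem op_coface_succ_extend {x : Forms k n} (hx : x ∈ relative k n) (i : Fin (n + 1)) :
    op (coface i.succ) (extend k n x) = 0 := by
  rw [extend_apply, map_sum]
  refine Finset.sum_eq_zero fun j _ => ?_
  rw [map_mul]
  by_cases hj : j = i
  · rw [hj, op_coface_t_self, zero_mul]
  · obtain _ | n := n
    · exact absurd (Fin.ext (by omega)) hj
    have hne : ∀ l, (Fin.cases j id : Fin (n + 3) → Fin (n + 2)) (coface i.succ l) ≠ i := by
      intro l
      have := Fin.succAbove_ne i.succ l
      change (Fin.cases j id : Fin (n + 3) → Fin (n + 2)) (i.succ.succAbove l) ≠ i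
      generalize i.succ.succAbove l = a at this
      induction a using Fin.cases with
      | zero => exact hj
      | succ a => exact fun e => this (congrArg Fin.succ e)
    choose ψ hψ using fun l => Fin.exists_succAbove_eq (hne l)
    have e : (Fin.cases j id : Fin (n + 3) → Fin (n + 2)) ∘ (coface i.succ) = coface i ∘ ψ := by
      funext l
      exact (hψ l).symm
    rw [op_eq_pull _ (pull _ x), pull_pull, e, ← pull_pull, ← op_eq_pull,
      mem_relative_succ.mp hx i, map_zero, mul_zero]

/-! ### Forms relative to the boundary -/

theorem d_mem_relative {x : Forms k n} (hx : x ∈ relative k n) : d k n x ∈ relative k n := by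
  cases n with
  | zero => exact Submodule.mem_top
  | succ n =>
    rw [mem_relative_succ] at hx ⊢
    intro i
    rw [op_d, hx i, map_zero]

theorem eq_zero_of_relative_closed [CharZero k] {x : Forms k n} (hx : x ∈ gr k n 0)
    (hr : x ∈ relative k n) (hd : d k n x = 0) (hi : 0 = n → integral k n x = 0) : x = 0 := by
  obtain ⟨c, rfl⟩ := eq_algebraMap_of_d_eq_zero hx hd
  cases n with
  | zero =>
    have := hi rfl
    rw [integral_zero_algebraMap] at this
    rw [this, map_zero]
  | succ n =>
    have := congrArg (op (Fin.predAboveOrderHom (0 : Fin (n + 1)))) (mem_relative_succ.mp hr 0)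
    rwa [AlgHom.commutes, AlgHom.commutes, map_zero] at this

/-- The Poincaré lemma relative to the boundary: a closed form that vanishes on the boundary, and
whose integral is zero if it is of top degree, is the differential of a form that vanishes on the
boundary. The cone contraction gives a primitive that vanishes on all faces but the one opposite to
the vertex `0`, where it is closed; by induction on the dimension it can be corrected there. -/
theorem exists_relative_primitive [CharZero k] {q : ℕ} {x : Forms k n} (hx : x ∈ gr k n (q + 1))
    (hr : x ∈ relative k n) (hd : d k n x = 0) (hi : q + 1 = n → integral k n x = 0) :
    ∃ y ∈ relative k n, y ∈ gr k n q ∧ d k n y = x := by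
  induction n generalizing q with
  | zero =>
    rw [eq_zero_of_mem_gr (Nat.succ_pos q) hx]
    exact ⟨0, zero_mem _, zero_mem _, map_zero _⟩
  | succ n ih =>
    rw [mem_relative_succ] at hr
    have hdc : d k (n + 1) (cone k (n + 1) x) = x := by
      rw [d_cone_of_mem hx, hd, map_zero, sub_zero]
    have hcs : ∀ i : Fin (n + 1), op (coface i.succ) (cone k (n + 1) x) = 0 := by
      intro i
      rw [op_cone (coface_succ_zero i), hr, map_zero]
    have hβ := op_mem_gr (coface (0 : Fin (n + 2))) (cone_mem_gr hx)
    have hβd : d k n (op (coface 0) (cone k (n + 1) x)) = 0 := by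
      rw [← op_d, hdc, hr]
    have hβr : op (coface 0) (cone k (n + 1) x) ∈ relative k n := by
      cases n with
      | zero => exact Submodule.mem_top
      | succ n =>
        rw [mem_relative_succ]
        intro i
        rw [op_coface_op_coface_zero, hcs, map_zero]
    have hβi : q = n → integral k n (op (coface 0) (cone k (n + 1) x)) = 0 := by
      rintro rfl
      rw [← integral_eq_integral_cone hx, hi rfl]
    cases q with
    | zero =>
      refine ⟨cone k (n + 1) x, ?_, cone_mem_gr hx, hdc⟩
      rw [mem_relative_succ]
      refine Fin.cases ?_ hcs
      exact eq_zero_of_relative_closed hβ hβr hβd hβi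
    | succ q =>
      obtain ⟨γ, hγr, hγ, hγd⟩ := ih hβ hβr hβd hβi
      refine ⟨cone k (n + 1) x - d k (n + 1) (extend k n γ), ?_,
        sub_mem (cone_mem_gr hx) (d_mem_gr rfl (extend_mem_gr hγ)), ?_⟩
      · rw [mem_relative_succ]
        refine Fin.cases ?_ fun i => ?_
        · rw [map_sub, op_d, op_coface_zero_extend, hγd, sub_self]
        · rw [map_sub, op_d, op_coface_succ_extend hγr, hcs, map_zero, sub_self]
      · rw [map_sub, hdc, d_d, sub_zero]

/-- The forms of degree `p` that vanish on the boundary and, if `p = n`, have integral zero. -/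
noncomputable def relativeZero (k : Type u) [Field k] (n p : ℕ) : Submodule k (gr k n p) where
  carrier := {x | x.1 ∈ relative k n ∧ (p = n → integral k n x.1 = 0)}
  add_mem' hx hy := ⟨add_mem hx.1 hy.1, fun e => by
    rw [Submodule.coe_add, map_add, hx.2 e, hy.2 e, add_zero]⟩
  zero_mem' := ⟨zero_mem _, fun _ => map_zero _⟩
  smul_mem' c x hx := ⟨Submodule.smul_mem _ c hx.1, fun e => by
    rw [Submodule.coe_smul, map_smul, hx.2 e, smul_zero]⟩

theorem grD_mem_relativeZero [CharZero k] {p : ℕ} {x : gr k n p} (hx : x ∈ relativeZero k n p) :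
    grD k n p (p + 1) rfl x ∈ relativeZero k n (p + 1) := by
  refine ⟨d_mem_relative hx.1, ?_⟩
  rintro rfl
  rw [grD_coe, integral_d x.2]
  refine Finset.sum_eq_zero fun i _ => ?_
  rw [mem_relative_succ.mp hx.1, map_zero, smul_zero]

/-- If every element of `Z` has a preimage in `R`, then such preimages can be chosen linearly. -/
theorem exists_linear_section {V W : Type*} [AddCommGroup V] [Module k V] [AddCommGroup W]
    [Module k W] (D : V →ₗ[k] W) (R : Submodule k V) (Z : Submodule k W)
    (h : ∀ z ∈ Z, ∃ x ∈ R, D x = z) :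
    ∃ s : W →ₗ[k] V, ∀ z ∈ Z, s z ∈ R ∧ D (s z) = z := by
  obtain ⟨g, hg⟩ := (D.domRestrict R).rangeRestrict.exists_rightInverse_of_surjective
    (LinearMap.range_rangeRestrict _)
  obtain ⟨s, hs⟩ := LinearMap.exists_extend (R.subtype ∘ₗ g)
  refine ⟨s, fun z hz => ?_⟩
  obtain ⟨x, hx, hxz⟩ := h z hz
  have hz' : z ∈ LinearMap.range (D.domRestrict R) := ⟨⟨x, hx⟩, hxz⟩
  have e : s z = g ⟨z, hz'⟩ := DFunLike.congr_fun hs ⟨z, hz'⟩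
  have e' := congrArg Subtype.val (DFunLike.congr_fun hg ⟨z, hz'⟩)
  rw [e]
  exact ⟨Subtype.prop _, e'⟩

/-- The complex of forms that vanish on the boundary and have integral zero is contractible. -/
theorem exists_relativeZero_homotopy [CharZero k] (n : ℕ) :
    ∃ H : ∀ p, gr k n (p + 1) →ₗ[k] gr k n p,
      (∀ p, ∀ x ∈ relativeZero k n (p + 1), H p x ∈ relativeZero k n p) ∧
      (∀ x ∈ relativeZero k n 0, H 0 (grD k n 0 1 rfl x) = x) ∧
      (∀ p, ∀ x ∈ relativeZero k n (p + 1),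
        grD k n p (p + 1) rfl (H p x) + H (p + 1) (grD k n (p + 1) (p + 2) rfl x) = x) := by
  have dd : ∀ p (x : gr k n p), grD k n (p + 1) (p + 2) rfl (grD k n p (p + 1) rfl x) = 0 :=
    fun p x => Subtype.ext (d_d x.1)
  have ex : ∀ p, ∃ s : gr k n (p + 1) →ₗ[k] gr k n p,
      ∀ z ∈ relativeZero k n (p + 1) ⊓ LinearMap.ker (grD k n (p + 1) (p + 2) rfl),
        s z ∈ relativeZero k n p ∧ grD k n p (p + 1) rfl (s z) = z := by
    intro p
    refine exists_linear_section _ _ _ fun z hz => ?_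
    have hz₂ : d k n z.1 = 0 := congrArg Subtype.val hz.2
    by_cases hp : p = n
    · subst hp
      refine ⟨0, zero_mem _, ?_⟩
      rw [map_zero]
      exact Subtype.ext (eq_zero_of_mem_gr (Nat.lt_succ_self _) z.2).symm
    · obtain ⟨y, hy, hyg, hyd⟩ := exists_relative_primitive z.2 hz.1.1 hz₂ hz.1.2
      exact ⟨⟨y, hyg⟩, ⟨hy, fun e => absurd e hp⟩, Subtype.ext hyd⟩
  choose s hs using ex
  -- With linear primitives `s` of the closed forms, the homotopy is `x ↦ s (x - s (d x))`.
  have hsd : ∀ p, ∀ x ∈ relativeZero k n p, s p (grD k n p (p + 1) rfl x) ∈ relativeZero k n p ∧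
      grD k n p (p + 1) rfl (s p (grD k n p (p + 1) rfl x)) = grD k n p (p + 1) rfl x :=
    fun p x hx => hs p _ ⟨grD_mem_relativeZero hx, dd p x⟩
  have hmem : ∀ p, ∀ x ∈ relativeZero k n (p + 1), x - s (p + 1) (grD k n (p + 1) (p + 2) rfl x) ∈
      relativeZero k n (p + 1) ⊓ LinearMap.ker (grD k n (p + 1) (p + 2) rfl) := by
    intro p x hx
    refine ⟨sub_mem hx (hsd _ x hx).1, LinearMap.mem_ker.mpr ?_⟩
    rw [map_sub, (hsd _ x hx).2, sub_self]
  refine ⟨fun p => s p ∘ₗ (LinearMap.id - s (p + 1) ∘ₗ grD k n (p + 1) (p + 2) rfl), ?_, ?_, ?_⟩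
  · intro p x hx
    exact (hs p _ (hmem p x hx)).1
  · intro x hx
    simp only [LinearMap.comp_apply, LinearMap.sub_apply, LinearMap.id_apply, dd, map_zero,
      sub_zero]
    have h := sub_mem hx (hsd 0 x hx).1
    have hd : d k n (x - s 0 (grD k n 0 1 rfl x)).1 = 0 := by
      have := (hsd 0 x hx).2
      have h2 := congrArg Subtype.val this
      simp only [grD_coe] at h2
      rw [Submodule.coe_sub, map_sub, h2, sub_self]
    have := eq_zero_of_relative_closed (x - s 0 (grD k n 0 1 rfl x)).2 h.1 hd h.2
    exact (sub_eq_zero.mp (Subtype.ext this)).symm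
  · intro p x hx
    simp only [LinearMap.comp_apply, LinearMap.sub_apply, LinearMap.id_apply, dd, map_zero,
      sub_zero]
    rw [(hs p _ (hmem p x hx)).2, sub_add_cancel]

/-- There are chain maps `Ω_n → Ω_{n+1}` that extend every form which vanishes on the boundary, and
has integral zero if it is of top degree, from the face opposite to the vertex `0` to a form that
vanishes on the other faces. -/
theorem exists_chain_extension [CharZero k] (n : ℕ) :
    ∃ T : ∀ p, gr k n p →ₗ[k] gr k (n + 1) p,
      (∀ p x, grD k (n + 1) p (p + 1) rfl (T p x) = T (p + 1) (grD k n p (p + 1) rfl x)) ∧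
      (∀ p, ∀ x ∈ relativeZero k n p, grOp k (coface 0) p (T p x) = x ∧
        ∀ i : Fin (n + 1), grOp k (coface i.succ) p (T p x) = 0) := by
  obtain ⟨H, hH, hH0, hH1⟩ := exists_relativeZero_homotopy (k := k) n
  let G : ∀ p, gr k n (p + 1) →ₗ[k] gr k (n + 1) p := fun p =>
    (extend k n).restrict (fun _ hx => extend_mem_gr hx) ∘ₗ H p
  have hG0 : ∀ p x, op (coface 0) (G p x).1 = (H p x).1 := fun p x => op_coface_zero_extend _
  have hGs : ∀ p, ∀ x ∈ relativeZero k n (p + 1), ∀ i : Fin (n + 1),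
      op (coface i.succ) (G p x).1 = 0 :=
    fun p x hx i => op_coface_succ_extend (hH p x hx).1 i
  -- `T = d G + G d`, where `G` is the contraction `H` followed by the extension of forms.
  let T : ∀ p, gr k n p →ₗ[k] gr k (n + 1) p := fun p => match p with
    | 0 => G 0 ∘ₗ grD k n 0 1 rfl
    | p + 1 => grD k (n + 1) p (p + 1) rfl ∘ₗ G p + G (p + 1) ∘ₗ grD k n (p + 1) (p + 2) rfl
  refine ⟨T, ?_, ?_⟩
  · intro p x
    apply Subtype.ext
    have dd : ∀ p (x : gr k n p), grD k n (p + 1) (p + 2) rfl (grD k n p (p + 1) rfl x) = 0 :=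
      fun p x => Subtype.ext (d_d x.1)
    cases p with
    | zero =>
      change d k (n + 1) (G 0 _).1 = d k (n + 1) (G 0 _).1 + (G 1 _).1
      rw [dd, map_zero, Submodule.coe_zero, add_zero]
    | succ p =>
      change d k (n + 1) (d k (n + 1) (G p _).1 + (G (p + 1) _).1) =
        d k (n + 1) (G (p + 1) _).1 + (G (p + 2) _).1
      rw [dd, map_zero, Submodule.coe_zero, add_zero, map_add, d_d, zero_add]
  · intro p x hx
    cases p with
    | zero =>
      refine ⟨Subtype.ext ?_, fun i => Subtype.ext ?_⟩
      · exact (hG0 0 _).trans (congrArg Subtype.val (hH0 x hx))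
      · exact hGs 0 _ (grD_mem_relativeZero hx) i
    | succ p =>
      refine ⟨Subtype.ext ?_, fun i => Subtype.ext ?_⟩
      · change op (coface 0) (d k (n + 1) (G p _).1 + (G (p + 1) _).1) = _
        rw [map_add, op_d, hG0, hG0]
        exact congrArg Subtype.val (hH1 p x hx)
      · change op (coface i.succ) (d k (n + 1) (G p _).1 + (G (p + 1) _).1) = _
        rw [map_add, op_d, hGs _ _ hx, hGs _ _ (grD_mem_relativeZero hx), map_zero, add_zero]
        rfl

/-! ### The integral of a shuffle product -/

/-- The simplicial Lie algebra of `3 × 3` matrices of forms. The bracket of `x E_{01}` and `y E_{12}`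
is `x y E_{02}`, so that shuffle brackets in it compute shuffle products of forms. -/
def matrixForms (k : Type u) [Field k] : SimplicialLieAlgebra.{u, u} k where
  obj n := Matrix (Fin 3) (Fin 3) (Forms k n)
  lieRing _ := LieRing.ofAssociativeRing
  lieAlgebra _ := LieAlgebra.ofAssociativeAlgebra
  map φ := (op φ).mapMatrix.toLieHom
  map_id n x := by
    ext i j
    exact DFunLike.congr_fun op_id (x i j)
  map_comp φ ψ x := by
    ext i j
    exact DFunLike.congr_fun (op_comp φ ψ) (x i j)

/-- The shuffle product of forms. -/
def shuffleMul (p q r : ℕ) (h : p + q = r) (x : Forms k p) (y : Forms k q) : Forms k r :=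
  ∑ σ : Equiv.Perm (Fin r) with IsShuffle p σ, (Equiv.Perm.sign σ : ℤ) •
    (op (stepMap (shuffleFst p σ) (card_shuffleFst h σ)) x *
      op (stepMap (shuffleSnd p σ) (card_shuffleSnd h σ)) y)

/-- The matrix with a single non-zero entry `x`. -/
def matrixSingle (i j : Fin 3) (x : Forms k n) : (matrixForms k).obj n :=
  (Matrix.single i j x : Matrix (Fin 3) (Fin 3) (Forms k n))

theorem matrixSingle_injective (i j : Fin 3) :
    Function.Injective (matrixSingle (k := k) (n := n) i j) :=
  fun x y h => by
    have := congrFun (congrFun (show (Matrix.single i j x : Matrix _ _ (Forms k n)) =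
      Matrix.single i j y from h) i) j
    rwa [Matrix.single_apply_same, Matrix.single_apply_same] at this

theorem matrixForms_map_single (φ : Fin (m + 1) →o Fin (n + 1)) (i j : Fin 3) (x : Forms k n) :
    (matrixForms k).map φ (matrixSingle i j x) = matrixSingle i j (op φ x) :=
  Matrix.map_single _ _ _ (op φ)

theorem matrixSingle_zero (i j : Fin 3) : matrixSingle i j (0 : Forms k n) = 0 :=
  Matrix.single_zero i j

theorem matrixSingle_zsmul (i j : Fin 3) (c : ℤ) (x : Forms k n) :
    matrixSingle i j (c • x) = c • matrixSingle i j x :=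
  map_zsmul (Matrix.singleAddMonoidHom (α := Forms k n) i j) c x

theorem lie_matrixSingle (a b : Forms k n) :
    ⁅(matrixSingle 0 1 a : (matrixForms k).obj n), matrixSingle 1 2 b⁆ =
      matrixSingle 0 2 (a * b) := by
  have h : (Matrix.single 0 1 a : Matrix (Fin 3) (Fin 3) (Forms k n)) * Matrix.single 1 2 b -
      Matrix.single 1 2 b * Matrix.single 0 1 a = Matrix.single 0 2 (a * b) := by
    rw [Matrix.single_mul_single_same, Matrix.single_mul_single_of_ne _ _ _ _ (by decide), sub_zero]
  exact h

theorem shuffleBracket_single {p q r : ℕ} (h : p + q = r) (x : Forms k p) (y : Forms k q) :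
    (matrixForms k).shuffleBracket p q r h (matrixSingle 0 1 x) (matrixSingle 1 2 y) =
      matrixSingle 0 2 (shuffleMul p q r h x y) := by
  simp only [SimplicialLieAlgebra.shuffleBracket, LinearMap.mk₂_apply, matrixForms_map_single,
    lie_matrixSingle, ← matrixSingle_zsmul]
  exact (map_sum (Matrix.singleAddMonoidHom (α := Forms k r) 0 2) _ _).symm

theorem stepMap_univ {r : ℕ} (h : (Finset.univ : Finset (Fin r)).card = r) :
    stepMap Finset.univ h = OrderHom.id := by
  ext j
  rw [stepMap_val]
  have : (Finset.univ.filter fun a : Fin r => a.1 < j.1).card = min r j.1 := by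
    exact Fin.card_filter_val_lt
  rw [this, OrderHom.id_coe, id, min_eq_right (Nat.lt_succ_iff.mp j.2)]

theorem shuffleMul_algebraMap {q : ℕ} (h : 0 + q = q) (c : k) (y : Forms k q) :
    shuffleMul 0 q q h (algebraMap k _ c) y = algebraMap k _ c * y := by
  apply matrixSingle_injective 0 2
  rw [← shuffleBracket_single, SimplicialLieAlgebra.shuffleBracket_eq, Fintype.sum_eq_single ∅]
  · rw [SimplicialLieAlgebra.act_of_card _ Finset.card_empty, Finset.compl_empty,
      SimplicialLieAlgebra.act_of_card _ (Finset.card_fin q), stepMap_univ,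
      SimplicialLieAlgebra.map_id, matrixForms_map_single, AlgHom.commutes, lie_matrixSingle,
      crossSign, Finset.prod_empty, one_smul]
  · intro S hS
    rw [SimplicialLieAlgebra.act_of_card_ne _ (Finset.card_ne_zero.mpr
      (Finset.nonempty_iff_ne_empty.mpr hS)), zero_lie, smul_zero]

theorem shuffleMul_mem_gr {a b c p q r : ℕ} (h : p + q = r) (h' : a + b = c) {x : Forms k p}
    {y : Forms k q} (hx : x ∈ gr k p a) (hy : y ∈ gr k q b) :
    shuffleMul p q r h x y ∈ gr k r c :=
  sum_mem fun _ _ => zsmul_mem (mul_mem_gr h' (op_mem_gr _ hx) (op_mem_gr _ hy)) _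

theorem d_shuffleMul {a p q r : ℕ} (h : p + q = r) {x : Forms k p} {y : Forms k q}
    (hx : x ∈ gr k p a) (hy : d k q y = 0) :
    d k r (shuffleMul p q r h x y) = shuffleMul p q r h (d k p x) y := by
  rw [shuffleMul, shuffleMul, map_sum]
  refine Finset.sum_congr rfl fun σ _ => ?_
  rw [map_zsmul, d_mul (op_mem_gr _ hx), ← op_d, ← op_d, hy, map_zero, mul_zero, smul_zero, add_zero]

theorem op_coface_succ_shuffleMul {p q r : ℕ} (h : p + 1 + q = r + 1) {x : Forms k (p + 1)}
    {y : Forms k q} (hx : ∀ i : Fin (p + 1), op (coface i.succ) x = 0) (hy : y ∈ relative k q)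
    (i : Fin (r + 1)) : op (coface i.succ) (shuffleMul (p + 1) q (r + 1) h x y) = 0 := by
  apply matrixSingle_injective 0 2
  rw [matrixSingle_zero, ← matrixForms_map_single, ← shuffleBracket_single]
  refine ((matrixForms k).mem_normalized_succ.mp ((matrixForms k).shuffleBracket_mem h
    ((matrixForms k).mem_normalized_succ.mpr fun i => ?_) ?_)) i
  · exact (matrixForms_map_single _ _ _ _).trans (by rw [hx, matrixSingle_zero])
  · cases q with
    | zero => exact Submodule.mem_top
    | succ q =>
      refine (matrixForms k).mem_normalized_succ.mpr fun i => ?_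
      exact (matrixForms_map_single _ _ _ _).trans
        (by rw [mem_relative_succ.mp hy i.succ, matrixSingle_zero])

/-- On the face opposite to the vertex `0`, the shuffle product of `x` with a form `y` that vanishes
on the boundary is the shuffle product of the face of `x` with `y`. -/
theorem op_coface_zero_shuffleMul {p q r : ℕ} (h : p + 1 + q = r + 1) (h' : p + q = r)
    (x : Forms k (p + 1)) {y : Forms k q} (hy : y ∈ relative k q) :
    op (coface 0) (shuffleMul (p + 1) q (r + 1) h x y) =
      shuffleMul p q r h' (op (coface 0) x) y := by
  apply matrixSingle_injective 0 2
  rw [← matrixForms_map_single, ← shuffleBracket_single, ← shuffleBracket_single,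
    ← matrixForms_map_single]
  cases q with
  | zero => exact (matrixForms k).face_zero_shuffleBracket_zero_right h h' _ _
  | succ q =>
    refine ((matrixForms k).face_zero_shuffleBracket h h' (by omega) _ _).trans ?_
    have : (matrixForms k).face 0 (matrixSingle 1 2 y) = 0 :=
      (matrixForms_map_single _ _ _ _).trans
        (by rw [mem_relative_succ.mp hy 0, matrixSingle_zero])
    rw [this, map_zero, smul_zero, add_zero]
    rfl

theorem mem_relative_of_top [CharZero k] {x : Forms k n} (hx : x ∈ gr k n n) :
    x ∈ relative k n := by
  cases n with
  | zero => exact Submodule.mem_top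
  | succ n => exact mem_relative_succ.mpr (op_coface_eq_zero_of_top hx)

/-- The integral of a shuffle product of top forms is the product of the integrals. By induction on
`p`: a top form `x` is the differential of its cone, and Stokes' theorem for the shuffle product of
the cone of `x` with `y` involves only the face opposite to the vertex `0`. -/
theorem integral_shuffleMul [CharZero k] {p q r : ℕ} (h : p + q = r) {x : Forms k p}
    {y : Forms k q} (hx : x ∈ gr k p p) (hy : y ∈ gr k q q) :
    integral k r (shuffleMul p q r h x y) = integral k p x * integral k q y := by
  induction p generalizing r with
  | zero =>
    obtain rfl : q = r := by omega
    obtain ⟨c, rfl⟩ := eq_algebraMap_of_d_eq_zero hx (d_eq_zero_of_top hx)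
    rw [shuffleMul_algebraMap, integral_zero_algebraMap, ← Algebra.smul_def, map_smul, smul_eq_mul]
  | succ p ih =>
    obtain ⟨r, rfl⟩ : ∃ s, r = s + 1 := ⟨p + q, by omega⟩
    have hα := cone_mem_gr hx
    have hs : ∀ i : Fin (p + 1), op (coface i.succ) (cone k (p + 1) x) = 0 := fun i => by
      rw [op_cone (coface_succ_zero i), op_coface_eq_zero_of_top hx, map_zero]
    have e := d_shuffleMul h hα (d_eq_zero_of_top hy)
    rw [d_cone_of_top hx] at e
    have h' : p + q = r := by omega
    rw [← e, integral_d (shuffleMul_mem_gr h h' hα hy), Fin.sum_univ_succ,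
      Finset.sum_eq_zero fun i _ => by
        rw [op_coface_succ_shuffleMul h hs (mem_relative_of_top hy), map_zero, smul_zero],
      op_coface_zero_shuffleMul h h' _ (mem_relative_of_top hy), ih h' (op_mem_gr _ hα),
      ← integral_eq_integral_cone hx]
    simp

end Forms

/-! ### Maps of completed tensor products -/

namespace CTensor

variable {k : Type u} [Field k] {V W U : Type w} [AddCommGroup V] [Module k V] [AddCommGroup W]
  [Module k W] [AddCommGroup U] [Module k U] {M M' : Type v} [AddCommGroup M] [Module k M]
  [AddCommGroup M'] [Module k M'] {F : Filt k M} {F' : Filt k M'}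

/-- The map `v ⊗ x ↦ f v ⊗ x`. -/
abbrev mapLeft (F : Filt k M) (f : V →ₗ[k] W) : CTensor V F →ₗ[k] CTensor W F :=
  map f LinearMap.id fun _ => le_rfl

theorem mapLeft_level (f : V →ₗ[k] W) (z : CTensor V F) (a : ℕ) :
    (mapLeft F f z).1 a = f.rTensor (M ⧸ F.F a) (z.1 a) := by
  change TensorProduct.map f (Submodule.mapQ _ _ LinearMap.id _) (z.1 a) = _
  rw [Submodule.mapQ_id]
  rfl

theorem eval_level (f : V →ₗ[k] k) (z : CTensor V F) (a : ℕ) :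
    (eval f z).1 a = TensorProduct.lid k (M ⧸ F.F a) (f.rTensor (M ⧸ F.F a) (z.1 a)) := rfl

theorem mapLeft_mapLeft (f : V →ₗ[k] W) (g : W →ₗ[k] U) (z : CTensor V F) :
    mapLeft F g (mapLeft F f z) = mapLeft F (g ∘ₗ f) z := map_map ..

theorem mapLeft_id (z : CTensor V F) : mapLeft F LinearMap.id z = z := map_id z

theorem mapLeft_sub (f g : V →ₗ[k] W) (z : CTensor V F) :
    mapLeft F (f - g) z = mapLeft F f z - mapLeft F g z := by
  refine ext fun a => ?_
  change _ = (mapLeft F f z).1 a - (mapLeft F g z).1 a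
  simp only [mapLeft_level, LinearMap.rTensor_sub, LinearMap.sub_apply]

theorem mapLeft_eq_zero_of_eq_zero {f : V →ₗ[k] W} (h : ∀ v, f v = 0) (z : CTensor V F) :
    mapLeft F f z = 0 := by
  obtain rfl : f = 0 := LinearMap.ext h
  refine ext fun a => ?_
  rw [mapLeft_level, LinearMap.rTensor_zero]
  rfl

theorem eq_zero_of_subsingleton [Subsingleton V] (z : CTensor V F) : z = 0 := by
  rw [← mapLeft_id z]
  exact mapLeft_eq_zero_of_eq_zero (fun v => Subsingleton.elim _ _) z

/-- A linear map that vanishes on the common kernel of finitely many linear maps is a combination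
of these, so that the induced map of completed tensor products vanishes on the common kernel of the
induced maps. -/
theorem mapLeft_eq_zero {ι : Type*} [Finite ι] (B : ι → V →ₗ[k] W) (f : V →ₗ[k] k)
    (T : V →ₗ[k] U) (h : ∀ v, (∀ i, B i v = 0) → f v = 0 → T v = 0) {z : CTensor V F}
    (hB : ∀ i, mapLeft F (B i) z = 0) (hf : eval f z = 0) : mapLeft F T z = 0 := by
  have := Fintype.ofFinite ι
  classical
  obtain ⟨s, hs⟩ := Forms.exists_linear_section ((LinearMap.pi B).prod f) ⊤
    (LinearMap.range ((LinearMap.pi B).prod f)) (by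
      rintro _ ⟨x, rfl⟩
      exact ⟨x, Submodule.mem_top, rfl⟩)
  have hT : ∀ v, T v = ∑ i, T (s (Pi.single i (B i v), 0)) + f v • T (s (0, 1)) := by
    intro v
    have e := (hs _ ⟨v, rfl⟩).2
    have e' : T (s (LinearMap.pi B v, f v) - v) = 0 := by
      refine h _ (fun i => ?_) ?_
      · rw [map_sub, sub_eq_zero]
        exact congrFun (congrArg Prod.fst e) i
      · rw [map_sub, sub_eq_zero]
        exact congrArg Prod.snd e
    rw [map_sub, sub_eq_zero] at e'
    rw [← e', ← map_sum, ← map_sum, ← map_smul, ← map_smul, ← map_add, ← map_add]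
    congr 2
    ext i
    · simp [Prod.fst_sum]
    · simp [Prod.snd_sum]
  have hT' : T = ∑ i, (T ∘ₗ s ∘ₗ LinearMap.inl k _ _ ∘ₗ LinearMap.single k (fun _ => W) i) ∘ₗ B i +
      f.smulRight (T (s (0, 1))) := by
    ext v
    rw [hT v]
    simp
  refine ext fun a => ?_
  have h₁ : ∀ i, (B i).rTensor (M ⧸ F.F a) (z.1 a) = 0 := fun i => by
    rw [← mapLeft_level, hB i]; rfl
  have h₂ : ∀ u : U, (f.smulRight u).rTensor (M ⧸ F.F a) (z.1 a) = 0 := by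
    intro u
    have e₁ : (f.smulRight u) = (LinearMap.toSpanSingleton k U u) ∘ₗ f := by
      ext v; simp
    have e₂ : f.rTensor (M ⧸ F.F a) (z.1 a) = 0 := by
      apply (TensorProduct.lid k (M ⧸ F.F a)).injective
      rw [← eval_level, hf, map_zero]; rfl
    rw [e₁, LinearMap.rTensor_comp_apply, e₂, map_zero]
  rw [mapLeft_level, hT', LinearMap.rTensor_add, LinearMap.add_apply, h₂, add_zero,
    ← LinearMap.coe_rTensorHom, map_sum, LinearMap.sum_apply]
  refine Finset.sum_eq_zero fun i _ => ?_
  rw [LinearMap.coe_rTensorHom, LinearMap.rTensor_comp_apply, h₁, map_zero]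

/-- The map `V ⊗̂ M → M`, `v ⊗ x ↦ f v • x`, for complete `M`. -/
noncomputable def contractLeft (hF : Function.Bijective (toFiltLim F)) (f : V →ₗ[k] k) :
    CTensor V F →ₗ[k] M :=
  (LinearEquiv.ofBijective (toFiltLim F) hF).symm.toLinearMap ∘ₗ eval f

theorem toFiltLim_contractLeft (hF : Function.Bijective (toFiltLim F)) (f : V →ₗ[k] k)
    (z : CTensor V F) : toFiltLim F (contractLeft hF f z) = eval f z :=
  (LinearEquiv.ofBijective (toFiltLim F) hF).apply_symm_apply _

theorem mkQ_contractLeft (hF : Function.Bijective (toFiltLim F)) (f : V →ₗ[k] k)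
    (z : CTensor V F) (a : ℕ) : (F.F a).mkQ (contractLeft hF f z) =
      TensorProduct.lid k (M ⧸ F.F a) (f.rTensor (M ⧸ F.F a) (z.1 a)) :=
  congrFun (congrArg Subtype.val (toFiltLim_contractLeft hF f z)) a

theorem eq_of_mkQ (hF : Function.Bijective (toFiltLim F)) {x y : M}
    (h : ∀ a, (F.F a).mkQ x = (F.F a).mkQ y) : x = y :=
  hF.1 (Subtype.ext (funext h))

theorem contractLeft_tmul (hF : Function.Bijective (toFiltLim F)) (f : V →ₗ[k] k) (v : V) (x : M) :
    contractLeft hF f (tmul F v x) = f v • x := by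
  apply hF.1
  rw [toFiltLim_contractLeft, eval_tmul]

theorem contractLeft_map (hF : Function.Bijective (toFiltLim F))
    (hF' : Function.Bijective (toFiltLim F')) (f : V →ₗ[k] W) (g : M →ₗ[k] M')
    (hg : ∀ a, F.F a ≤ (F'.F a).comap g) (φ : W →ₗ[k] k) (z : CTensor V F) :
    contractLeft hF' φ (map f g hg z) = g (contractLeft hF (φ ∘ₗ f) z) := by
  refine eq_of_mkQ hF' fun a => ?_
  have : (F'.F a).mkQ (g (contractLeft hF (φ ∘ₗ f) z)) =
      (F.F a).mapQ (F'.F a) g (hg a) ((F.F a).mkQ (contractLeft hF (φ ∘ₗ f) z)) := rfl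
  rw [this, mkQ_contractLeft, mkQ_contractLeft]
  change TensorProduct.lid k _ (φ.rTensor _ (TensorProduct.map f ((F.F a).mapQ (F'.F a) g (hg a))
    (z.1 a))) = _
  induction z.1 a using TensorProduct.induction_on with
  | zero => simp
  | tmul v x => simp
  | add y z hy hz => simp only [map_add, hy, hz]

theorem contractLeft_sum (hF : Function.Bijective (toFiltLim F)) {ι : Type*} (s : Finset ι)
    (c : ι → k) (f : ι → V →ₗ[k] k) (z : CTensor V F) :
    contractLeft hF (∑ i ∈ s, c i • f i) z = ∑ i ∈ s, c i • contractLeft hF (f i) z := by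
  refine eq_of_mkQ hF fun a => ?_
  simp only [map_sum, map_smul, mkQ_contractLeft]
  induction z.1 a using TensorProduct.induction_on with
  | zero => simp
  | tmul v x => simp [Finset.sum_smul, mul_smul]
  | add y z hy hz => simp only [map_add, hy, hz, smul_add, Finset.sum_add_distrib]

end CTensor

namespace Forms

variable {k : Type u} [Field k] [CharZero k]

theorem gr_subsingleton {n p : ℕ} (h : n < p) :
    Subsingleton (gr k n p) :=
  ⟨fun x y => Subtype.ext
    ((eq_zero_of_mem_gr h x.2).trans (eq_zero_of_mem_gr h y.2).symm)⟩

theorem grIntegral_comp_grD (m : ℕ) :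
    grIntegral k (m + 1) ∘ₗ grD k (m + 1) m (m + 1) rfl =
      ∑ i : Fin (m + 2), (-1 : k) ^ i.1 •
        (grIntegral k m ∘ₗ grOp k (coface i) m) := by
  ext x
  simp only [LinearMap.sum_apply, LinearMap.smul_apply]
  exact integral_d x.2

end Forms

namespace CompleteDGLie

variable {k : Type u} [Field k] (L : CompleteDGLie.{u, v} k)

/-! ### Cocycles of degree zero -/

/-- The cocycle condition in degree zero, with all components in the form `Ω_n^p ⊗̂ L^{-p}`. -/
theorem mem_Z0_iff {n : ℕ} {ξ : L.Omega n 0} : ξ ∈ L.Z0 n ↔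
    L.dLie n 0 (-((0 : ℕ) : ℤ)) 1 (by simp) (L.comp0 ξ 0) = 0 ∧
    ∀ p : ℕ, L.dForm n p (p + 1) rfl (-p) (L.comp0 ξ p) + (-1 : k) ^ (p + 1) •
      L.dLie n (p + 1) (-((p + 1 : ℕ) : ℤ)) (-p) (by push_cast; ring) (L.comp0 ξ (p + 1)) = 0 := by
  rw [mem_Z0]
  constructor
  · intro H
    refine ⟨?_, fun p => ?_⟩
    · have := H 0 1 (by simp)
      rw [L.omegaDLie_eq ξ 0 1 (by simp) (by simp), pow_zero, one_smul] at this
      exact (zero_add _).symm.trans this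
    · have := H (p + 1) (-p) (by push_cast; ring)
      rwa [L.omegaDLie_eq ξ (p + 1) (-p) (by push_cast; ring) (by push_cast; ring)] at this
  · rintro ⟨H₀, H⟩ p i h
    cases p with
    | zero =>
      obtain rfl : i = 1 := by simpa using h
      rw [L.omegaDLie_eq ξ 0 1 (by simp) (by simp), H₀, smul_zero, add_zero]
      rfl
    | succ p =>
      obtain rfl : i = -p := by push_cast at h; omega
      rw [L.omegaDLie_eq ξ (p + 1) (-p) (by push_cast; ring) (by push_cast; ring)]
      exact H p

theorem comp0_omegaOp {m n : ℕ} (φ : Fin (m + 1) →o Fin (n + 1)) (ξ : L.Omega n 0) (p : ℕ) :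
    L.comp0 (L.omegaOp φ 0 ξ) p = CTensor.mapLeft _ (Forms.grOp k φ p) (L.comp0 ξ p) := rfl

/-- The map `Ω_n(L) → Ω_m(L)` in degree zero induced by a family of maps `Ω_n^p → Ω_m^p`. -/
def omegaMapLeft {m n : ℕ} (T : ∀ p, Forms.gr k n p →ₗ[k] Forms.gr k m p) (ξ : L.Omega n 0) :
    L.Omega m 0 := fun x => CTensor.mapLeft _ (T x.1.1) (ξ x)

theorem comp0_omegaMapLeft {m n : ℕ} (T : ∀ p, Forms.gr k n p →ₗ[k] Forms.gr k m p)
    (ξ : L.Omega n 0) (p : ℕ) :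
    L.comp0 (L.omegaMapLeft T ξ) p = CTensor.mapLeft _ (T p) (L.comp0 ξ p) := rfl

theorem omegaMapLeft_mem_Z0 {m n : ℕ} {T : ∀ p, Forms.gr k n p →ₗ[k] Forms.gr k m p}
    (hT : ∀ p x, Forms.grD k m p (p + 1) rfl (T p x) = T (p + 1) (Forms.grD k n p (p + 1) rfl x))
    {ξ : L.Omega n 0} (hξ : ξ ∈ L.Z0 n) : L.omegaMapLeft T ξ ∈ L.Z0 m := by
  rw [mem_Z0_iff] at *
  have e₁ : ∀ p i (z : L.Comp n p i), L.dForm m p (p + 1) rfl i (CTensor.mapLeft _ (T p) z) =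
      CTensor.mapLeft _ (T (p + 1)) (L.dForm n p (p + 1) rfl i z) := by
    intro p i z
    rw [dForm, dForm, CTensor.map_map, CTensor.map_map]
    have : Forms.grD k m p (p + 1) rfl ∘ₗ T p = T (p + 1) ∘ₗ Forms.grD k n p (p + 1) rfl :=
      LinearMap.ext (hT p)
    simp only [this]
  have e₂ : ∀ p i j h (z : L.Comp n p i), L.dLie m p i j h (CTensor.mapLeft _ (T p) z) =
      CTensor.mapLeft _ (T p) (L.dLie n p i j h z) := by
    intro p i j h z
    rw [dLie, dLie, CTensor.map_map, CTensor.map_map]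
    rfl
  refine ⟨?_, fun p => ?_⟩
  · rw [comp0_omegaMapLeft, e₂, hξ.1, map_zero]
  · rw [comp0_omegaMapLeft, comp0_omegaMapLeft, e₁, e₂, ← map_smul, ← map_add, hξ.2, map_zero]

/-- The element of degree zero of `Ω_n(L)` with a single component. -/
noncomputable def single {n : ℕ} (p : ℕ) (z : L.Comp n p (-p)) : L.Omega n 0 :=
  Pi.single ⟨(p, -p), add_neg_cancel _⟩ z

theorem comp0_single_same {n p : ℕ} (z : L.Comp n p (-p)) : L.comp0 (L.single p z) p = z :=
  Pi.single_eq_same _ _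

theorem comp0_single_ne {n p q : ℕ} (h : q ≠ p) (z : L.Comp n p (-p)) :
    L.comp0 (L.single p z) q = 0 :=
  Pi.single_eq_of_ne (fun e => h (congrArg (fun x => x.1.1) e)) _

theorem comp0_add {n : ℕ} (ξ η : L.Omega n 0) (p : ℕ) :
    L.comp0 (ξ + η) p = L.comp0 ξ p + L.comp0 η p := rfl

theorem single_zero_mem_Z0 {n : ℕ} {z : L.Comp n 0 (-((0 : ℕ) : ℤ))}
    (h₁ : L.dForm n 0 1 rfl _ z = 0) (h₂ : L.dLie n 0 _ 1 (by simp) z = 0) :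
    L.single 0 z ∈ L.Z0 n := by
  rw [mem_Z0_iff]
  refine ⟨by rw [comp0_single_same, h₂], fun p => ?_⟩
  rw [L.comp0_single_ne (Nat.succ_ne_zero p), map_zero, smul_zero, add_zero]
  cases p with
  | zero => rw [comp0_single_same]; exact h₁
  | succ p => rw [L.comp0_single_ne (Nat.succ_ne_zero p), map_zero]

theorem single_add_single_mem_Z0 {n m : ℕ} {z : L.Comp n (m + 1) (-((m + 1 : ℕ) : ℤ))}
    {z' : L.Comp n m (-m)} (h₁ : L.dForm n (m + 1) (m + 2) rfl _ z = 0)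
    (h₂ : L.dForm n m (m + 1) rfl _ z' + (-1 : k) ^ (m + 1) •
      L.dLie n (m + 1) _ (-m) (by push_cast; ring) z = 0)
    (h₃ : ∀ j h, L.dLie n m _ j h z' = 0) : L.single (m + 1) z + L.single m z' ∈ L.Z0 n := by
  rw [mem_Z0_iff]
  have h0 : ∀ p j h, L.dLie n p _ j h (L.comp0 (L.single m z') p) = 0 := by
    intro p j h
    by_cases e : p = m
    · subst e; rw [comp0_single_same, h₃]
    · rw [L.comp0_single_ne e, map_zero]
  refine ⟨?_, fun p => ?_⟩
  · rw [comp0_add, map_add, L.comp0_single_ne (Nat.succ_ne_zero m).symm, map_zero, h0]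
    exact add_zero _
  · rw [comp0_add, comp0_add, map_add, map_add, h0, add_zero]
    by_cases e : p = m
    · subst e
      rw [L.comp0_single_ne (Nat.lt_succ_self p).ne, map_zero, zero_add, comp0_single_same,
        comp0_single_same, h₂]
    · rw [L.comp0_single_ne e, map_zero, add_zero,
        L.comp0_single_ne fun e' => e (Nat.succ_injective e'), map_zero, smul_zero, add_zero]
      by_cases e' : p = m + 1
      · subst e'; rw [comp0_single_same, h₁]
      · rw [L.comp0_single_ne e', map_zero]

/-! ### The integration map is a morphism of dg Lie algebras -/

theorem integrate_eq (n : ℕ) (i : ℤ) :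
    L.integrate n i = CTensor.contractLeft (L.complete i) (Forms.grIntegral k n) := rfl

theorem integrate_eq_zero_iff {n : ℕ} {i : ℤ} {z : L.Comp n n i} :
    L.integrate n i z = 0 ↔ CTensor.eval (Forms.grIntegral k n) z = 0 :=
  (LinearEquiv.ofBijective (toFiltLim (L.filt i)) (L.complete i)).symm.map_eq_zero_iff

theorem integrateZ0_apply {n : ℕ} {i : ℤ} (h : (n : ℤ) + i = 0) (ξ : L.Z0 n) :
    L.integrateZ0 n i h ξ = (-1 : k) ^ n.choose 2 • L.integrate n i (ξ.1 ⟨(n, i), h⟩) := rfl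

/-- In degree zero, the integral of a cocycle is a cocycle of `L`, although `L` need not vanish in
negative homological degrees. -/
theorem d_integrateZ0_zero (ξ : L.Z0 0) {j : ℤ} (h : ((0 : ℕ) : ℤ) + 0 = 0) (hj : 0 + 1 = j) :
    L.d 0 j hj (L.integrateZ0 0 0 h ξ) = 0 := by
  have aux : ∀ (i : ℤ) (hi : i = -((0 : ℕ) : ℤ)) (h : ((0 : ℕ) : ℤ) + i = 0) (hj : i + 1 = j),
      L.d i j hj (L.integrateZ0 0 i h ξ) = 0 := by
    rintro _ rfl h hj
    obtain rfl : j = 1 := by simpa using hj.symm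
    have hd := (L.mem_Z0_iff.mp ξ.2).1
    rw [integrateZ0_apply, map_smul, integrate_eq]
    have := CTensor.contractLeft_map (L.complete (-((0 : ℕ) : ℤ))) (L.complete 1)
      LinearMap.id (L.d (-((0 : ℕ) : ℤ)) 1 hj) (fun a x hx => L.d_mem _ _ hj a x hx)
      (Forms.grIntegral k 0) (L.comp0 ξ.1 0)
    rw [LinearMap.comp_id] at this
    change _ • L.d _ _ hj (CTensor.contractLeft _ _ (L.comp0 ξ.1 0)) = 0
    rw [← this]
    change _ • CTensor.contractLeft _ _ (L.dLie 0 0 _ 1 hj (L.comp0 ξ.1 0)) = 0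
    rw [hd, map_zero, smul_zero]
  exact aux 0 (by simp) h hj

variable [CharZero k]

/-- Stokes' theorem for an element of `Z^0 Ω_{m+1}(L)` whose faces, except for the one opposite to
the vertex `0`, vanish. -/
theorem integrateZ0_face_zero {m : ℕ} {i j : ℤ} (h : ((m + 1 : ℕ) : ℤ) + i = 0)
    (h' : (m : ℤ) + j = 0) (hij : i + 1 = j) {ξ : L.Z0 (m + 1)}
    (hξ : ξ ∈ L.simplicial.normalized (m + 1)) :
    L.integrateZ0 m j h' (L.simplicial.face 0 ξ) =
      L.d i j hij (L.integrateZ0 (m + 1) i h ξ) := by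
  obtain rfl : j = -m := by omega
  obtain rfl : i = -((m + 1 : ℕ) : ℤ) := by omega
  have hf : ∀ i : Fin (m + 1), CTensor.mapLeft (L.filt (-m)) (Forms.grOp k (Forms.coface i.succ) m)
      (L.comp0 ξ.1 m) = 0 := fun i =>
    congrArg (fun η : L.Z0 m => L.comp0 η.1 m) (L.simplicial.mem_normalized_succ.mp hξ i)
  have hd := eq_neg_of_add_eq_zero_right ((L.mem_Z0_iff.mp ξ.2).2 m)
  have hd' : L.dLie (m + 1) (m + 1) (-((m + 1 : ℕ) : ℤ)) (-m) hij (L.comp0 ξ.1 (m + 1)) =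
      (-1 : k) ^ m • L.dForm (m + 1) m (m + 1) rfl (-m) (L.comp0 ξ.1 m) := by
    have e : (-1 : k) ^ (m + 1) * (-1) ^ (m + 1) = 1 := by rw [← mul_pow]; simp
    have := congrArg (fun z => (-1 : k) ^ (m + 1) • z) hd
    rw [smul_smul, e, one_smul, smul_neg, ← neg_smul] at this
    rw [this, pow_succ, mul_neg_one, neg_neg]
  have h₁ : L.d _ _ hij (L.integrate (m + 1) (-((m + 1 : ℕ) : ℤ)) (L.comp0 ξ.1 (m + 1))) =
      L.integrate (m + 1) (-m)
        (L.dLie (m + 1) (m + 1) (-((m + 1 : ℕ) : ℤ)) (-m) hij (L.comp0 ξ.1 (m + 1))) := by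
    rw [integrate_eq, integrate_eq, dLie, CTensor.contractLeft_map (L.complete _)]
    rfl
  have h₂ : L.integrate (m + 1) (-m) (L.dForm (m + 1) m (m + 1) rfl (-m) (L.comp0 ξ.1 m)) =
      L.integrate m (-m) (CTensor.mapLeft _ (Forms.grOp k (Forms.coface 0) m) (L.comp0 ξ.1 m)) := by
    rw [integrate_eq, dForm, CTensor.contractLeft_map (L.complete _), LinearMap.id_apply,
      Forms.grIntegral_comp_grD, CTensor.contractLeft_sum, Fin.sum_univ_succ,
      Finset.sum_eq_zero fun i _ => ?_, add_zero]
    · rw [integrate_eq, CTensor.contractLeft_map (L.complete _)]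
      simp
    · have := CTensor.contractLeft_map (L.complete (-m)) (L.complete (-m))
        (Forms.grOp k (Forms.coface i.succ) m) LinearMap.id (fun _ => le_rfl)
        (Forms.grIntegral k m) (L.comp0 ξ.1 m)
      rw [LinearMap.id_apply] at this
      rw [← this, hf, map_zero, smul_zero]
  rw [integrateZ0_apply, map_smul]
  change (-1 : k) ^ m.choose 2 • L.integrate m (-m)
    (CTensor.mapLeft _ (Forms.grOp k (Forms.coface 0) m) (L.comp0 ξ.1 m)) =
    (-1 : k) ^ (m + 1).choose 2 • L.d _ _ hij
      (L.integrate (m + 1) (-((m + 1 : ℕ) : ℤ)) (L.comp0 ξ.1 (m + 1)))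
  have hs : (-1 : k) ^ (m + 1).choose 2 * (-1) ^ m = (-1) ^ m.choose 2 := by
    rw [Nat.choose_succ_succ' m 1, Nat.choose_one_right, pow_add, mul_right_comm, ← mul_pow]
    simp
  rw [h₁, hd', map_smul, h₂, smul_smul, hs]

theorem I_apply {i : ℤ} (hi : i ≤ 0) (x : L.NL.X i) :
    L.I i x = L.integrateZ0 (-i).toNat i (by omega) x.1 := by
  rw [I, dif_pos hi]
  rfl

theorem I_d (i j : ℤ) (h : i + 1 = j) (x : L.NL.X i) :
    L.I j (L.NL.d i j h x) = L.d i j h (L.I i x) := by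
  rcases lt_trichotomy i 0 with hi | rfl | hi
  · obtain ⟨m, hm⟩ : ∃ m : ℕ, (-j).toNat = m := ⟨_, rfl⟩
    have hn : (-i).toNat = m + 1 := by omega
    rw [L.I_apply hi.le]
    refine (L.I_apply (by omega) _).trans ((congrArg (L.integrateZ0 (-j).toNat j (by omega))
      (L.simplicial.N_d_coe h hi x)).trans ?_)
    have hx := L.simplicial.N_mem hi.le x
    revert hx
    generalize_proofs p₁ p₂ p₃
    generalize (x.1 : L.simplicial.obj (-i).toNat) = y
    revert y p₁ p₂ p₃
    generalize (-i).toNat = n at *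
    generalize (-j).toNat = m' at *
    subst hn hm
    intro p₁ p₂ p₃ y hy
    rw [L.simplicial.boundary_eq_face _ hy]
    exact L.integrateZ0_face_zero _ _ h hy
  · have : Subsingleton (L.NL.X j) := L.simplicial.N_subsingleton (by omega)
    rw [Subsingleton.elim (L.NL.d 0 j h x) 0, map_zero, L.I_apply le_rfl]
    exact (L.d_integrateZ0_zero x.1 _ h).symm
  · have : Subsingleton (L.NL.X i) := L.simplicial.N_subsingleton hi
    rw [Subsingleton.elim x 0, map_zero, map_zero, map_zero, map_zero]

/-- The component of a shuffle summand of the bracket in the top degree `r = p + q`. -/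
theorem comp0_omegaBracket_top {p q r : ℕ} (h : p + q = r) (g : -(p : ℤ) + -q = -r)
    (φ : Fin (r + 1) →o Fin (p + 1)) (ψ : Fin (r + 1) →o Fin (q + 1)) (ξ : L.Omega p 0)
    (η : L.Omega q 0) :
    L.comp0 (L.omegaBracket r (L.omegaOp φ 0 ξ) (L.omegaOp ψ 0 η)) r =
      (-1 : k) ^ (p * q) • L.compMul r p q r h (-p) (-q) (-r) g
        (CTensor.mapLeft _ (Forms.grOp k φ p) (L.comp0 ξ p))
        (CTensor.mapLeft _ (Forms.grOp k ψ q) (L.comp0 η q)) := by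
  rw [comp0_bracket, sumAntidiag]
  rw [Fintype.sum_eq_single ⟨(p, q), Finset.HasAntidiagonal.mem_antidiagonal.mpr h⟩]
  · rfl
  · rintro ⟨⟨p', q'⟩, e⟩ hne
    have e' := Finset.HasAntidiagonal.mem_antidiagonal.mp e
    dsimp only at e' ⊢
    rw [comp0_omegaOp, comp0_omegaOp]
    rcases lt_trichotomy p p' with hp | rfl | hp
    · have := Forms.gr_subsingleton (k := k) hp
      rw [CTensor.eq_zero_of_subsingleton (L.comp0 ξ p'), map_zero, map_zero,
        LinearMap.zero_apply, smul_zero]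
    · obtain rfl : q' = q := by omega
      exact absurd rfl hne
    · have := Forms.gr_subsingleton (k := k) (show q < q' by omega)
      rw [CTensor.eq_zero_of_subsingleton (L.comp0 η q'), map_zero, map_zero, smul_zero]

/-- The multiplicativity of the integral under shuffle products, with coefficients in `L`. -/
theorem sum_integrate_compMul {p q r : ℕ} (h : p + q = r) {i j l : ℤ} (g : i + j = l)
    (x : L.Comp p p i) (y : L.Comp q q j) :
    ∑ σ : Equiv.Perm (Fin r) with IsShuffle p σ, (Equiv.Perm.sign σ : ℤ) •
      L.integrate r l (L.compMul r p q r h i j l g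
        (CTensor.mapLeft _ (Forms.grOp k (stepMap (shuffleFst p σ) (card_shuffleFst h σ)) p) x)
        (CTensor.mapLeft _ (Forms.grOp k (stepMap (shuffleSnd p σ) (card_shuffleSnd h σ)) q) y)) =
      L.bracket i j l g (L.integrate p i x) (L.integrate q j y) := by
  refine CTensor.eq_of_mkQ (L.complete l) fun A => ?_
  have hb : ∀ (a : L.X i) (b : L.X j), ((L.filt l).F A).mkQ (L.bracket i j l g a b) =
      CTensor.quotBilin (L.bracket i j l g) A (fun x hx y => L.bracket_mem_left g A x hx y)
          (fun x y hy => L.bracket_mem_right g A x y hy) (((L.filt i).F A).mkQ a)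
            (((L.filt j).F A).mkQ b) := fun _ _ => rfl
  rw [hb, integrate_eq, integrate_eq, integrate_eq, map_sum]
  simp only [map_zsmul, CTensor.mkQ_contractLeft, compMul_level, CTensor.mapLeft_level]
  induction x.1 A using TensorProduct.induction_on with
  | zero => simp
  | add x x' hx hx' =>
    simp only [map_add, LinearMap.add_apply, ← hx, ← hx', smul_add, Finset.sum_add_distrib]
  | tmul ω x =>
    induction y.1 A using TensorProduct.induction_on with
    | zero => simp
    | add y y' hy hy' =>
      simp only [map_add, ← hy, ← hy', smul_add, Finset.sum_add_distrib]
    | tmul η y =>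
      simp only [LinearMap.rTensor_tmul, TensorProduct.map₂_apply_tmul, TensorProduct.map_tmul,
        TensorProduct.lid_tmul,
        map_smul, LinearMap.smul_apply, ← smul_assoc, ← Finset.sum_smul]
      congr 1
      have e := Forms.integral_shuffleMul h ω.2 η.2
      rw [Forms.shuffleMul, map_sum] at e
      rw [smul_eq_mul]
      refine Eq.trans ?_ (e.trans (mul_comm _ _))
      refine Finset.sum_congr rfl fun σ _ => ?_
      rw [map_zsmul]
      rfl

theorem choose_add_two (p q : ℕ) : (p + q).choose 2 = p.choose 2 + q.choose 2 + p * q := by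
  induction q with
  | zero => simp
  | succ q ih =>
    rw [← add_assoc, Nat.choose_succ_succ' (p + q) 1, Nat.choose_succ_succ' q 1, ih,
      Nat.choose_one_right, Nat.choose_one_right]
    ring

theorem integrateZ0_shuffleBracket {p q r : ℕ} (h : p + q = r) {i j l : ℤ} (hi : (p : ℤ) + i = 0)
    (hj : (q : ℤ) + j = 0) (hl : (r : ℤ) + l = 0) (g : i + j = l) (ξ : L.Z0 p)
    (η : L.Z0 q) :
    L.integrateZ0 r l hl (L.simplicial.shuffleBracket p q r h ξ η) =
      L.bracket i j l g (L.integrateZ0 p i hi ξ) (L.integrateZ0 q j hj η) := by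
  obtain rfl : i = -p := by omega
  obtain rfl : j = -q := by omega
  obtain rfl : l = -r := by omega
  refine Eq.trans (map_sum (L.integrateZ0 r (-r) hl) _ _) ?_
  rw [L.integrateZ0_apply hi, L.integrateZ0_apply hj, map_smul, map_smul, LinearMap.smul_apply]
  change _ = _ • _ • L.bracket _ _ _ g (L.integrate p (-p) (L.comp0 ξ.1 p))
    (L.integrate q (-q) (L.comp0 η.1 q))
  rw [← L.sum_integrate_compMul h g, Finset.smul_sum, Finset.smul_sum]
  refine Finset.sum_congr rfl fun σ _ => ?_
  refine Eq.trans (map_zsmul (L.integrateZ0 r (-r) hl) _ _) ?_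
  change (_ : ℤ) • (-1 : k) ^ r.choose 2 • L.integrate r (-r) (L.comp0 (L.omegaBracket r (L.omegaOp _ 0 ξ.1)
    (L.omegaOp _ 0 η.1)) r) = _
  rw [L.comp0_omegaBracket_top h g, map_smul,
    smul_comm _ (Equiv.Perm.sign σ : ℤ), smul_comm _ (Equiv.Perm.sign σ : ℤ)]
  congr 1
  rw [smul_smul, smul_smul]
  congr 1
  rw [← h, choose_add_two, pow_add, pow_add]
  have e : (-1 : k) ^ (p * q) * (-1) ^ (p * q) = 1 := by rw [← mul_pow]; simp
  linear_combination ((-1 : k) ^ p.choose 2 * (-1) ^ q.choose 2) * e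

theorem I_bracket (i j l : ℤ) (h : i + j = l) (x : L.NL.X i) (y : L.NL.X j) :
    L.I l (L.NL.bracket i j l h x y) = L.bracket i j l h (L.I i x) (L.I j y) := by
  rcases le_or_gt i 0 with hi | hi
  · rcases le_or_gt j 0 with hj | hj
    · rw [L.I_apply hi, L.I_apply hj]
      refine (L.I_apply (by omega) _).trans ((congrArg (L.integrateZ0 (-l).toNat l (by omega))
        (L.simplicial.N_bracket_coe h hi hj x y)).trans ?_)
      exact L.integrateZ0_shuffleBracket _ _ _ _ h _ _
    · have : Subsingleton (L.NL.X j) := L.simplicial.N_subsingleton hj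
      rw [Subsingleton.elim y 0, map_zero, map_zero, map_zero, map_zero]
  · have : Subsingleton (L.NL.X i) := L.simplicial.N_subsingleton hi
    rw [Subsingleton.elim x 0, map_zero, map_zero, map_zero, LinearMap.zero_apply,
      LinearMap.zero_apply, map_zero]

theorem I_isHom : DGLieData.IsHom L.NL L.toDGLieData L.I where
  map_d := L.I_d
  map_bracket := L.I_bracket

/-- The naturality of the integration map. -/
theorem Hom.I_mapNL {L L' : CompleteDGLie.{u, v} k} (f : Hom L L') (i : ℤ) (x : L.NL.X i) :
    L'.I i (f.mapNL i x) = f.f i (L.I i x) := by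
  rcases le_or_gt i 0 with hi | hi
  · rw [L.I_apply hi]
    refine (L'.I_apply hi _).trans ?_
    change (-1 : k) ^ _ • L'.integrate _ i _ = f.f i ((-1 : k) ^ _ • L.integrate _ i _)
    rw [map_smul]
    refine congrArg _ ?_
    exact CTensor.contractLeft_map (L.complete i) (L'.complete i) LinearMap.id (f.f i)
      (fun a y hy => f.map_filt _ a y hy) (Forms.grIntegral k _) _
  · have : Subsingleton (L.NL.X i) := L.simplicial.N_subsingleton hi
    rw [Subsingleton.elim x 0, map_zero, map_zero, map_zero, map_zero]

end CompleteDGLie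

namespace Forms

variable {k : Type u} [Field k] [CharZero k]

theorem exists_grIntegral_eq_one (n : ℕ) : ∃ ω : gr k n n, grIntegral k n ω = 1 := by
  have hn : (n.factorial : k) ≠ 0 := Nat.cast_ne_zero.mpr n.factorial_ne_zero
  refine ⟨(n.factorial : k) • ⟨vol k n, vol_mem_gr⟩, ?_⟩
  have h := integral_mul_vol (k := k) (n := n) one_mem_polys
  have hp := polyIntegral_monomial (k := k) (n := n) 0
  have h1 : (MvPolynomial.monomial (0 : Fin n →₀ ℕ) (1 : k)) = 1 := rfl
  rw [one_mul, map_one (toPoly k n), ← h1, hp] at h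
  rw [map_smul]
  refine Eq.trans (congrArg _ h) ?_
  simp [hn]

end Forms

theorem SimplicialLieAlgebra.mem_normalized_zero {k : Type u} [Field k]
    (X : SimplicialLieAlgebra.{u, w} k) (x : X.obj 0) : x ∈ X.normalized 0 := Submodule.mem_top

namespace CompleteDGLie

variable {k : Type u} [Field k] (L : CompleteDGLie.{u, v} k)

/-! ### Surjectivity of integration -/

theorem mapLeft_comp0_single {n n' p : ℕ} (f : ∀ p, Forms.gr k n p →ₗ[k] Forms.gr k n' p)
    {z : L.Comp n p (-p)} (h : CTensor.mapLeft _ (f p) z = 0) (q : ℕ) :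
    CTensor.mapLeft _ (f q) (L.comp0 (L.single p z) q) = 0 := by
  by_cases e : q = p
  · subst e; rw [comp0_single_same, h]
  · rw [L.comp0_single_ne e, map_zero]

theorem tmul_zero_left {n p : ℕ} {i : ℤ} (x : L.X i) :
    CTensor.tmul (L.filt i) (0 : Forms.gr k n p) x = 0 :=
  CTensor.ext fun _ => TensorProduct.zero_tmul _ _

theorem tmul_zero_right {n p : ℕ} {i : ℤ} (ω : Forms.gr k n p) :
    CTensor.tmul (L.filt i) ω (0 : L.X i) = 0 :=
  CTensor.ext fun _ => TensorProduct.tmul_zero _ _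

/-- A linear functional on `Ω_n^p` that is the integral for `p = n`, and zero otherwise. -/
noncomputable def topIntegral (k : Type u) [Field k] (n p : ℕ) : Forms.gr k n p →ₗ[k] k :=
  if p = n then Forms.integral k n ∘ₗ (Forms.gr k n p).subtype else 0

theorem topIntegral_eq_zero {n p : ℕ} {v : Forms.gr k n p} (hv : topIntegral k n p v = 0)
    (e : p = n) : Forms.integral k n v.1 = 0 := by
  rwa [topIntegral, if_pos e] at hv

variable [CharZero k]

/-- In positive degrees `I` is surjective on chains, with preimages of cycles being cycles. -/
theorem exists_integrateZ0_eq_succ {m : ℕ} {i : ℤ} (h : ((m + 1 : ℕ) : ℤ) + i = 0) (w : L.X i) :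
    ∃ ξ : L.Z0 (m + 1), ξ ∈ L.simplicial.normalized (m + 1) ∧
      L.integrateZ0 (m + 1) i h ξ = w ∧
      ((∀ j hj, L.d i j hj w = 0) → L.simplicial.face 0 ξ = 0) := by
  obtain rfl : i = -((m + 1 : ℕ) : ℤ) := by omega
  obtain ⟨ω, hω⟩ := Forms.exists_grIntegral_eq_one (k := k) (m + 1)
  have hj : -((m + 1 : ℕ) : ℤ) + 1 = -m := by push_cast; ring
  -- `ξ = ± (ω ⊗ w ± α ⊗ dw)`, where `ω` has integral one and `α` is the cone of `ω`.
  let c : k := (-1) ^ (m + 1).choose 2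
  let α : Forms.gr k (m + 1) m := ⟨Forms.cone k (m + 1) ω.1, Forms.cone_mem_gr ω.2⟩
  have hα : Forms.grD k (m + 1) m (m + 1) rfl α = ω := Subtype.ext (Forms.d_cone_of_top ω.2)
  let z : L.Comp (m + 1) (m + 1) (-((m + 1 : ℕ) : ℤ)) := CTensor.tmul _ ω (c • w)
  let z' : L.Comp (m + 1) m (-m) := (-1 : k) ^ m • CTensor.tmul _ α (L.d _ _ hj (c • w))
  have h₁ : L.dForm (m + 1) (m + 1) (m + 2) rfl _ z = 0 := by
    have := Forms.gr_subsingleton (k := k) (Nat.lt_succ_self (m + 1))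
    exact CTensor.eq_zero_of_subsingleton _
  have h₂ : L.dForm (m + 1) m (m + 1) rfl _ z' + (-1 : k) ^ (m + 1) •
      L.dLie (m + 1) (m + 1) _ (-m) hj z = 0 := by
    have e₁ : L.dForm (m + 1) m (m + 1) rfl (-m) (CTensor.tmul _ α (L.d _ _ hj (c • w))) =
        CTensor.tmul _ ω (L.d _ _ hj (c • w)) := by
      rw [dForm, CTensor.map_tmul, hα]
      rfl
    have e₂ : L.dLie (m + 1) (m + 1) _ (-m) hj z = CTensor.tmul _ ω (L.d _ _ hj (c • w)) := rfl
    rw [map_smul, e₁, e₂, ← add_smul, pow_succ]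
    simp
  have h₃ : ∀ j h, L.dLie (m + 1) m (-m) j h z' = 0 := by
    intro j h
    rw [map_smul]
    refine smul_eq_zero_of_right _ ?_
    rw [dLie, CTensor.map_tmul, L.isDGLie.d_d, tmul_zero_right]
  have hz : ∀ i : Fin (m + 2), CTensor.mapLeft _ (Forms.grOp k (Forms.coface i) (m + 1)) z = 0 := by
    intro i
    have := Forms.gr_subsingleton (k := k) (Nat.lt_succ_self m)
    exact CTensor.eq_zero_of_subsingleton _
  have hface : ∀ i : Fin (m + 2), CTensor.mapLeft _ (Forms.grOp k (Forms.coface i) m) z' = 0 →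
      L.simplicial.face i ⟨L.single (m + 1) z + L.single m z',
        L.single_add_single_mem_Z0 h₁ h₂ h₃⟩ = 0 := by
    intro i hi
    refine Subtype.ext (L.omega_ext fun p => ?_)
    change CTensor.mapLeft _ (Forms.grOp k (Forms.coface i) p)
      (L.comp0 (L.single (m + 1) z + L.single m z') p) = 0
    rw [comp0_add, map_add, L.mapLeft_comp0_single (Forms.grOp k (Forms.coface i)) (hz i),
      L.mapLeft_comp0_single (Forms.grOp k (Forms.coface i)) hi, add_zero]
  refine ⟨⟨L.single (m + 1) z + L.single m z', L.single_add_single_mem_Z0 h₁ h₂ h₃⟩, ?_, ?_, ?_⟩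
  · refine L.simplicial.mem_normalized_succ.mpr fun i => hface i.succ ?_
    have : Forms.grOp k (Forms.coface i.succ) m α = 0 := Subtype.ext (by
      rw [Forms.grOp_coe, Forms.op_cone (Forms.coface_succ_zero i),
        Forms.op_coface_eq_zero_of_top ω.2, map_zero]
      rfl)
    rw [map_smul, CTensor.map_tmul, this, tmul_zero_left, smul_zero]
  · rw [integrateZ0_apply]
    change c • L.integrate (m + 1) _ (L.comp0 (L.single (m + 1) z + L.single m z') (m + 1)) = w
    rw [comp0_add, comp0_single_same, L.comp0_single_ne (Nat.lt_succ_self m).ne', add_zero,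
      integrate_eq, CTensor.contractLeft_tmul, hω, one_smul, smul_smul, ← mul_pow]
    simp
  · intro hw
    refine hface 0 ?_
    rw [map_smul, CTensor.map_tmul, map_smul, hw, smul_zero, map_zero, tmul_zero_right, smul_zero]

theorem exists_integrateZ0_eq_zero {i : ℤ} (h : ((0 : ℕ) : ℤ) + i = 0) (w : L.X i)
    (hw : ∀ j hj, L.d i j hj w = 0) : ∃ ξ : L.Z0 0, L.integrateZ0 0 i h ξ = w := by
  obtain rfl : i = -((0 : ℕ) : ℤ) := by omega
  obtain ⟨ω, hω⟩ := Forms.exists_grIntegral_eq_one (k := k) 0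
  have h₁ : L.dForm 0 0 1 rfl _ (CTensor.tmul (L.filt (-((0 : ℕ) : ℤ))) ω w) = 0 := by
    have := Forms.gr_subsingleton (k := k) Nat.zero_lt_one
    exact CTensor.eq_zero_of_subsingleton _
  refine ⟨⟨L.single 0 (CTensor.tmul _ ω w), L.single_zero_mem_Z0 h₁ ?_⟩, ?_⟩
  · rw [dLie, CTensor.map_tmul, hw, tmul_zero_right]
  · rw [integrateZ0_apply]
    have e := L.comp0_single_same (CTensor.tmul (L.filt (-((0 : ℕ) : ℤ))) ω w)
    refine (congrArg (fun z => (-1 : k) ^ Nat.choose 0 2 • L.integrate 0 _ z) e).trans ?_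
    rw [integrate_eq, CTensor.contractLeft_tmul, hω, one_smul]
    simp

/-- Every cycle of `L` in non-negative homological degree is the integral of a normalized cycle. -/
theorem exists_cycle_integrateZ0_eq {n : ℕ} {i : ℤ} (h : (n : ℤ) + i = 0) (w : L.X i)
    (hw : ∀ j hj, L.d i j hj w = 0) : ∃ ξ : L.Z0 n, ξ ∈ L.simplicial.normalized n ∧
      (∀ m e, L.simplicial.boundary n m e ξ = 0) ∧ L.integrateZ0 n i h ξ = w := by
  cases n with
  | zero =>
    obtain ⟨ξ, hξ⟩ := L.exists_integrateZ0_eq_zero h w hw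
    exact ⟨ξ, L.simplicial.mem_normalized_zero ξ, fun m e => absurd e (by omega), hξ⟩
  | succ m =>
    obtain ⟨ξ, hξ, hi, hf⟩ := L.exists_integrateZ0_eq_succ h w
    refine ⟨ξ, hξ, fun m' e => ?_, hi⟩
    obtain rfl : m = m' := by omega
    exact (L.simplicial.boundary_eq_face e hξ).trans (hf hw)

/-! ### Cycles with integral zero -/

/-- If the components of `ξ` are killed by all linear maps that vanish on the forms with zero
boundary values and zero integral, then `ξ` behaves like such a form, and its extension to `Δ^{n+1}`
is a normalized chain with boundary `ξ`. -/
theorem exists_boundary_eq_of_mapLeft_eq_zero {n : ℕ} {ξ : L.Z0 n}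
    (key : ∀ p (T : Forms.gr k n p →ₗ[k] Forms.gr k n p),
      (∀ v ∈ Forms.relativeZero k n p, T v = 0) → CTensor.mapLeft _ T (L.comp0 ξ.1 p) = 0) :
    ∃ η : L.Z0 (n + 1), η ∈ L.simplicial.normalized (n + 1) ∧
      L.simplicial.boundary (n + 1) n rfl η = ξ := by
  obtain ⟨T, hT, hT'⟩ := Forms.exists_chain_extension (k := k) n
  let η : L.Z0 (n + 1) := ⟨L.omegaMapLeft T ξ.1, L.omegaMapLeft_mem_Z0 hT ξ.2⟩
  have hη : η ∈ L.simplicial.normalized (n + 1) := by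
    refine L.simplicial.mem_normalized_succ.mpr fun i => Subtype.ext (L.omega_ext fun p => ?_)
    change CTensor.mapLeft _ (Forms.grOp k (Forms.coface i.succ) p)
      (CTensor.mapLeft _ (T p) (L.comp0 ξ.1 p)) = 0
    rw [CTensor.mapLeft_mapLeft]
    exact key p _ fun v hv => (hT' p v hv).2 i
  refine ⟨η, hη, (L.simplicial.boundary_eq_face rfl hη).trans ?_⟩
  refine Subtype.ext (L.omega_ext fun p => ?_)
  change CTensor.mapLeft _ (Forms.grOp k (Forms.coface 0) p)
    (CTensor.mapLeft _ (T p) (L.comp0 ξ.1 p)) = L.comp0 ξ.1 p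
  have := key p (Forms.grOp k (Forms.coface 0) p ∘ₗ T p - LinearMap.id) fun v hv => by
    rw [LinearMap.sub_apply, LinearMap.comp_apply, (hT' p v hv).1, LinearMap.id_apply, sub_self]
  rwa [CTensor.mapLeft_sub, CTensor.mapLeft_id, sub_eq_zero, ← CTensor.mapLeft_mapLeft] at this

theorem eval_topIntegral {n : ℕ} {i : ℤ} {h : (n : ℤ) + i = 0} {ξ : L.Z0 n}
    (hi : L.integrateZ0 n i h ξ = 0) (p : ℕ) :
    CTensor.eval (topIntegral k n p) (L.comp0 ξ.1 p) = 0 := by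
  obtain rfl : i = -n := by omega
  by_cases e : p = n
  · subst e
    rw [topIntegral, if_pos rfl]
    rw [integrateZ0_apply] at hi
    exact L.integrate_eq_zero_iff.mp
      ((smul_eq_zero.mp hi).resolve_left (pow_ne_zero _ (neg_ne_zero.mpr one_ne_zero)))
  · rw [topIntegral, if_neg e]
    refine Subtype.ext (funext fun a => ?_)
    rw [CTensor.eval_level, LinearMap.rTensor_zero]
    simp

/-- A normalized cycle with integral zero is a boundary. -/
theorem exists_boundary_eq_of_integrateZ0_eq_zero {n : ℕ} {i : ℤ} {h : (n : ℤ) + i = 0}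
    {ξ : L.Z0 n} (hξ : ξ ∈ L.simplicial.normalized n)
    (hd : ∀ m e, L.simplicial.boundary n m e ξ = 0) (hi : L.integrateZ0 n i h ξ = 0) :
    ∃ η : L.Z0 (n + 1), η ∈ L.simplicial.normalized (n + 1) ∧
      L.simplicial.boundary (n + 1) n rfl η = ξ := by
  refine L.exists_boundary_eq_of_mapLeft_eq_zero fun p T hT => ?_
  cases n with
  | zero =>
    exact CTensor.mapLeft_eq_zero (fun _ : Empty => LinearMap.id) (topIntegral k 0 p) T
      (fun v _ hv => hT v ⟨Submodule.mem_top, topIntegral_eq_zero hv⟩) (fun i => i.elim)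
      (L.eval_topIntegral hi p)
  | succ m =>
    have hf : ∀ i, L.simplicial.face i ξ = 0 := Fin.cases
      ((L.simplicial.boundary_eq_face rfl hξ).symm.trans (hd m rfl))
      (L.simplicial.mem_normalized_succ.mp hξ)
    refine CTensor.mapLeft_eq_zero (fun i => Forms.grOp k (Forms.coface i) p)
      (topIntegral k (m + 1) p) T (fun v hv hv' => hT v ⟨Forms.mem_relative_succ.mpr fun i => ?_,
        topIntegral_eq_zero hv'⟩) (fun i => ?_) (L.eval_topIntegral hi p)
    · exact congrArg Subtype.val (hv i)
    · exact congrArg (fun η : L.Z0 m => L.comp0 η.1 p) (hf i)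

/-- A normalized cycle whose integral is a boundary in `L` is a boundary: subtracting the boundary of
a chain with prescribed integral makes its integral zero. -/
theorem exists_boundary_eq {n N : ℕ} (e : N = n + 1) {i j : ℤ} (h : (n : ℤ) + i = 0)
    (hj : j + 1 = i) {ξ : L.Z0 n} (hξ : ξ ∈ L.simplicial.normalized n)
    (hd : ∀ m e, L.simplicial.boundary n m e ξ = 0) (w : L.X j)
    (hi : L.integrateZ0 n i h ξ = L.d j i hj w) :
    ∃ η : L.Z0 N, η ∈ L.simplicial.normalized N ∧ L.simplicial.boundary N n e η = ξ := by
  subst e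
  obtain ⟨u, hu, hui, -⟩ := L.exists_integrateZ0_eq_succ (m := n) (i := j)
    (by push_cast; omega) w
  let ζ : L.Z0 n := L.simplicial.boundary (n + 1) n rfl u
  have hζ : ζ ∈ L.simplicial.normalized n := L.simplicial.boundary_mem rfl hu
  have hζi : L.integrateZ0 n i h ζ = L.d j i hj w := by
    rw [← hui]
    refine (congrArg (L.integrateZ0 n i h) (L.simplicial.boundary_eq_face rfl hu)).trans ?_
    exact L.integrateZ0_face_zero _ _ _ hu
  obtain ⟨η, hη, hηξ⟩ := L.exists_boundary_eq_of_integrateZ0_eq_zero (h := h)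
    (show ξ - ζ ∈ L.simplicial.normalized n from sub_mem hξ hζ)
    (fun m e => ((L.simplicial.boundary n m e).map_sub ξ ζ).trans (by
      rw [hd, L.simplicial.boundary_boundary rfl e hu, sub_zero]))
    (by rw [map_sub, hi, hζi, sub_self])
  refine ⟨η + u, add_mem hη hu, ?_⟩
  refine ((L.simplicial.boundary (n + 1) n rfl).map_add η u).trans ?_
  rw [hηξ]
  exact sub_add_cancel ξ ζ

/-! ### The map in homology -/

theorem injective_mapH {i : ℤ} (hi : i ≤ 0) : Function.Injective (L.I_isHom.mapH i) := by
  rw [injective_iff_map_eq_zero]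
  intro x hx
  obtain ⟨⟨x, hxd⟩, rfl⟩ := Submodule.Quotient.mk_surjective _ x
  have hxd' : L.NL.d i (i + 1) rfl x = 0 := hxd
  obtain ⟨w, hw⟩ := (Submodule.Quotient.mk_eq_zero _).mp hx
  have hw' : L.I i x = L.d (i - 1) i (sub_add_cancel i 1) w := hw.symm
  rw [L.I_apply hi] at hw'
  obtain ⟨η, hη, hηx⟩ := L.exists_boundary_eq (N := (-(i - 1)).toNat) (by omega) _ _
    (L.simplicial.N_mem hi x) (fun m e => by
      obtain rfl : m = (-(i + 1)).toNat := by omega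
      refine (L.simplicial.N_d_coe rfl (by omega) x).symm.trans ?_
      exact congrArg Subtype.val hxd') w hw'
  refine (Submodule.Quotient.mk_eq_zero _).mpr
    ⟨⟨η, (L.simplicial.mem_normalizedPart (by omega)).mpr hη⟩, ?_⟩
  refine L.simplicial.N_ext fun _ => ?_
  exact (L.simplicial.N_d_coe _ (by omega) _).trans hηx

theorem surjective_mapH {i : ℤ} (hi : i ≤ 0) : Function.Surjective (L.I_isHom.mapH i) := by
  intro y
  obtain ⟨⟨w, hw⟩, rfl⟩ := Submodule.Quotient.mk_surjective _ y
  have hw' : L.d i (i + 1) rfl w = 0 := hw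
  obtain ⟨ξ, hξ, hd, hξw⟩ := L.exists_cycle_integrateZ0_eq (n := (-i).toNat) (by omega) w
    (fun j hj => by subst hj; exact hw')
  let x : L.NL.X i := ⟨ξ, (L.simplicial.mem_normalizedPart hi).mpr hξ⟩
  have hx : L.NL.d i (i + 1) rfl x = 0 := by
    refine L.simplicial.N_ext fun hi' => ?_
    exact (L.simplicial.N_d_coe rfl (by omega) x).trans (hd _ _)
  refine ⟨Submodule.Quotient.mk ⟨x, hx⟩, ?_⟩
  refine congrArg Submodule.Quotient.mk (Subtype.ext ?_)
  exact (L.I_apply hi x).trans hξw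

theorem quasiIso_iff : L.I_isHom.QuasiIso ↔ ∀ i : ℤ, 0 < i → Subsingleton (L.H i) := by
  have hs : ∀ i : ℤ, 0 < i → Subsingleton (L.NL.H i) := fun i hi => by
    have := L.simplicial.N_subsingleton hi
    have : Subsingleton (L.NL.X i) := this
    infer_instance
  refine ⟨fun h i hi => ?_, fun h i => ?_⟩
  · have := hs i hi
    exact (h i).2.subsingleton
  · rcases le_or_gt i 0 with hi | hi
    · exact ⟨L.injective_mapH hi, L.surjective_mapH hi⟩
    · have := hs i hi
      have := h i hi
      exact ⟨Function.injective_of_subsingleton _, fun y => ⟨0, Subsingleton.elim _ _⟩⟩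

end CompleteDGLie

end LieDoldKan

theorem mainTheorem5 {k : Type u} [Field k] [CharZero k] :
    (∀ L : LieDoldKan.CompleteDGLie.{u, v} k,
      L.NL.IsDGLie ∧
      ∃ hI : LieDoldKan.DGLieData.IsHom L.NL L.toDGLieData L.I,
        (∀ i : ℤ, i ≤ 0 → Function.Bijective (hI.mapH i)) ∧
        (hI.QuasiIso ↔ ∀ i : ℤ, 0 < i → Subsingleton (L.H i))) ∧
    (∀ (L L' : LieDoldKan.CompleteDGLie.{u, v} k) (f : LieDoldKan.CompleteDGLie.Hom L L'),
      LieDoldKan.DGLieData.IsHom L.NL L'.NL f.mapNL ∧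
      ∀ (i : ℤ) (x : L.NL.X i), L'.I i (f.mapNL i x) = f.f i (L.I i x)) :=
  ⟨fun L => ⟨L.simplicial.N_isDGLie, L.I_isHom,
      fun _ hi => ⟨L.injective_mapH hi, L.surjective_mapH hi⟩, L.quasiIso_iff⟩,
    fun _ _ f => ⟨f.simplicialMap.mapN_isHom, f.I_mapNL⟩⟩
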